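/- Let $M$ be a smooth (Hausdorff, $\sigma$-compact) manifold with boundary of dimension $n\ge 1$, and let $\iota:\partial M\to M$ be the inclusion of its boundary. All functions are real-valued and smooth up to the boundary, and $C^\infty_M$ is the sheaf of smooth functions. Let $D_M$ be the sheaf of linear differential operators, that is, the sheaf of subalgebras of $\mathcal{E}nd_{\mathbb R}(C^\infty_M)$ that is locally generated by functions and vector fields; $D_{\partial M}$ is defined in the same way. Let $\mathcal D_M$ be the sheaf of distributions: $\mathcal D_M(U)$ is the space of continuous linear functionals on $C^\infty_{c}(U)$, where test functions need not vanish on $U\cap\partial M$. It is a sheaf of right $D_M$-modules by $(T\cdot P)(g)=T(Pg)$. Let $\Omega^{n-1}_{\partial M,tw}$ be the sheaf of smooth densities on $\partial M$, a sheaf of right $D_{\partial M}$-modules by formal adjoints: $\int_{\partial M} g\,(\nu\cdot Q)=\int_{\partial M}(Qg)\,\nu$ for test functions $g$. Regard $\iota_*\Omega^{n-1}_{\partial M,tw}$ as a subsheaf of $\mathcal D_M$ by letting $\nu\in\Omega^{n-1}_{\partial M,tw}(U\cap\partial M)$ act as $g\mapsto\int_{\partial M} g|_{\partial M}\,\nu$.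 Let $D_{\partial M\to M}=C^\infty_{\partial M}\otimes_{\iota^{-1}C^\infty_M}\iota^{-1}D_M$. It has the right $\iota^{-1}D_M$-module structure $(f\otimes D)\cdot P=f\otimes DP$. It also has a left $D_{\partial M}$-module structure that commutes with the right one and in which functions act by $h\cdot(f\otimes D)=hf\otimes D$ and vector fields $X$ on $\partial M$ act by $X\cdot(f\otimes D)=(Xf)\otimes D+f\otimes\widehat X D$, where $\widehat X$ is any vector field on $M$ that restricts to $X$ along $\partial M$ (these structures are well defined). The $D$-module pushforward of the boundary densities is the sheaf of right $D_M$-modules $$\iota_D\Omega^{n-1}_{\partial M,tw}=\iota_*\bigl(\Omega^{n-1}_{\partial M,tw}\otimes_{D_{\partial M}}D_{\partial M\to M}\bigr).$$ Let $\mathcal G\subseteq\mathcal D_M$ be the sheaf of right $D_M$-modules generated by $\iota_*\Omega^{n-1}_{\partial M,tw}$, that is, the smallest subsheaf of right $D_M$-modules of $\mathcal D_M$ that contains it. 1. There is an isomorphism of sheaves of right $D_M$-modules $\iota_D\Omega^{n-1}_{\partial M,tw}\to\mathcal G$ that sends $\nu\otimes f\otimes D$ to the distribution $g\mapsto\int_{\partial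 M} f\,(Dg)|_{\partial M}\,\nu$. 2. Let a tubular neighborhood of $\partial M$ be given, i.e. a diffeomorphism of $\partial M\times[0,\varepsilon)$ onto an open subset of $M$ that restricts to $\iota$ on $\partial M\times\{0\}$, and let $t$ be its normal coordinate. Then, for every open $U\subseteq M$, a distribution $T\in\mathcal D_M(U)$ lies in $\mathcal G(U)$ if and only if there are smooth densities $\nu_0,\nu_1,\nu_2,\dots$ on $U\cap\partial M$, forming a locally finite family (every point of $U\cap\partial M$ has a neighborhood on which all but finitely many $\nu_k$ vanish), such that $$T(g)=\sum_{k\ge 0}\int_{\partial M}(\partial_t^k g)|_{t=0}\,\nu_k\qquad\text{for all } g\in C^\infty_c(U).$$ -/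

import Mathlib

open Set Filter Topology TopologicalSpace Manifold MeasureTheory MulOpposite
open scoped ContDiff TensorProduct

noncomputable section

namespace BoundaryDensities

/-! ## Smooth functions, differential operators, distributions on a manifold with corners -/

section Generic

variable {E : Type*} [NormedAddCommGroup E] [NormedSpace ℝ E]
  {H : Type*} [TopologicalSpace H] (I : ModelWithCorners ℝ E H)
  {M : Type*} [TopologicalSpace M] [ChartedSpace H M]

/-- `C^∞(W)`, the algebra of real smooth functions on an open subset `W` of `M`
(smooth up to the boundary). -/
abbrev SmoothFn (W : Opens M) : Type _ := C^∞⟮I, W; 𝓘(ℝ, ℝ), ℝ⟯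

/-- Restriction of smooth functions. -/
def SmoothFn.res {W W' : Opens M} (h : W' ≤ W) : SmoothFn I W →ₐ[ℝ] SmoothFn I W' :=
  { ContMDiffMap.restrictRingHom (n := ∞) I 𝓘(ℝ, ℝ) ℝ h with
    commutes' := fun _ => rfl }

/-- Extension by zero of a function on an open subset. -/
def extendZero {W : Opens M} (f : W → ℝ) : M → ℝ :=
  open Classical in fun y => if h : y ∈ W then f ⟨y, h⟩ else 0

/-- `End_ℝ(C^∞_M)(U)`: the algebra of `ℝ`-linear endomorphisms of the sheaf `C^∞_M|_U`, that is, of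
families of linear endomorphisms of `C^∞(W)`, `W ⊆ U` open, that are compatible with restriction. -/
def sheafEndSubalgebra (U : Opens M) :
    Subalgebra ℝ (∀ W : {W : Opens M // W ≤ U}, Module.End ℝ (SmoothFn I W.1)) where
  carrier := {P | ∀ (W W' : {W : Opens M // W ≤ U}) (h : W'.1 ≤ W.1) (f : SmoothFn I W.1),
    P W' (SmoothFn.res I h f) = SmoothFn.res I h (P W f)}
  mul_mem' := by
    intro P Q hP hQ W W' h f
    simp only [Pi.mul_apply, Module.End.mul_apply]
    rw [hQ W W' h, hP W W' h]
  add_mem' := by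
    intro P Q hP hQ W W' h f
    simp only [Pi.add_apply, LinearMap.add_apply, map_add]
    rw [hQ W W' h, hP W W' h]
  algebraMap_mem' := by
    intro r W W' h f
    simp only [Pi.algebraMap_apply, Module.algebraMap_end_apply, map_smul]

/-- The algebra `End_ℝ(C^∞_M)(U)` as a type. -/
def SheafEnd (U : Opens M) : Type _ := sheafEndSubalgebra I U

instance (U : Opens M) : Ring (SheafEnd I U) := inferInstanceAs (Ring (sheafEndSubalgebra I U))

instance (U : Opens M) : Algebra ℝ (SheafEnd I U) :=
  inferInstanceAs (Algebra ℝ (sheafEndSubalgebra I U))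

/-- Restriction of sheaf endomorphisms to a smaller open set. -/
def SheafEnd.res {U U' : Opens M} (h : U' ≤ U) : SheafEnd I U →ₐ[ℝ] SheafEnd I U' where
  toFun P := ⟨fun W => P.1 ⟨W.1, W.2.trans h⟩, fun W W' hW f => P.2 ⟨W.1, _⟩ ⟨W'.1, _⟩ hW f⟩
  map_one' := rfl
  map_mul' _ _ := rfl
  map_zero' := rfl
  map_add' _ _ := rfl
  commutes' _ := rfl

variable {I} in
lemma SheafEnd.ext {U : Opens M} {P Q : SheafEnd I U}
    (h : ∀ (W : {W : Opens M // W ≤ U}) (f : SmoothFn I W.1) (x : W.1), P.1 W f x = Q.1 W f x) :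
    P = Q :=
  Subtype.ext <| funext fun W => LinearMap.ext fun f => DFunLike.ext _ _ fun x => h W f x

/-- Multiplication by a smooth function, as an endomorphism of the sheaf `C^∞_M|_U`. -/
def SheafEnd.mulFn (U : Opens M) : SmoothFn I U →ₐ[ℝ] SheafEnd I U where
  toFun f := ⟨fun W => LinearMap.mulLeft ℝ (SmoothFn.res I W.2 f), fun W W' h g => by
    simp only [LinearMap.mulLeft_apply, map_mul]; rfl⟩
  map_one' := SheafEnd.ext fun W g x => one_mul (g x)
  map_mul' f f' := SheafEnd.ext fun W g x => mul_assoc _ _ _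
  map_zero' := SheafEnd.ext fun W g x => zero_mul (g x)
  map_add' f f' := SheafEnd.ext fun W g x => add_mul _ _ _
  commutes' r := SheafEnd.ext fun W g x => rfl

/-- `P` is the derivation `f ↦ X f = df(X)` of `C^∞_M|_U` given by the vector field `X`, which
is smooth on `U`. -/
def IsVectorFieldOp [IsManifold I ∞ M] (U : Opens M) (X : ∀ x : M, TangentSpace I x)
    (P : SheafEnd I U) : Prop :=
  ContMDiffOn I I.tangent ∞ (fun x => (⟨x, X x⟩ : TangentBundle I M)) (U : Set M) ∧
  ∀ (W : {W : Opens M // W ≤ U}) (f : SmoothFn I W.1) (x : W.1),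
    P.1 W f x = mfderiv I 𝓘(ℝ, ℝ) (extendZero f) (x : M) (X x)

/-- The functions and the vector fields on `U`, as endomorphisms of `C^∞_M|_U`. -/
def diffOpGenerators [IsManifold I ∞ M] (U : Opens M) : Set (SheafEnd I U) :=
  Set.range (SheafEnd.mulFn I U) ∪ {P | ∃ X, IsVectorFieldOp I U X P}

lemma res_mem_diffOpGenerators [IsManifold I ∞ M] {U U' : Opens M} (h : U' ≤ U) {P : SheafEnd I U}
    (hP : P ∈ diffOpGenerators I U) : SheafEnd.res I h P ∈ diffOpGenerators I U' := by
  rcases hP with ⟨f, rfl⟩ | ⟨X, hX, hP⟩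
  · exact Or.inl ⟨SmoothFn.res I h f, rfl⟩
  · exact Or.inr ⟨X, hX.mono h, fun W f x => hP ⟨W.1, W.2.trans h⟩ f x⟩

lemma res_mem_adjoin [IsManifold I ∞ M] {U U' : Opens M} (h : U' ≤ U) {P : SheafEnd I U}
    (hP : P ∈ Algebra.adjoin ℝ (diffOpGenerators I U)) :
    SheafEnd.res I h P ∈ Algebra.adjoin ℝ (diffOpGenerators I U') := by
  have h1 : SheafEnd.res I h P ∈
      (Algebra.adjoin ℝ (diffOpGenerators I U)).map (SheafEnd.res I h) := ⟨P, hP, rfl⟩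
  rw [AlgHom.map_adjoin] at h1
  refine Algebra.adjoin_mono ?_ h1
  rintro _ ⟨Q, hQ, rfl⟩
  exact res_mem_diffOpGenerators I h hQ

/-- `D_M(U)`, the algebra of linear differential operators on `U`: `D_M` is the sheaf of
subalgebras of `End_ℝ(C^∞_M)` generated by the functions and the vector fields, so an endomorphism
belongs to `D_M(U)` if, locally, it is a polynomial in functions and vector fields. -/
def diffOpSubalgebra [IsManifold I ∞ M] (U : Opens M) : Subalgebra ℝ (SheafEnd I U) where
  carrier := {P | ∀ x ∈ U, ∃ (W : Opens M) (h : W ≤ U), x ∈ W ∧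
    SheafEnd.res I h P ∈ Algebra.adjoin ℝ (diffOpGenerators I W)}
  mul_mem' := by
    intro P Q hP hQ x hx
    obtain ⟨W₁, h₁, hx₁, hP⟩ := hP x hx
    obtain ⟨W₂, h₂, hx₂, hQ⟩ := hQ x hx
    refine ⟨W₁ ⊓ W₂, inf_le_left.trans h₁, ⟨hx₁, hx₂⟩, ?_⟩
    rw [map_mul]
    exact mul_mem (res_mem_adjoin I (inf_le_left : W₁ ⊓ W₂ ≤ W₁) hP)
      (res_mem_adjoin I (inf_le_right : W₁ ⊓ W₂ ≤ W₂) hQ)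
  add_mem' := by
    intro P Q hP hQ x hx
    obtain ⟨W₁, h₁, hx₁, hP⟩ := hP x hx
    obtain ⟨W₂, h₂, hx₂, hQ⟩ := hQ x hx
    refine ⟨W₁ ⊓ W₂, inf_le_left.trans h₁, ⟨hx₁, hx₂⟩, ?_⟩
    rw [map_add]
    exact add_mem (res_mem_adjoin I (inf_le_left : W₁ ⊓ W₂ ≤ W₁) hP)
      (res_mem_adjoin I (inf_le_right : W₁ ⊓ W₂ ≤ W₂) hQ)
  algebraMap_mem' := by
    intro r x hx
    refine ⟨U, le_rfl, hx, ?_⟩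
    rw [AlgHom.commutes]
    exact Subalgebra.algebraMap_mem _ r

variable [IsManifold I ∞ M]

/-- The algebra `D_M(U)` as a type. -/
def DiffOp (U : Opens M) : Type _ := diffOpSubalgebra I U

instance (U : Opens M) : Ring (DiffOp I U) := inferInstanceAs (Ring (diffOpSubalgebra I U))

instance (U : Opens M) : Algebra ℝ (DiffOp I U) :=
  inferInstanceAs (Algebra ℝ (diffOpSubalgebra I U))

/-- Restriction of differential operators. -/
def DiffOp.res {U U' : Opens M} (h : U' ≤ U) : DiffOp I U →ₐ[ℝ] DiffOp I U' :=
  ((SheafEnd.res I h).comp (diffOpSubalgebra I U).val).codRestrict (diffOpSubalgebra I U') (by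
    intro P x hx
    obtain ⟨W, hW, hxW, hP⟩ := P.2 x (h hx)
    exact ⟨W ⊓ U', inf_le_right, ⟨hxW, hx⟩, res_mem_adjoin I (inf_le_left : W ⊓ U' ≤ W) hP⟩)

/-- Smooth functions as differential operators of order zero. -/
def DiffOp.ofFn (U : Opens M) : SmoothFn I U →ₐ[ℝ] DiffOp I U :=
  (SheafEnd.mulFn I U).codRestrict (diffOpSubalgebra I U) (fun f _ hx =>
    ⟨U, le_rfl, hx, Algebra.subset_adjoin (Or.inl ⟨f, rfl⟩)⟩)

/-- The action of `D_M(U)` on `C^∞(U)`. -/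
def DiffOp.apply {U : Opens M} (P : DiffOp I U) : SmoothFn I U →ₗ[ℝ] SmoothFn I U :=
  P.1.1 ⟨U, le_rfl⟩

/-! ### Test functions and distributions -/

/-- `C^∞_c(U)`: the smooth functions with compact support contained in `U`, regarded as functions
on all of `M` that vanish outside of `U`. They need not vanish on the boundary of `M`. -/
def testFnSubmodule (U : Opens M) : Submodule ℝ C^∞⟮I, M; 𝓘(ℝ, ℝ), ℝ⟯ where
  carrier := {g | HasCompactSupport g ∧ tsupport g ⊆ U}
  zero_mem' := by
    refine ⟨HasCompactSupport.zero, ?_⟩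
    have : tsupport ((0 : C^∞⟮I, M; 𝓘(ℝ, ℝ), ℝ⟯) : M → ℝ) = ∅ := tsupport_eq_empty_iff.2 rfl
    rw [this]
    exact Set.empty_subset _
  add_mem' := by
    intro f g hf hg
    exact ⟨hf.1.add hg.1, (tsupport_add f g).trans (Set.union_subset hf.2 hg.2)⟩
  smul_mem' := by
    intro r f hf
    exact ⟨hf.1.smul_left (f := fun _ => r), (tsupport_smul_subset_right (fun _ => r) f).trans hf.2⟩

/-- The space `C^∞_c(U)` as a type. -/
def TestFn (U : Opens M) : Type _ := testFnSubmodule I U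

instance (U : Opens M) : AddCommGroup (TestFn I U) :=
  inferInstanceAs (AddCommGroup (testFnSubmodule I U))

instance (U : Opens M) : Module ℝ (TestFn I U) := inferInstanceAs (Module ℝ (testFnSubmodule I U))

instance (U : Opens M) : CoeFun (TestFn I U) (fun _ => M → ℝ) := ⟨fun g => g.1⟩

/-- The inclusion `C^∞_c(U') ⊆ C^∞_c(U)` for `U' ⊆ U` (extension by zero). -/
def TestFn.incl {U U' : Opens M} (h : U' ≤ U) : TestFn I U' →ₗ[ℝ] TestFn I U :=
  Submodule.inclusion (p := testFnSubmodule I U') (p' := testFnSubmodule I U) fun _ hg => ⟨hg.1, hg.2.trans h⟩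

/-- A test function on `U` as a smooth function on `U`. -/
def TestFn.toSmoothFn {U : Opens M} : TestFn I U →ₗ[ℝ] SmoothFn I U where
  toFun g := ⟨fun x => g.1 x, g.1.contMDiff.comp contMDiff_subtype_val⟩
  map_add' _ _ := rfl
  map_smul' _ _ := rfl

variable {I} in
lemma DiffOp.apply_eq_zero {U : Opens M} (P : DiffOp I U) (g : TestFn I U) (x : U)
    (hx : (x : M) ∉ tsupport g) : P.apply I (TestFn.toSmoothFn I g) x = 0 := by
  let W : Opens M := U ⊓ ⟨(tsupport g.1)ᶜ, (isClosed_tsupport _).isOpen_compl⟩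
  have hW : W ≤ U := inf_le_left
  have h0 : SmoothFn.res I hW (TestFn.toSmoothFn I g) = 0 := by
    ext y
    exact image_eq_zero_of_notMem_tsupport (f := g.1) y.2.2
  have h1 := P.1.2 ⟨U, le_rfl⟩ ⟨W, hW⟩ hW (TestFn.toSmoothFn I g)
  rw [h0, map_zero] at h1
  exact (DFunLike.congr_fun h1 (⟨x, x.2, hx⟩ : W)).symm

variable {I} in
lemma DiffOp.extendZero_eq_zero {U : Opens M} (P : DiffOp I U) (g : TestFn I U) (x : M)
    (hx : x ∉ tsupport g) : extendZero (P.apply I (TestFn.toSmoothFn I g)) x = 0 := by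
  unfold extendZero
  split_ifs with h
  · exact P.apply_eq_zero g ⟨x, h⟩ hx
  · rfl

variable {I} in
lemma DiffOp.tsupport_subset {U : Opens M} (P : DiffOp I U) (g : TestFn I U) :
    tsupport (extendZero (P.apply I (TestFn.toSmoothFn I g))) ⊆ tsupport g.1 := by
  refine closure_minimal (fun x hx => ?_) (isClosed_tsupport _)
  by_contra h
  exact hx (P.extendZero_eq_zero g x h)

variable {I} in
lemma extendZero_coe {U : Opens M} (f : U → ℝ) (x : U) : extendZero f (x : M) = f x := by
  unfold extendZero
  rw [dif_pos x.2]

variable {I} in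
lemma DiffOp.contMDiff_extendZero {U : Opens M} (P : DiffOp I U) (g : TestFn I U) :
    ContMDiff I 𝓘(ℝ, ℝ) ∞ (extendZero (P.apply I (TestFn.toSmoothFn I g))) := by
  refine contMDiff_of_tsupport fun x hx => ?_
  have hxU : x ∈ U := g.2.2 (P.tsupport_subset g hx)
  have h := (contMDiffAt_subtype_iff (I := I) (I' := 𝓘(ℝ, ℝ)) (n := ∞) (U := U)
    (f := extendZero (P.apply I (TestFn.toSmoothFn I g))) (x := ⟨x, hxU⟩)).1
  refine h ?_
  have : (fun y : U => extendZero (P.apply I (TestFn.toSmoothFn I g)) (y : M)) =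
      P.apply I (TestFn.toSmoothFn I g) := funext fun y => extendZero_coe _ y
  rw [this]
  exact (P.apply I (TestFn.toSmoothFn I g)).contMDiff.contMDiffAt

/-- The left action of `D_M(U)` on `C^∞_c(U)`. -/
instance (U : Opens M) : SMul (DiffOp I U) (TestFn I U) where
  smul P g := ⟨⟨extendZero (P.apply I (TestFn.toSmoothFn I g)), P.contMDiff_extendZero g⟩,
    g.2.1.mono' (subset_closure.trans (P.tsupport_subset g)), (P.tsupport_subset g).trans g.2.2⟩

variable {I} in
lemma TestFn.smul_apply {U : Opens M} (P : DiffOp I U) (g : TestFn I U) (x : U) :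
    (P • g).1 (x : M) = P.apply I (TestFn.toSmoothFn I g) x := extendZero_coe _ x

variable {I} in
lemma TestFn.ext_on {U : Opens M} {g g' : TestFn I U} (h : ∀ x : U, g.1 (x : M) = g'.1 (x : M)) :
    g = g' := by
  apply Subtype.ext
  ext x
  by_cases hx : x ∈ U
  · exact h ⟨x, hx⟩
  · rw [image_eq_zero_of_notMem_tsupport fun h => hx (g.2.2 h),
      image_eq_zero_of_notMem_tsupport fun h => hx (g'.2.2 h)]

variable {I} in
lemma TestFn.toSmoothFn_smul {U : Opens M} (P : DiffOp I U) (g : TestFn I U) :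
    TestFn.toSmoothFn I (P • g) = P.apply I (TestFn.toSmoothFn I g) := by
  ext x
  exact TestFn.smul_apply P g x

instance (U : Opens M) : Module (DiffOp I U) (TestFn I U) where
  one_smul g := TestFn.ext_on fun x => by rw [TestFn.smul_apply]; rfl
  mul_smul P Q g := TestFn.ext_on fun x => by
    rw [TestFn.smul_apply, TestFn.smul_apply, TestFn.toSmoothFn_smul]; rfl
  smul_zero P := TestFn.ext_on fun x => by
    rw [TestFn.smul_apply, map_zero, map_zero]; rfl
  smul_add P g g' := TestFn.ext_on fun x => by
    rw [TestFn.smul_apply, map_add, map_add]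
    exact congrArg₂ (· + ·) (TestFn.smul_apply P g x).symm (TestFn.smul_apply P g' x).symm
  add_smul P Q g := TestFn.ext_on fun x => by
    rw [TestFn.smul_apply]
    exact congrArg₂ (· + ·) (TestFn.smul_apply P g x).symm (TestFn.smul_apply Q g x).symm
  zero_smul g := TestFn.ext_on fun x => by rw [TestFn.smul_apply]; rfl

lemma TestFn.smul_real_smul {U : Opens M} (P : DiffOp I U) (r : ℝ) (g : TestFn I U) :
    P • (r • g) = r • (P • g) := TestFn.ext_on fun x => by
  rw [TestFn.smul_apply, map_smul, map_smul]
  exact congrArg (r * ·) (TestFn.smul_apply P g x).symm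

lemma TestFn.smul_incl {U U' : Opens M} (h : U' ≤ U) (P : DiffOp I U) (g : TestFn I U') :
    P • TestFn.incl I h g = TestFn.incl I h (DiffOp.res I h P • g) := by
  apply Subtype.ext
  ext x
  by_cases hx : x ∈ U'
  · rw [TestFn.smul_apply P _ ⟨x, h hx⟩]
    refine Eq.trans ?_ (TestFn.smul_apply (DiffOp.res I h P) g ⟨x, hx⟩).symm
    exact (DFunLike.congr_fun
      (P.1.2 ⟨U, le_rfl⟩ ⟨U', h⟩ h (TestFn.toSmoothFn I (TestFn.incl I h g))) ⟨x, hx⟩).symm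
  · have hg : x ∉ tsupport g := fun h' => hx (g.2.2 h')
    exact (P.extendZero_eq_zero (TestFn.incl I h g) x hg).trans
      ((DiffOp.res I h P).extendZero_eq_zero g x hg).symm

/-- `𝒟_M(U)`, the distributions on `U`: the linear functionals on `C^∞_c(U)` that are continuous on
`C^∞_K(U)` for every compact `K ⊆ U`, for the topology given by the seminorms `g ↦ sup |P g|`,
`P` a differential operator on `U`. -/
def distributionSubmodule (U : Opens M) : Submodule ℝ (TestFn I U →ₗ[ℝ] ℝ) where
  carrier := {T | ∀ K : Set M, IsCompact K → K ⊆ U → ∃ (s : Finset (DiffOp I U)) (C : ℝ),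
    ∀ g : TestFn I U, tsupport g.1 ⊆ K → ∀ b : ℝ, 0 ≤ b →
      (∀ P ∈ s, ∀ x : M, |(P • g).1 x| ≤ b) → |T g| ≤ C * b}
  zero_mem' := fun K _ _ => ⟨∅, 0, fun g _ b _ _ => by simp⟩
  add_mem' := by
    classical
    intro T T' hT hT' K hK hKU
    obtain ⟨s, C, h⟩ := hT K hK hKU
    obtain ⟨s', C', h'⟩ := hT' K hK hKU
    refine ⟨s ∪ s', C + C', fun g hg b hb hP => ?_⟩
    have h1 := h g hg b hb fun P hPs => hP P (Finset.mem_union_left _ hPs)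
    have h2 := h' g hg b hb fun P hPs => hP P (Finset.mem_union_right _ hPs)
    calc |(T + T') g| ≤ |T g| + |T' g| := abs_add_le _ _
      _ ≤ (C + C') * b := by linarith
  smul_mem' := by
    intro r T hT K hK hKU
    obtain ⟨s, C, h⟩ := hT K hK hKU
    refine ⟨s, |r| * C, fun g hg b hb hP => ?_⟩
    have h1 := h g hg b hb hP
    calc |(r • T) g| = |r| * |T g| := by simp [abs_mul]
      _ ≤ |r| * C * b := by
        rw [mul_assoc]
        exact mul_le_mul_of_nonneg_left h1 (abs_nonneg r)

/-- The space `𝒟_M(U)` as a type. -/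
def Distribution (U : Opens M) : Type _ := distributionSubmodule I U

instance (U : Opens M) : AddCommGroup (Distribution I U) :=
  inferInstanceAs (AddCommGroup (distributionSubmodule I U))

instance (U : Opens M) : Module ℝ (Distribution I U) :=
  inferInstanceAs (Module ℝ (distributionSubmodule I U))

instance (U : Opens M) : CoeFun (Distribution I U) (fun _ => TestFn I U → ℝ) := ⟨fun T => T.1⟩

/-- Restriction of distributions. -/
def Distribution.res {U U' : Opens M} (h : U' ≤ U) : Distribution I U →ₗ[ℝ] Distribution I U' where
  toFun T := ⟨T.1.comp (TestFn.incl I h), by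
    classical
    intro K hK hKU
    obtain ⟨s, C, hs⟩ := T.2 K hK (hKU.trans h)
    refine ⟨s.image (DiffOp.res I h), C, fun g hg b hb hP => ?_⟩
    refine hs (TestFn.incl I h g) hg b hb fun P hPs x => ?_
    rw [TestFn.smul_incl]
    exact hP _ (Finset.mem_image_of_mem _ hPs) x⟩
  map_add' _ _ := rfl
  map_smul' _ _ := rfl

/-- The right action of `D_M(U)` on the distributions on `U`: `(T · P)(g) = T(P g)`. -/
instance (U : Opens M) : SMul (DiffOp I U)ᵐᵒᵖ (Distribution I U) where
  smul P T := ⟨{ toFun := fun g => T.1 (unop P • g)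
                 map_add' := fun g g' => by rw [smul_add, map_add]
                 map_smul' := fun r g => by rw [TestFn.smul_real_smul, map_smul, RingHom.id_apply] },
    by
      classical
      intro K hK hKU
      obtain ⟨s, C, hs⟩ := T.2 K hK hKU
      refine ⟨s.image (· * unop P), C, fun g hg b hb hP => ?_⟩
      refine hs (unop P • g) (((unop P).tsupport_subset g).trans hg) b hb fun Q hQ x => ?_
      rw [← mul_smul]
      exact hP _ (Finset.mem_image_of_mem _ hQ) x⟩

lemma Distribution.op_smul_apply {U : Opens M} (P : DiffOp I U) (T : Distribution I U)
    (g : TestFn I U) : (op P • T) g = T (P • g) := rfl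

instance (U : Opens M) : Module (DiffOp I U)ᵐᵒᵖ (Distribution I U) where
  one_smul T := Subtype.ext <| LinearMap.ext fun g => congrArg T.1 (one_smul _ g)
  mul_smul P Q T := Subtype.ext <| LinearMap.ext fun g =>
    congrArg T.1 (mul_smul (unop Q) (unop P) g)
  smul_zero P := rfl
  smul_add P T T' := rfl
  add_smul P Q T := Subtype.ext <| LinearMap.ext fun g => by
    refine (congrArg T.1 (add_smul (unop P) (unop Q) g)).trans ?_
    rw [map_add]; rfl
  zero_smul T := Subtype.ext <| LinearMap.ext fun g => by
    refine (congrArg T.1 (zero_smul (DiffOp I U) g)).trans ?_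
    rw [map_zero]; rfl

/-! ### Sheaves of right `D_M`-submodules of the distributions -/

/-- `F` is a subsheaf of right `D_M`-modules of the sheaf of distributions `𝒟_M`. -/
structure IsSubmoduleSheaf
    (F : ∀ U : Opens M, Submodule (DiffOp I U)ᵐᵒᵖ (Distribution I U)) : Prop where
  res_mem : ∀ {U U' : Opens M} (h : U' ≤ U) (T : Distribution I U), T ∈ F U →
    Distribution.res I h T ∈ F U'
  mem_of_local : ∀ {U : Opens M} (T : Distribution I U),
    (∀ x ∈ U, ∃ (W : Opens M) (h : W ≤ U), x ∈ W ∧ Distribution.res I h T ∈ F W) → T ∈ F U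

/-- The sheaf of right `D_M`-modules generated inside `𝒟_M` by a family `S` of distributions: the
smallest subsheaf of right `D_M`-modules of `𝒟_M` that contains `S`. -/
def generatedSheaf (S : ∀ U : Opens M, Set (Distribution I U)) (U : Opens M) :
    Submodule (DiffOp I U)ᵐᵒᵖ (Distribution I U) :=
  sInf {N | ∃ F, IsSubmoduleSheaf I F ∧ (∀ U', S U' ⊆ F U') ∧ N = F U}

/-- Restriction of sections of the generated sheaf. -/
def generatedSheaf.res (S : ∀ U : Opens M, Set (Distribution I U)) {U U' : Opens M} (h : U' ≤ U)
    (T : generatedSheaf I S U) : generatedSheaf I S U' :=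
  ⟨Distribution.res I h T.1, by
    have hT := T.2
    simp only [generatedSheaf, Submodule.mem_sInf] at hT ⊢
    rintro _ ⟨F, hF, hS, rfl⟩
    exact hF.res_mem h _ (hT _ ⟨F, hF, hS, rfl⟩)⟩

/-! ### Smooth densities -/

section Density

/-- `Ω^{top}_{tw}(V)`, the smooth densities on an open subset `V`. A density is given by its
coefficient functions `ρ i` in the charts at the points `i`, defined on `V ∩ (chartAt H i).source`
(and set to be `0` elsewhere), which are smooth and transform with the absolute value of the
Jacobian determinant of the coordinate changes. -/
def densitySubmodule (V : Opens M) : Submodule ℝ (M → M → ℝ) where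
  carrier := {ρ |
    (∀ i x, x ∉ (V : Set M) ∩ (chartAt H i).source → ρ i x = 0) ∧
    (∀ i, ContMDiffOn I 𝓘(ℝ, ℝ) ∞ (ρ i) ((V : Set M) ∩ (chartAt H i).source)) ∧
    ∀ i j x, x ∈ V → x ∈ (chartAt H i).source → x ∈ (chartAt H j).source →
      ρ i x = |(tangentCoordChange I i j x).det| * ρ j x}
  zero_mem' := ⟨fun _ _ _ => rfl, fun _ => contMDiffOn_const, fun _ _ _ _ _ _ => by simp⟩
  add_mem' := by
    rintro ρ ρ' ⟨h1, h2, h3⟩ ⟨h1', h2', h3'⟩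
    refine ⟨fun i x hx => ?_, fun i => (h2 i).add (h2' i), fun i j x hx hi hj => ?_⟩
    · simp [h1 i x hx, h1' i x hx]
    · simp only [Pi.add_apply]
      rw [h3 i j x hx hi hj, h3' i j x hx hi hj, mul_add]
  smul_mem' := by
    rintro r ρ ⟨h1, h2, h3⟩
    refine ⟨fun i x hx => ?_, fun i => contMDiffOn_const.mul (h2 i), fun i j x hx hi hj => ?_⟩
    · simp [h1 i x hx]
    · simp only [Pi.smul_apply, smul_eq_mul]
      rw [h3 i j x hx hi hj]
      ring

/-- The space `Ω^{top}_{tw}(V)` as a type. -/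
def Density (V : Opens M) : Type _ := densitySubmodule I V

instance (V : Opens M) : AddCommGroup (Density I V) :=
  inferInstanceAs (AddCommGroup (densitySubmodule I V))

instance (V : Opens M) : Module ℝ (Density I V) :=
  inferInstanceAs (Module ℝ (densitySubmodule I V))

/-- Restriction of densities. -/
def Density.res {V V' : Opens M} (h : V' ≤ V) : Density I V →ₗ[ℝ] Density I V' where
  toFun ρ := ⟨fun i => (V' : Set M).indicator (ρ.1 i), by
    obtain ⟨h1, h2, h3⟩ := ρ.2
    refine ⟨fun i x hx => ?_, fun i => ?_, fun i j x hx hi hj => ?_⟩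
    · beta_reduce
      by_cases hV : x ∈ (V' : Set M)
      · rw [Set.indicator_of_mem hV]
        exact h1 i x fun hx' => hx ⟨hV, hx'.2⟩
      · exact Set.indicator_of_notMem hV _
    · exact ((h2 i).mono (Set.inter_subset_inter_left _ h)).congr
        fun x hx => Set.indicator_of_mem hx.1 _
    · beta_reduce
      rw [Set.indicator_of_mem (show x ∈ (V' : Set M) from hx),
        Set.indicator_of_mem (show x ∈ (V' : Set M) from hx)]
      exact h3 i j x (h hx) hi hj⟩
  map_add' ρ ρ' := by
    apply Subtype.ext
    funext i
    exact Set.indicator_add _ _ _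
  map_smul' r ρ := by
    apply Subtype.ext
    funext i
    exact Set.indicator_const_smul (V' : Set M) r (ρ.1 i)

variable [FiniteDimensional ℝ E] [MeasureSpace E] [SigmaCompactSpace M] [T2Space M]

variable (M) in
/-- A smooth partition of unity subordinate to the domains of the charts of `M`. -/
def chartPartition : SmoothPartitionOfUnity M I M univ :=
  (SmoothPartitionOfUnity.exists_isSubordinate_chartAt_source I M).choose

/-- The integral `∫ g ν` of a function `g` (smooth, with compact support in `V`) against a density
`ν` on `V`, computed in charts by a partition of unity. -/
def Density.integral {V : Opens M} (ν : Density I V) (g : M → ℝ) : ℝ :=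
  ∑ᶠ i : M, ∫ y in (extChartAt I i).target,
    chartPartition I M i ((extChartAt I i).symm y) *
      (g ((extChartAt I i).symm y) * ν.1 i ((extChartAt I i).symm y))

end Density

/-! ### Stalks -/

section Stalks

instance (x : M) : DirectedSystem (fun U : (OpenNhdsOf x)ᵒᵈ => SmoothFn I (OrderDual.ofDual U).1)
    (fun _ _ h => SmoothFn.res I h) where
  map_self _ _ := rfl
  map_map _ _ _ _ _ _ := rfl

instance (x : M) : DirectedSystem (fun U : (OpenNhdsOf x)ᵒᵈ => DiffOp I (OrderDual.ofDual U).1)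
    (fun _ _ h => DiffOp.res I h) where
  map_self _ _ := rfl
  map_map _ _ _ _ _ _ := rfl

instance (x : M) : DirectedSystem (fun U : (OpenNhdsOf x)ᵒᵈ => Density I (OrderDual.ofDual U).1)
    (fun _ _ h => Density.res I h) where
  map_self U ρ := by
    refine Subtype.ext (funext fun i => ?_)
    refine Set.indicator_eq_self.2 fun y hy => ?_
    by_contra hyU
    exact hy (ρ.2.1 i y fun h => hyU h.1)
  map_map U V W hij hjk ρ := by
    refine Subtype.ext (funext fun i => ?_)
    refine (Set.indicator_indicator _ _ _).trans ?_
    exact congrArg (fun s : Set M => s.indicator (ρ.1 i)) (Set.inter_eq_left.2 hjk)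

/-- `C^∞_{M,x}`, the algebra of germs of smooth functions at `x`. -/
def FnStalk (x : M) : Type _ :=
  DirectLimit (fun U : (OpenNhdsOf x)ᵒᵈ => SmoothFn I (OrderDual.ofDual U).1)
    (fun _ _ h => SmoothFn.res I h)

/-- `D_{M,x}`, the ring of germs of differential operators at `x`. -/
def DiffOpStalk (x : M) : Type _ :=
  DirectLimit (fun U : (OpenNhdsOf x)ᵒᵈ => DiffOp I (OrderDual.ofDual U).1)
    (fun _ _ h => DiffOp.res I h)

/-- `Ω^{top}_{tw,x}`, the space of germs of smooth densities at `x`. -/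
def DensityStalk (x : M) : Type _ :=
  DirectLimit (fun U : (OpenNhdsOf x)ᵒᵈ => Density I (OrderDual.ofDual U).1)
    (fun _ _ h => Density.res I h)

instance (x : M) : CommRing (FnStalk I x) :=
  DirectLimit.instCommRingOfRingHomClass

instance (x : M) : Ring (DiffOpStalk I x) :=
  DirectLimit.instRingOfRingHomClass

instance (x : M) : AddCommGroup (DensityStalk I x) :=
  DirectLimit.instAddCommGroupOfAddMonoidHomClass

/-- The germ at `x` of a smooth function. -/
def FnStalk.germ {U : Opens M} (x : M) (hx : x ∈ U) : SmoothFn I U →+* FnStalk I x :=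
  DirectLimit.Ring.of (fun U : (OpenNhdsOf x)ᵒᵈ => SmoothFn I (OrderDual.ofDual U).1)
    (fun _ _ h => SmoothFn.res I h) (OrderDual.toDual ⟨U, hx⟩)

/-- The germ at `x` of a differential operator. -/
def DiffOpStalk.germ {U : Opens M} (x : M) (hx : x ∈ U) : DiffOp I U →+* DiffOpStalk I x :=
  DirectLimit.Ring.of (fun U : (OpenNhdsOf x)ᵒᵈ => DiffOp I (OrderDual.ofDual U).1)
    (fun _ _ h => DiffOp.res I h) (OrderDual.toDual ⟨U, hx⟩)

/-- The germ at `x` of a density. -/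
def DensityStalk.germ {U : Opens M} (x : M) (hx : x ∈ U) (ν : Density I U) : DensityStalk I x :=
  Quotient.mk _ ⟨OrderDual.toDual ⟨U, hx⟩, ν⟩

lemma FnStalk.germ_res {U W : Opens M} (h : W ≤ U) (x : M) (hx : x ∈ W) (f : SmoothFn I U) :
    FnStalk.germ I x hx (SmoothFn.res I h f) = FnStalk.germ I x (h hx) f :=
  DirectLimit.mk_apply (F := fun U : (OpenNhdsOf x)ᵒᵈ => SmoothFn I (OrderDual.ofDual U).1)
    (f := fun _ _ h => SmoothFn.res I h) (OrderDual.toDual ⟨U, h hx⟩) (OrderDual.toDual ⟨W, hx⟩) f h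

lemma DiffOpStalk.germ_res {U W : Opens M} (h : W ≤ U) (x : M) (hx : x ∈ W) (P : DiffOp I U) :
    DiffOpStalk.germ I x hx (DiffOp.res I h P) = DiffOpStalk.germ I x (h hx) P :=
  DirectLimit.mk_apply (F := fun U : (OpenNhdsOf x)ᵒᵈ => DiffOp I (OrderDual.ofDual U).1)
    (f := fun _ _ h => DiffOp.res I h) (OrderDual.toDual ⟨U, h hx⟩) (OrderDual.toDual ⟨W, hx⟩) P h

lemma DensityStalk.germ_res {U W : Opens M} (h : W ≤ U) (x : M) (hx : x ∈ W) (ν : Density I U) :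
    DensityStalk.germ I x hx (Density.res I h ν) = DensityStalk.germ I x (h hx) ν :=
  DirectLimit.mk_apply (F := fun U : (OpenNhdsOf x)ᵒᵈ => Density I (OrderDual.ofDual U).1)
    (f := fun _ _ h => Density.res I h) (OrderDual.toDual ⟨U, h hx⟩) (OrderDual.toDual ⟨W, hx⟩) ν h

/-- The inclusion `C^∞_{M,x} → D_{M,x}`. -/
def DiffOpStalk.ofFn (x : M) : FnStalk I x →+* DiffOpStalk I x :=
  DirectLimit.Ring.lift (fun U : (OpenNhdsOf x)ᵒᵈ => SmoothFn I (OrderDual.ofDual U).1)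
    (fun _ _ h => SmoothFn.res I h) (DiffOpStalk I x)
    (fun U => (DiffOpStalk.germ I x (OrderDual.ofDual U).2).comp
      (DiffOp.ofFn I (OrderDual.ofDual U).1).toRingHom)
    (fun U V h f => DiffOpStalk.germ_res I (U := (OrderDual.ofDual U).1)
      (W := (OrderDual.ofDual V).1) h x (OrderDual.ofDual V).2 (DiffOp.ofFn I _ f))

/-- `D_{M,x}` as a left module over `C^∞_{M,x}`. -/
instance (x : M) : Module (FnStalk I x) (DiffOpStalk I x) :=
  Module.compHom _ (DiffOpStalk.ofFn I x)

instance (x : M) : SMulCommClass (FnStalk I x) (DiffOpStalk I x)ᵐᵒᵖ (DiffOpStalk I x) where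
  smul_comm f P D := (mul_assoc (DiffOpStalk.ofFn I x f) D (unop P)).symm

end Stalks

end Generic

/-! ## The inclusion of the boundary and the push-forward of right `D`-modules -/

section Boundary

variable {E : Type*} [NormedAddCommGroup E] [NormedSpace ℝ E]
  {H : Type*} [TopologicalSpace H] {I : ModelWithCorners ℝ E H}
  {M : Type*} [TopologicalSpace M] [ChartedSpace H M] [IsManifold I ∞ M]
  {E' : Type*} [NormedAddCommGroup E'] [NormedSpace ℝ E']
  {H' : Type*} [TopologicalSpace H'] {J : ModelWithCorners ℝ E' H'}
  {N : Type*} [TopologicalSpace N] [ChartedSpace H' N] [IsManifold J ∞ N]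
  (ι : C^∞⟮J, N; I, M⟯)

/-- `ι⁻¹(U)`. -/
def preim (U : Opens M) : Opens N := ⟨ι ⁻¹' U, U.2.preimage ι.contMDiff.continuous⟩

/-- `f ↦ f ∘ ι`, from `C^∞_M(U)` to `C^∞_N(ι⁻¹ U)`. -/
def pullFn (U : Opens M) : SmoothFn I U →+* SmoothFn J (preim ι U) where
  toFun f := ⟨fun x => f ⟨ι x, x.2⟩, f.contMDiff.comp
    ((ContMDiff.subtypeVal_comp_iff U (fun x : preim ι U => (⟨ι x, x.2⟩ : U))).1
      (ι.contMDiff.comp contMDiff_subtype_val))⟩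
  map_one' := rfl
  map_mul' _ _ := rfl
  map_zero' := rfl
  map_add' _ _ := rfl

/-- `f ↦ f ∘ ι` on germs: `(ι⁻¹ C^∞_M)_x = C^∞_{M,ι(x)} → C^∞_{N,x}`. -/
def pullStalk (x : N) : FnStalk I (ι x) →+* FnStalk J x :=
  DirectLimit.Ring.lift (fun U : (OpenNhdsOf (ι x))ᵒᵈ => SmoothFn I (OrderDual.ofDual U).1)
    (fun _ _ h => SmoothFn.res I h) (FnStalk J x)
    (fun U => (FnStalk.germ J (U := preim ι (OrderDual.ofDual U).1) x (OrderDual.ofDual U).2).comp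
      (pullFn ι (OrderDual.ofDual U).1))
    (fun U V h f => FnStalk.germ_res J (U := preim ι (OrderDual.ofDual U).1)
      (W := preim ι (OrderDual.ofDual V).1) (fun _ hy => h hy) x (OrderDual.ofDual V).2
      (pullFn ι _ f))

/-- `C^∞_{N,x}`, regarded as a module over `(ι⁻¹ C^∞_M)_x = C^∞_{M,ι(x)}`. -/
def PullFnStalk (_ι : C^∞⟮J, N; I, M⟯) (x : N) : Type _ := FnStalk J x

instance (x : N) : CommRing (PullFnStalk ι x) := inferInstanceAs (CommRing (FnStalk J x))

instance (x : N) : Module (FnStalk I (ι x)) (PullFnStalk ι x) :=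
  Module.compHom (FnStalk J x) (pullStalk ι x)

/-- The stalk at `x` of `D_{N → M} = C^∞_N ⊗_{ι⁻¹ C^∞_M} ι⁻¹ D_M`, that is, the tensor product of
`C^∞_{N,x}` and `D_{M,ι(x)}` over `C^∞_{M,ι(x)}` (written with the two factors in the opposite
order). -/
def TransferStalk (x : N) : Type _ :=
  DiffOpStalk I (ι x) ⊗[FnStalk I (ι x)] PullFnStalk ι x

instance (x : N) : AddCommGroup (TransferStalk ι x) :=
  Module.addCommMonoidToAddCommGroup
    (M := DiffOpStalk I (ι x) ⊗[FnStalk I (ι x)] PullFnStalk ι x) (FnStalk I (ι x))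

/-- The right `D_{M,ι(x)}`-module structure of `D_{N → M}`: `(f ⊗ D) · P = f ⊗ (D P)`. -/
instance (x : N) : Module (DiffOpStalk I (ι x))ᵐᵒᵖ (TransferStalk ι x) :=
  TensorProduct.leftModule

/-- The element `f ⊗ D` of the stalk of `D_{N → M}`. -/
def TransferStalk.tmul (x : N) (f : FnStalk J x) (D : DiffOpStalk I (ι x)) : TransferStalk ι x :=
  TensorProduct.tmul (FnStalk I (ι x)) D (show PullFnStalk ι x from f)

/-- The given left `D_N`-module structure on `D_{N → M}` is the one of the pullback connection:
functions act by `h · (f ⊗ D) = (h f) ⊗ D`, a vector field `X` on `N` acts by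
`X · (f ⊗ D) = (X f) ⊗ D + f ⊗ (X̂ D)` where `X̂` is any vector field on `M` that
restricts to `X` along `ι`, and the action commutes with the right action of `ι⁻¹ D_M`. -/
structure IsPullbackConnection [∀ x : N, Module (DiffOpStalk J x) (TransferStalk ι x)] :
    Prop where
  fn_smul : ∀ (x : N) (h f : FnStalk J x) (D : DiffOpStalk I (ι x)),
    DiffOpStalk.ofFn J x h • TransferStalk.tmul ι x f D = TransferStalk.tmul ι x (h * f) D
  vectorField_smul : ∀ (U : Opens M) (x : N) (hx : x ∈ preim ι U)
    (X : ∀ y : N, TangentSpace J y) (X' : ∀ y : M, TangentSpace I y)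
    (P : DiffOp J (preim ι U)) (P' : DiffOp I U),
    IsVectorFieldOp J (preim ι U) X P.1 → IsVectorFieldOp I U X' P'.1 →
    (∀ y ∈ preim ι U, X' (ι y) = mfderiv J I ι y (X y)) →
    ∀ (f : SmoothFn J (preim ι U)) (D : DiffOpStalk I (ι x)),
      DiffOpStalk.germ J x hx P • TransferStalk.tmul ι x (FnStalk.germ J x hx f) D =
        TransferStalk.tmul ι x (FnStalk.germ J x hx (P.apply J f)) D +
        TransferStalk.tmul ι x (FnStalk.germ J x hx f) (DiffOpStalk.germ I (ι x) hx P' * D)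
  smul_comm : ∀ (x : N) (Q : DiffOpStalk J x) (P : DiffOpStalk I (ι x)) (t : TransferStalk ι x),
    Q • (op P • t) = op P • (Q • t)

/-- The given right `D_N`-module structure on the densities of `N` is the one by formal adjoints:
`∫ g (ν · Q) = ∫ (Q g) ν` for all test functions `g`. -/
def IsFormalAdjointAction [FiniteDimensional ℝ E'] [MeasureSpace E'] [SigmaCompactSpace N]
    [T2Space N] [∀ x : N, Module (DiffOpStalk J x)ᵐᵒᵖ (DensityStalk J x)] : Prop :=
  ∀ (V : Opens N) (ν : Density J V) (Q : DiffOp J V), ∃ ν' : Density J V,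
    (∀ g : TestFn J V, ν'.integral J g = ν.integral J ((Q • g : TestFn J V) : N → ℝ)) ∧
    ∀ (x : N) (hx : x ∈ V), op (DiffOpStalk.germ J x hx Q) • DensityStalk.germ J x hx ν =
      DensityStalk.germ J x hx ν'

/-! ### The push-forward `ι_D Ω_N` -/

section PushForward

variable [∀ x : N, Module (DiffOpStalk J x)ᵐᵒᵖ (DensityStalk J x)]
  [∀ x : N, Module (DiffOpStalk J x) (TransferStalk ι x)]

/-- The relations `ν Q ⊗ t = ν ⊗ Q t`, `Q ∈ D_{N,x}`, that define the tensor product over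
`D_{N,x}` (the two factors are written in the opposite order). -/
def balancingRelations (x : N) :
    Submodule (DiffOpStalk I (ι x))ᵐᵒᵖ (TransferStalk ι x ⊗[ℤ] DensityStalk J x) :=
  Submodule.span _ {z | ∃ (t : TransferStalk ι x) (Q : DiffOpStalk J x) (ν : DensityStalk J x),
    z = t ⊗ₜ[ℤ] (op Q • ν) - (Q • t) ⊗ₜ[ℤ] ν}

/-- The stalk at `x` of `Ω_N ⊗_{D_N} D_{N → M}`, a right `D_{M,ι(x)}`-module. -/
def PushStalk (x : N) : Type _ :=
  (TransferStalk ι x ⊗[ℤ] DensityStalk J x) ⧸ balancingRelations ι x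

instance (x : N) : AddCommGroup (PushStalk ι x) :=
  inferInstanceAs (AddCommGroup ((TransferStalk ι x ⊗[ℤ] DensityStalk J x) ⧸
    balancingRelations ι x))

instance (x : N) : Module (DiffOpStalk I (ι x))ᵐᵒᵖ (PushStalk ι x) :=
  inferInstanceAs (Module (DiffOpStalk I (ι x))ᵐᵒᵖ
    ((TransferStalk ι x ⊗[ℤ] DensityStalk J x) ⧸ balancingRelations ι x))

/-- The element `ν ⊗ (f ⊗ D)` of the stalk of `Ω_N ⊗_{D_N} D_{N → M}`. -/
def PushStalk.tmul (x : N) (ν : DensityStalk J x) (f : FnStalk J x) (D : DiffOpStalk I (ι x)) :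
    PushStalk ι x :=
  Submodule.Quotient.mk (p := balancingRelations ι x) (TransferStalk.tmul ι x f D ⊗ₜ[ℤ] ν)

lemma PushStalk.op_smul_tmul (x : N) (ν : DensityStalk J x) (f : FnStalk J x)
    (D P : DiffOpStalk I (ι x)) :
    op P • PushStalk.tmul ι x ν f D = PushStalk.tmul ι x ν f (D * P) := rfl

/-- Families of germs of `Ω_N ⊗_{D_N} D_{N → M}` over `ι⁻¹(U)`. -/
def GermFamily (U : Opens M) : Type _ := ∀ x : preim ι U, PushStalk ι (x : N)

instance (U : Opens M) : AddCommGroup (GermFamily ι U) :=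
  inferInstanceAs (AddCommGroup (∀ x : preim ι U, PushStalk ι (x : N)))

/-- `D_M(U)` acts from the right on families of germs through its germs at the points `ι(x)`. -/
instance (U : Opens M) : SMul (DiffOp I U)ᵐᵒᵖ (GermFamily ι U) where
  smul P s := fun x => op (DiffOpStalk.germ I (ι x) x.2 (unop P)) • s x

lemma GermFamily.smul_apply {U : Opens M} (P : (DiffOp I U)ᵐᵒᵖ) (s : GermFamily ι U)
    (x : preim ι U) : (P • s) x = op (DiffOpStalk.germ I (ι x) x.2 (unop P)) • s x := rfl

lemma GermFamily.add_apply {U : Opens M} (s s' : GermFamily ι U) (x : preim ι U) :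
    (s + s') x = s x + s' x := rfl

instance (U : Opens M) : Module (DiffOp I U)ᵐᵒᵖ (GermFamily ι U) where
  one_smul s := funext fun x => by
    rw [GermFamily.smul_apply, unop_one, map_one, op_one, one_smul]
  mul_smul P Q s := funext fun x => by
    simp only [GermFamily.smul_apply]
    rw [unop_mul, map_mul, op_mul, mul_smul]
  smul_zero P := funext fun x => smul_zero (op (DiffOpStalk.germ I (ι x) x.2 (unop P)))
  smul_add P s s' := funext fun x => by
    simp only [GermFamily.smul_apply, GermFamily.add_apply]
    rw [smul_add]
  add_smul P Q s := funext fun x => by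
    simp only [GermFamily.smul_apply, GermFamily.add_apply]
    rw [unop_add, map_add, op_add, add_smul]
  zero_smul s := funext fun x => by
    rw [GermFamily.smul_apply, unop_zero, map_zero, op_zero, zero_smul]
    rfl

/-- Restriction of families of germs. -/
def GermFamily.res {U U' : Opens M} (h : U' ≤ U) : GermFamily ι U →+ GermFamily ι U' where
  toFun s := fun x => s ⟨x, h x.2⟩
  map_zero' := rfl
  map_add' _ _ := rfl

/-- The family of germs of `ν ⊗ (f ⊗ D)`. -/
def GermFamily.tmul {U : Opens M} (ν : Density J (preim ι U)) (f : SmoothFn J (preim ι U))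
    (D : DiffOp I U) : GermFamily ι U := fun x =>
  PushStalk.tmul ι x (DensityStalk.germ J (x : N) x.2 ν) (FnStalk.germ J (x : N) x.2 f)
    (DiffOpStalk.germ I (ι x) x.2 D)

/-- Finite sums of sections `ν ⊗ (f ⊗ D)`, `ν ∈ Ω_N(ι⁻¹ U)`, `f ∈ C^∞(ι⁻¹ U)`, `D ∈ D_M(U)`. -/
def tensorSections (U : Opens M) : AddSubgroup (GermFamily ι U) :=
  AddSubgroup.closure {s | ∃ ν f D, s = GermFamily.tmul ι (U := U) ν f D}

lemma tensorSections_res {U U' : Opens M} (h : U' ≤ U) {s : GermFamily ι U}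
    (hs : s ∈ tensorSections ι U) : GermFamily.res ι h s ∈ tensorSections ι U' := by
  have h1 : GermFamily.res ι h s ∈ (tensorSections ι U).map (GermFamily.res ι h) := ⟨s, hs, rfl⟩
  unfold tensorSections at h1
  rw [AddMonoidHom.map_closure] at h1
  refine (AddSubgroup.closure_mono ?_) h1
  rintro _ ⟨_, ⟨ν, f, D, rfl⟩, rfl⟩
  have h' : preim ι U' ≤ preim ι U := fun _ hy => h hy
  refine ⟨Density.res J h' ν, SmoothFn.res J h' f,
    DiffOp.res I h D, funext fun x => ?_⟩
  have h1 := DensityStalk.germ_res J h' x x.2 ν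
  have h2 := FnStalk.germ_res J h' x x.2 f
  have h3 := DiffOpStalk.germ_res I h (ι x) x.2 D
  exact (congr (congr (congrArg (PushStalk.tmul ι (x : N)) h1) h2) h3).symm

lemma tensorSections_smul {U : Opens M} (P : (DiffOp I U)ᵐᵒᵖ) {s : GermFamily ι U}
    (hs : s ∈ tensorSections ι U) : P • s ∈ tensorSections ι U := by
  induction hs using AddSubgroup.closure_induction with
  | mem s hs =>
    obtain ⟨ν, f, D, rfl⟩ := hs
    refine AddSubgroup.subset_closure ⟨ν, f, D * unop P, funext fun x => ?_⟩
    rw [GermFamily.smul_apply]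
    refine (PushStalk.op_smul_tmul ι (x : N) _ _ _ _).trans ?_
    rw [← map_mul]
    rfl
  | zero => rw [smul_zero]; exact zero_mem _
  | add s s' _ _ h h' => rw [smul_add]; exact add_mem h h'
  | neg s _ h => rw [smul_neg]; exact neg_mem h

/-- `(ι_D Ω_N)(U) = (Ω_N ⊗_{D_N} D_{N → M})(ι⁻¹ U)` as a right `D_M(U)`-module: the families of
germs that are locally finite sums of sections `ν ⊗ (f ⊗ D)`. -/
def pushforward (U : Opens M) : Submodule (DiffOp I U)ᵐᵒᵖ (GermFamily ι U) where
  carrier := {s | ∀ x ∈ preim ι U, ∃ (W : Opens M) (h : W ≤ U), x ∈ preim ι W ∧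
    GermFamily.res ι h s ∈ tensorSections ι W}
  zero_mem' := fun x hx => ⟨U, le_rfl, hx, zero_mem _⟩
  add_mem' := by
    intro s s' hs hs' x hx
    obtain ⟨W, h, hxW, hW⟩ := hs x hx
    obtain ⟨W', h', hxW', hW'⟩ := hs' x hx
    exact ⟨W ⊓ W', inf_le_left.trans h, ⟨hxW, hxW'⟩,
      add_mem (tensorSections_res ι (inf_le_left : W ⊓ W' ≤ W) hW)
        (tensorSections_res ι (inf_le_right : W ⊓ W' ≤ W') hW')⟩
  smul_mem' := by
    intro P s hs x hx
    obtain ⟨W, h, hxW, hW⟩ := hs x hx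
    refine ⟨W, h, hxW, ?_⟩
    have h1 := tensorSections_smul ι (op (DiffOp.res I h (unop P))) hW
    have h2 : GermFamily.res ι h (P • s) =
        op (DiffOp.res I h (unop P)) • GermFamily.res ι h s := funext fun y => by
      rw [GermFamily.smul_apply, MulOpposite.unop_op, DiffOpStalk.germ_res I h (ι y) y.2 (unop P)]
      rfl
    rw [h2]
    exact h1

/-- Restriction of sections of `ι_D Ω_N`. -/
def pushforward.res {U U' : Opens M} (h : U' ≤ U) (s : pushforward ι U) : pushforward ι U' :=
  ⟨GermFamily.res ι h s.1, fun x hx => by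
    obtain ⟨W, hW, hxW, hs⟩ := s.2 x (h hx)
    exact ⟨W ⊓ U', inf_le_right, ⟨hxW, hx⟩,
      tensorSections_res ι (inf_le_left : W ⊓ U' ≤ W) hs⟩⟩

/-- The section of `ι_D Ω_N` defined by `ν ⊗ (f ⊗ D)`. -/
def pushforward.tmul {U : Opens M} (ν : Density J (preim ι U)) (f : SmoothFn J (preim ι U))
    (D : DiffOp I U) : pushforward ι U :=
  ⟨GermFamily.tmul ι ν f D, fun _ hx => ⟨U, le_rfl, hx, AddSubgroup.subset_closure ⟨ν, f, D, rfl⟩⟩⟩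

end PushForward

/-! ### Distributions supported on the boundary -/

section BoundaryDistributions

variable [FiniteDimensional ℝ E'] [MeasureSpace E'] [SigmaCompactSpace N] [T2Space N]

/-- `ι_* Ω_N` inside `𝒟_M`: the distributions `g ↦ ∫_N (g ∘ ι) ν` on `U`, for the densities `ν` on
`ι⁻¹(U)`. -/
def boundaryDensities (U : Opens M) : Set (Distribution I U) :=
  {T | ∃ ν : Density J (preim ι U), ∀ g : TestFn I U, T g = ν.integral J (fun x => g (ι x))}

end BoundaryDistributions

/-- A tubular neighborhood of the boundary: a diffeomorphism `toFun` from `N × [0, ε)` onto an open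
subset of `M`, with inverse `inv`, that restricts to `ι` on `N × {0}`. -/
structure Collar where
  ε : ℝ
  ε_pos : 0 < ε
  toFun : N × ℝ → M
  inv : M → N × ℝ
  contMDiffOn_toFun : ContMDiffOn (J.prod 𝓘(ℝ, ℝ)) I ∞ toFun (univ ×ˢ Ico 0 ε)
  isOpen_image : IsOpen (toFun '' (univ ×ˢ Ico 0 ε))
  contMDiffOn_inv : ContMDiffOn I (J.prod 𝓘(ℝ, ℝ)) ∞ inv (toFun '' (univ ×ˢ Ico 0 ε))
  inv_toFun : ∀ p ∈ (univ ×ˢ Ico 0 ε : Set (N × ℝ)), inv (toFun p) = p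
  toFun_zero : ∀ x : N, toFun (x, 0) = ι x

variable {ι} in
/-- `(∂_t^k g)|_{t = 0}`, where `t` is the normal coordinate of the collar. -/
def Collar.normalDeriv (c : Collar ι) (k : ℕ) (g : M → ℝ) (x : N) : ℝ :=
  iteratedDerivWithin k (fun t => g (c.toFun (x, t))) (Ico 0 c.ε) 0

/-- A sequence of densities on `V` is locally finite if every point of `V` has a neighborhood on
which only finitely many of them do not vanish. -/
def IsLocallyFinite {V : Opens N} (ν : ℕ → Density J V) : Prop :=
  ∀ x ∈ V, ∃ W : Opens N, x ∈ W ∧ ∃ K : ℕ, ∀ k ≥ K, ∀ i, ∀ y ∈ W, (ν k).1 i y = 0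

end Boundary

end BoundaryDensities

end

open BoundaryDensities

/-!
Write `N` for the boundary of `M`, with inclusion `ι`. Everything is reduced to germs at points of
`N`. A germ `ν ⊗ (f ⊗ D)` of the push-forward acts as the germ of the distribution
`g ↦ ∫ f (D g)|_N ν`. This gives a linear map `IsOperatorAction.toDist` from the stalk of the
push-forward to the stalk of distributions, provided that the pairing is balanced over `D_N`. As
`D_N` is locally generated by functions and coordinate vector fields, balancedness is checked on
these, using the definition of the formal adjoint (`transferPairing_smul`).

The module structures themselves have to be constructed. Formal adjoints come from integration by
parts in charts and a partition of unity (`exists_isAdjoint`). The transfer module embeds into the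
operators `φ ↦ f · ι^* (D φ)` from functions on `M` to functions on `N`
(`HasBoundaryCoordinates.toOperator_injective`): in coordinates it is free over the functions on `N`
on the monomials in the partial derivatives, and an operator with coefficients in these functions
determines its coefficients, because commutators with the coordinate functions lower the order
(`IsCoordinateFrame.symbolOperator_injective`). Composition with operators on `N` preserves the
image, and this gives the left module structure (`HasBoundaryCoordinates.transferModule`).

Choose coordinates adapted to the boundary, with normal coordinate `t` and normal derivative `d`.
Since tangential derivatives can be moved across the tensor product onto the density, every germ of
the push-forward is a sum `∑ ν k ⊗ (1 ⊗ d ^ k)` (`normalForm_surjective`). Its distribution is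
`g ↦ ∑ ∫ (d ^ k g)|_N ν k`, and multiplication by `t`, which replaces `ν k ⊗ d ^ k` by
`k • ν k ⊗ d ^ (k - 1)`, shows inductively that the `ν k` are determined by the distribution
(`eq_zero_of_sum_eq_zero`, `eq_zero_of_sum_normal_eq_zero`). Hence the map on stalks is injective
(`toDist_injective`).

Distributions form a sheaf (`Distribution.exists_glue`, by partitions of unity), so a section of the
push-forward is the same thing as a distribution that it represents at every point of `N` and that
vanishes away from `N` (`Represents`). The distributions arising in this way form a subsheaf of right
modules containing the boundary densities, and locally they lie in every such subsheaf. They are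
therefore the generated subsheaf (`pushforward.toGenerated_bijective`).

A collar gives adapted coordinates in which `d` is the derivative along the collar
(`Collar.normalDeriv_eq`). The densities `ν k` in the normal forms of a distribution are unique, so
the local ones glue to a family on all of `U ∩ N`, which is locally finite because each germ needs
only finitely many of them (`IsOperatorAction.exists_isLocallyFinite`). Conversely a locally finite
sum is locally a finite sum of boundary densities acted on by powers of `d`
(`IsLocallyFinite.mem_generatedSheaf`).
-/

noncomputable section

namespace BoundaryDensities

/-! ### Germs -/

section Germs

variable {E : Type*} [NormedAddCommGroup E] [NormedSpace ℝ E]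
  {H : Type*} [TopologicalSpace H] {I : ModelWithCorners ℝ E H}
  {M : Type*} [TopologicalSpace M] [ChartedSpace H M] [IsManifold I ∞ M]

lemma DiffOp.ext_apply {U : Opens M} {P Q : DiffOp I U}
    (h : ∀ (W : Opens M) (hW : W ≤ U) (f : SmoothFn I W),
      (DiffOp.res I hW P).apply I f = (DiffOp.res I hW Q).apply I f) : P = Q :=
  Subtype.ext <| SheafEnd.ext fun W f x => DFunLike.congr_fun (h W.1 W.2 f) x

lemma DiffOp.apply_res {U W : Opens M} (h : W ≤ U) (P : DiffOp I U) (f : SmoothFn I U) :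
    (DiffOp.res I h P).apply I (SmoothFn.res I h f) = SmoothFn.res I h (P.apply I f) :=
  P.1.2 ⟨U, le_rfl⟩ ⟨W, h⟩ h f

lemma DiffOp.add_apply {U : Opens M} (P Q : DiffOp I U) (f : SmoothFn I U) :
    (P + Q).apply I f = P.apply I f + Q.apply I f := rfl

lemma DiffOp.mul_apply {U : Opens M} (P Q : DiffOp I U) (f : SmoothFn I U) :
    (P * Q).apply I f = P.apply I (Q.apply I f) := rfl

lemma DiffOp.one_apply {U : Opens M} (f : SmoothFn I U) : (1 : DiffOp I U).apply I f = f := rfl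

lemma DiffOp.ofFn_apply {U : Opens M} (a f : SmoothFn I U) :
    (DiffOp.ofFn I U a).apply I f = a * f := rfl

/-- A differential operator is local: its value at a point depends only on the germ of the
function. -/
lemma DiffOp.apply_congr {U W : Opens M} (hW : W ≤ U) (P : DiffOp I U) {f g : SmoothFn I U}
    (h : ∀ y (hy : y ∈ W), f ⟨y, hW hy⟩ = g ⟨y, hW hy⟩) (x : W) :
    P.apply I f ⟨x, hW x.2⟩ = P.apply I g ⟨x, hW x.2⟩ := by
  have h1 : SmoothFn.res I hW f = SmoothFn.res I hW g := DFunLike.ext _ _ fun y => h y.1 y.2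
  have h2 := DFunLike.congr_fun (DiffOp.apply_res hW P f) x
  have h3 := DFunLike.congr_fun (DiffOp.apply_res hW P g) x
  rw [h1] at h2
  exact h2.symm.trans h3

lemma FnStalk.exists_germ_le {x : M} (φ : FnStalk I x) {V : Opens M} (hV : x ∈ V) :
    ∃ (U : Opens M) (hx : x ∈ U) (f : SmoothFn I U), U ≤ V ∧ FnStalk.germ I x hx f = φ := by
  obtain ⟨U, f, rfl⟩ := DirectLimit.exists_eq_mk _ φ
  exact ⟨(OrderDual.ofDual U).1 ⊓ V, ⟨(OrderDual.ofDual U).2, hV⟩, SmoothFn.res I inf_le_left f,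
    inf_le_right, FnStalk.germ_res I inf_le_left x ⟨(OrderDual.ofDual U).2, hV⟩ f⟩

lemma DiffOpStalk.exists_germ_le {x : M} (D : DiffOpStalk I x) {V : Opens M} (hV : x ∈ V) :
    ∃ (U : Opens M) (hx : x ∈ U) (P : DiffOp I U), U ≤ V ∧ DiffOpStalk.germ I x hx P = D := by
  obtain ⟨U, f, rfl⟩ := DirectLimit.exists_eq_mk _ D
  exact ⟨(OrderDual.ofDual U).1 ⊓ V, ⟨(OrderDual.ofDual U).2, hV⟩, DiffOp.res I inf_le_left f,
    inf_le_right, DiffOpStalk.germ_res I inf_le_left x ⟨(OrderDual.ofDual U).2, hV⟩ f⟩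

lemma DensityStalk.exists_germ_le {x : M} (D : DensityStalk I x) {V : Opens M} (hV : x ∈ V) :
    ∃ (U : Opens M) (hx : x ∈ U) (ν : Density I U), U ≤ V ∧ DensityStalk.germ I x hx ν = D := by
  obtain ⟨U, f, rfl⟩ := DirectLimit.exists_eq_mk _ D
  exact ⟨(OrderDual.ofDual U).1 ⊓ V, ⟨(OrderDual.ofDual U).2, hV⟩, Density.res I inf_le_left f,
    inf_le_right, DensityStalk.germ_res I inf_le_left x ⟨(OrderDual.ofDual U).2, hV⟩ f⟩

lemma DensityStalk.germ_eq {x : M} {U V : Opens M} {hU : x ∈ U} {hV : x ∈ V} {f : Density I U}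
    {g : Density I V} (h : DensityStalk.germ I x hU f = DensityStalk.germ I x hV g) :
    ∃ (W : Opens M) (h₁ : W ≤ U) (h₂ : W ≤ V), x ∈ W ∧
      Density.res I h₁ f = Density.res I h₂ g := by
  obtain ⟨W, h₁, h₂, h⟩ := Quotient.exact h
  exact ⟨(OrderDual.ofDual W).1, h₁, h₂, (OrderDual.ofDual W).2, h⟩

lemma DensityStalk.germ_add {x : M} {U : Opens M} (hU : x ∈ U) (ν ν' : Density I U) :
    DensityStalk.germ I x hU (ν + ν') = DensityStalk.germ I x hU ν + DensityStalk.germ I x hU ν' :=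
  (DirectLimit.add_def (G := fun U : (OpenNhdsOf x)ᵒᵈ => Density I (OrderDual.ofDual U).1)
    (f := fun _ _ h => Density.res I h) (OrderDual.toDual ⟨U, hU⟩) ν ν').symm

lemma DensityStalk.germ_zero {x : M} {U : Opens M} (hU : x ∈ U) :
    DensityStalk.germ I x hU (0 : Density I U) = 0 :=
  (DirectLimit.zero_def (G := fun U : (OpenNhdsOf x)ᵒᵈ => Density I (OrderDual.ofDual U).1)
    (f := fun _ _ h => Density.res I h) (OrderDual.toDual ⟨U, hU⟩)).symm

lemma DiffOpStalk.exists_germ_fnGerm {x : M} (D : DiffOpStalk I x) (φ : FnStalk I x) :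
    ∃ (U : Opens M) (hx : x ∈ U) (P : DiffOp I U) (f : SmoothFn I U),
      DiffOpStalk.germ I x hx P = D ∧ FnStalk.germ I x hx f = φ := by
  obtain ⟨U, hU, P, -, rfl⟩ := D.exists_germ_le (V := ⊤) trivial
  obtain ⟨V, hV, f, hVU, rfl⟩ := φ.exists_germ_le hU
  exact ⟨V, hV, DiffOp.res I hVU P, f, DiffOpStalk.germ_res I hVU x hV P, rfl⟩

/-- The result of applying a germ of a differential operator to a germ of a function. -/
def DiffOpStalk.applyGerm {x : M} (D : DiffOpStalk I x) (φ : FnStalk I x) : FnStalk I x :=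
  DirectLimit.map₂ (ι := (OpenNhdsOf x)ᵒᵈ)
    (F₁ := fun U => DiffOp I (OrderDual.ofDual U).1)
    (F₂ := fun U => SmoothFn I (OrderDual.ofDual U).1)
    (F := fun U => SmoothFn I (OrderDual.ofDual U).1)
    (fun _ _ h => DiffOp.res I h) (fun _ _ h => SmoothFn.res I h)
    (fun _ _ h => SmoothFn.res I h) (fun _ P f => P.apply I f)
    (fun _ _ h P f => (DiffOp.apply_res h P f).symm) D φ

lemma DiffOpStalk.applyGerm_germ {x : M} {U : Opens M} (hx : x ∈ U) (P : DiffOp I U)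
    (f : SmoothFn I U) :
    (DiffOpStalk.germ I x hx P).applyGerm (FnStalk.germ I x hx f) =
      FnStalk.germ I x hx (P.apply I f) :=
  DirectLimit.map₂_def (ι := (OpenNhdsOf x)ᵒᵈ)
    (F₁ := fun U => DiffOp I (OrderDual.ofDual U).1)
    (F₂ := fun U => SmoothFn I (OrderDual.ofDual U).1)
    (F := fun U => SmoothFn I (OrderDual.ofDual U).1)
    (fun _ _ h => DiffOp.res I h) (fun _ _ h => SmoothFn.res I h)
    (fun _ _ h => SmoothFn.res I h) (fun _ P f => P.apply I f)
    (fun _ _ h P f => (DiffOp.apply_res h P f).symm) (OrderDual.toDual ⟨U, hx⟩) P f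

lemma DiffOpStalk.applyGerm_add {x : M} (D : DiffOpStalk I x) (φ ψ : FnStalk I x) :
    D.applyGerm (φ + ψ) = D.applyGerm φ + D.applyGerm ψ := by
  obtain ⟨U, hU, P, f, rfl, rfl⟩ := D.exists_germ_fnGerm φ
  obtain ⟨V, hV, g, hVU, rfl⟩ := ψ.exists_germ_le hU
  rw [← DiffOpStalk.germ_res I hVU x hV, ← FnStalk.germ_res I hVU x hV, ← map_add,
    applyGerm_germ, applyGerm_germ, applyGerm_germ, map_add, map_add]

lemma DiffOpStalk.add_applyGerm {x : M} (D D' : DiffOpStalk I x) (φ : FnStalk I x) :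
    (D + D').applyGerm φ = D.applyGerm φ + D'.applyGerm φ := by
  obtain ⟨U, hU, P, f, rfl, rfl⟩ := D.exists_germ_fnGerm φ
  obtain ⟨V, hV, Q, hVU, rfl⟩ := D'.exists_germ_le hU
  rw [← DiffOpStalk.germ_res I hVU x hV, ← FnStalk.germ_res I hVU x hV, ← map_add,
    applyGerm_germ, applyGerm_germ, applyGerm_germ, DiffOp.add_apply, map_add]

lemma DiffOpStalk.mul_applyGerm {x : M} (D D' : DiffOpStalk I x) (φ : FnStalk I x) :
    (D * D').applyGerm φ = D.applyGerm (D'.applyGerm φ) := by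
  obtain ⟨U, hU, P, f, rfl, rfl⟩ := D.exists_germ_fnGerm φ
  obtain ⟨V, hV, Q, hVU, rfl⟩ := D'.exists_germ_le hU
  rw [← DiffOpStalk.germ_res I hVU x hV, ← FnStalk.germ_res I hVU x hV, ← map_mul,
    applyGerm_germ, applyGerm_germ, applyGerm_germ, DiffOp.mul_apply]

lemma DiffOpStalk.one_applyGerm {x : M} (φ : FnStalk I x) :
    (1 : DiffOpStalk I x).applyGerm φ = φ := by
  obtain ⟨U, hU, f, -, rfl⟩ := φ.exists_germ_le (V := ⊤) trivial
  rw [← map_one (DiffOpStalk.germ I x hU)]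
  exact applyGerm_germ hU 1 f

/-- The action of germs of differential operators on germs of functions. -/
def DiffOpStalk.act (x : M) : DiffOpStalk I x →+* AddMonoid.End (FnStalk I x) :=
  RingHom.mk' { toFun := fun D => AddMonoidHom.mk' D.applyGerm D.applyGerm_add
                map_one' := AddMonoidHom.ext fun φ => DiffOpStalk.one_applyGerm (I := I) φ
                map_mul' := fun D D' => AddMonoidHom.ext (D.mul_applyGerm D') }
    fun D D' => AddMonoidHom.ext (D.add_applyGerm D')

lemma DiffOpStalk.act_germ {x : M} {U : Opens M} (hx : x ∈ U) (P : DiffOp I U) (f : SmoothFn I U) :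
    DiffOpStalk.act x (DiffOpStalk.germ I x hx P) (FnStalk.germ I x hx f) =
      FnStalk.germ I x hx (P.apply I f) :=
  applyGerm_germ hx P f

lemma DiffOpStalk.ofFn_germ {x : M} {U : Opens M} (hx : x ∈ U) (f : SmoothFn I U) :
    DiffOpStalk.ofFn I x (FnStalk.germ I x hx f) = DiffOpStalk.germ I x hx (DiffOp.ofFn I U f) :=
  rfl

lemma DiffOpStalk.act_ofFn {x : M} (a b : FnStalk I x) :
    DiffOpStalk.act x (DiffOpStalk.ofFn I x a) b = a * b := by
  obtain ⟨U, hU, a, -, rfl⟩ := a.exists_germ_le (V := ⊤) trivial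
  obtain ⟨V, hV, b, hVU, rfl⟩ := b.exists_germ_le hU
  rw [← FnStalk.germ_res I hVU x hV, DiffOpStalk.ofFn_germ, DiffOpStalk.act_germ, ← map_mul]
  rfl

omit [IsManifold I ∞ M] in
lemma FnStalk.nsmul_eq_zero {x : M} {k : ℕ} (hk : k ≠ 0) {φ : FnStalk I x} (h : k * φ = 0) :
    φ = 0 := by
  have h1 : FnStalk.germ I x (U := ⊤) trivial (algebraMap ℝ _ (k : ℝ)⁻¹) * k = 1 := by
    rw [← map_natCast (FnStalk.germ I x (U := ⊤) trivial), ← map_mul,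
      ← map_natCast (algebraMap ℝ (SmoothFn I (⊤ : Opens M))), ← map_mul, inv_mul_cancel₀,
      map_one, map_one]
    exact_mod_cast hk
  rw [← one_mul φ, ← h1, mul_assoc, h, mul_zero]

end Germs

/-! ### Partitions of unity and sheaf properties of distributions -/

section Gluing

variable {E : Type*} [NormedAddCommGroup E] [NormedSpace ℝ E]
  {H : Type*} [TopologicalSpace H] {I : ModelWithCorners ℝ E H}
  {M : Type*} [TopologicalSpace M] [ChartedSpace H M]

/-- A finite partition of unity on a compact set, subordinate to an open cover. -/
lemma exists_finite_partition [IsManifold I ∞ M] [FiniteDimensional ℝ E] [SigmaCompactSpace M]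
    [T2Space M] {α : Type*} (W : α → Opens M)
    {K : Set M} (hK : IsCompact K) (hKW : K ⊆ ⋃ i, (W i : Set M)) :
    ∃ (t : Finset α) (χ : α → C^∞⟮I, M; 𝓘(ℝ, ℝ), ℝ⟯), (∀ i, tsupport (χ i) ⊆ W i) ∧
      ∀ x ∈ K, ∑ i ∈ t, χ i x = 1 := by
  obtain ⟨f, hf⟩ := SmoothPartitionOfUnity.exists_isSubordinate I hK.isClosed
    (fun i => (W i : Set M)) (fun i => (W i).2) hKW
  have hfin := f.locallyFinite.finite_nonempty_inter_compact hK
  refine ⟨hfin.toFinset, f, hf, fun x hx => ?_⟩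
  rw [← f.sum_eq_one hx]
  refine (finsum_eq_sum_of_support_subset _ fun i hi => ?_).symm
  exact hfin.mem_toFinset.2 ⟨x, hi, hx⟩

/-- The product of a smooth function whose support is contained in `W` and a test function. -/
def TestFn.cutoff {U : Opens M} (W : Opens M) (χ : C^∞⟮I, M; 𝓘(ℝ, ℝ), ℝ⟯)
    (hχ : tsupport χ ⊆ W) (g : TestFn I U) : TestFn I (W ⊓ U) :=
  ⟨χ * g.1, g.2.1.mul_left, fun _ hx =>
    ⟨hχ (tsupport_mul_subset_left hx), g.2.2 (tsupport_mul_subset_right hx)⟩⟩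

lemma TestFn.cutoff_apply {U : Opens M} (W : Opens M) (χ : C^∞⟮I, M; 𝓘(ℝ, ℝ), ℝ⟯)
    (hχ : tsupport χ ⊆ W) (g : TestFn I U) (x : M) :
    (TestFn.cutoff W χ hχ g).1 x = χ x * g.1 x := rfl

lemma TestFn.incl_apply {U U' : Opens M} (h : U' ≤ U) (g : TestFn I U') (x : M) :
    (TestFn.incl I h g).1 x = g.1 x := rfl

lemma TestFn.sum_apply {U : Opens M} {α : Type*} (t : Finset α) (g : α → TestFn I U) (x : M) :
    (∑ i ∈ t, g i).1 x = ∑ i ∈ t, (g i).1 x := by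
  classical
  induction t using Finset.induction_on with
  | empty => rfl
  | insert a t ha ih =>
    rw [Finset.sum_insert ha, Finset.sum_insert ha, ← ih]
    rfl

lemma TestFn.ext_apply {U : Opens M} {g g' : TestFn I U} (h : ∀ x, g.1 x = g'.1 x) : g = g' :=
  Subtype.ext (DFunLike.ext _ _ h)

/-- A test function is a finite sum of test functions supported in the members of an open cover of
its support. -/
lemma TestFn.exists_decomposition [IsManifold I ∞ M] [FiniteDimensional ℝ E]
    [SigmaCompactSpace M] [T2Space M] {α : Type*} (W : α → Opens M)
    {U : Opens M} (g : TestFn I U) (hW : tsupport g.1 ⊆ ⋃ i, (W i : Set M)) :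
    ∃ (t : Finset α) (χ : α → C^∞⟮I, M; 𝓘(ℝ, ℝ), ℝ⟯) (hχ : ∀ i, tsupport (χ i) ⊆ W i),
      g = ∑ i ∈ t, TestFn.incl I inf_le_right (TestFn.cutoff (W i) (χ i) (hχ i) g) := by
  obtain ⟨t, χ, hχ, h1⟩ := exists_finite_partition (I := I) W g.2.1.isCompact hW
  refine ⟨t, χ, hχ, TestFn.ext_apply fun x => ?_⟩
  rw [TestFn.sum_apply]
  simp only [TestFn.incl_apply, TestFn.cutoff_apply]
  rw [← Finset.sum_mul]
  by_cases hx : x ∈ tsupport g.1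
  · rw [h1 x hx, one_mul]
  · rw [image_eq_zero_of_notMem_tsupport hx, mul_zero]

variable [IsManifold I ∞ M]

/-! #### Extension of differential operators by zero -/

omit [IsManifold I ∞ M] in
lemma contMDiff_dite_of_tsupport_subset {W W' : Opens M} {η : C^∞⟮I, M; 𝓘(ℝ, ℝ), ℝ⟯}
    (hη : tsupport η ⊆ W) (f : SmoothFn I (W ⊓ W')) :
    ContMDiff I 𝓘(ℝ, ℝ) ∞ (fun x : W' => η x * extendZero f (x : M)) := by
  intro x
  by_cases hx : (x : M) ∈ W
  · have h1 : ContMDiffAt I 𝓘(ℝ, ℝ) ∞ (extendZero f) (x : M) := by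
      refine (contMDiffAt_subtype_iff (I := I) (I' := 𝓘(ℝ, ℝ)) (n := ∞) (U := W ⊓ W')
        (f := extendZero f) (x := ⟨x, hx, x.2⟩)).1 ?_
      rw [show (fun y : ↥(W ⊓ W') => extendZero f (y : M)) = f from
        funext fun y => extendZero_coe _ y]
      exact f.contMDiff.contMDiffAt
    exact (contMDiffAt_subtype_iff (I := I) (U := W')
      (f := fun x : M => η x * extendZero f x)).2 (η.contMDiff.contMDiffAt.mul h1)
  · have h1 : (x : M) ∉ tsupport η := fun h => hx (hη h)
    have h2 : ∀ᶠ y : W' in 𝓝 x, η (y : M) * extendZero f (y : M) = 0 := by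
      have : ∀ᶠ y in 𝓝 (x : M), y ∉ tsupport η := (isClosed_tsupport _).isOpen_compl.mem_nhds h1
      filter_upwards [continuous_subtype_val.continuousAt.eventually this] with y hy
      rw [image_eq_zero_of_notMem_tsupport hy, zero_mul]
    exact contMDiffAt_const.congr_of_eventuallyEq h2

/-- The sheaf endomorphism `η P` on `U`, where the support of `η` is contained in the domain `W` of
`P`. -/
def SheafEnd.extend {W U : Opens M} (P : SheafEnd I W) (η : C^∞⟮I, M; 𝓘(ℝ, ℝ), ℝ⟯)
    (hη : tsupport η ⊆ W) : SheafEnd I U :=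
  ⟨fun W' =>
    { toFun := fun f => ⟨fun x => η x * extendZero
        (P.1 ⟨W ⊓ W'.1, inf_le_left⟩ (SmoothFn.res I inf_le_right f)) (x : M),
        contMDiff_dite_of_tsupport_subset hη _⟩
      map_add' := fun f g => by
        ext x
        change η x * extendZero _ (x : M) = η x * extendZero _ (x : M) + η x * extendZero _ (x : M)
        by_cases hx : (x : M) ∈ W
        · have : (x : M) ∈ W ⊓ W'.1 := ⟨hx, x.2⟩
          simp only [extendZero, dif_pos this, map_add]
          exact mul_add _ _ _
        · simp [image_eq_zero_of_notMem_tsupport fun h => hx (hη h)]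
      map_smul' := fun r f => by
        ext x
        change η x * extendZero _ (x : M) = r * (η x * extendZero _ (x : M))
        by_cases hx : (x : M) ∈ W
        · have : (x : M) ∈ W ⊓ W'.1 := ⟨hx, x.2⟩
          simp only [extendZero, dif_pos this, map_smul]
          exact mul_left_comm _ _ _
        · simp [image_eq_zero_of_notMem_tsupport fun h => hx (hη h)] },
    fun W₁ W₂ h f => by
      ext x
      change η x * extendZero _ (x : M) = η x * extendZero _ (x : M)
      by_cases hx : (x : M) ∈ W
      · have h2 : (x : M) ∈ W ⊓ W₂.1 := ⟨hx, x.2⟩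
        have h1 : (x : M) ∈ W ⊓ W₁.1 := ⟨hx, h x.2⟩
        simp only [extendZero, dif_pos h1, dif_pos h2]
        congr 1
        exact DFunLike.congr_fun (P.2 ⟨W ⊓ W₁.1, inf_le_left⟩ ⟨W ⊓ W₂.1, inf_le_left⟩
          (inf_le_inf_left _ h) (SmoothFn.res I inf_le_right f)) ⟨x, h2⟩
      · simp [image_eq_zero_of_notMem_tsupport fun h => hx (hη h)]⟩

omit [IsManifold I ∞ M] in
lemma SheafEnd.extend_apply {W U : Opens M} (P : SheafEnd I W) (η : C^∞⟮I, M; 𝓘(ℝ, ℝ), ℝ⟯)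
    (hη : tsupport η ⊆ W) (W' : {W' : Opens M // W' ≤ U}) (f : SmoothFn I W'.1) (x : W'.1) :
    (SheafEnd.extend (U := U) P η hη).1 W' f x = η x * extendZero
      (P.1 ⟨W ⊓ W'.1, inf_le_left⟩ (SmoothFn.res I inf_le_right f)) (x : M) := rfl

/-- The differential operator `η P` on `U`, where the support of `η` is contained in the domain `W`
of `P`. -/
def DiffOp.extend {W U : Opens M} (hWU : W ≤ U) (P : DiffOp I W) (η : C^∞⟮I, M; 𝓘(ℝ, ℝ), ℝ⟯)
    (hη : tsupport η ⊆ W) : DiffOp I U :=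
  ⟨SheafEnd.extend P.1 η hη, fun x hx => by
    by_cases hxW : x ∈ W
    · obtain ⟨W₁, hW₁, hxW₁, hP⟩ := P.2 x hxW
      refine ⟨W₁, hW₁.trans hWU, hxW₁, ?_⟩
      have : SheafEnd.res I (hW₁.trans hWU) (SheafEnd.extend P.1 η hη) =
          SheafEnd.mulFn I W₁ ⟨fun y => η y, η.contMDiff.comp contMDiff_subtype_val⟩ *
            SheafEnd.res I hW₁ P.1 := by
        refine SheafEnd.ext fun W' f y => ?_
        have hy : (y : M) ∈ W ⊓ W'.1 := ⟨hW₁ (W'.2 y.2), y.2⟩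
        refine (SheafEnd.extend_apply P.1 η hη ⟨W'.1, _⟩ f y).trans ?_
        refine congrArg (η y * ·) ?_
        simp only [extendZero, dif_pos hy]
        exact DFunLike.congr_fun (P.1.2 ⟨W'.1, W'.2.trans hW₁⟩ ⟨W ⊓ W'.1, inf_le_left⟩
          inf_le_right f) ⟨y, hy⟩
      rw [this]
      exact mul_mem (Algebra.subset_adjoin (Or.inl ⟨_, rfl⟩)) hP
    · let W₁ : Opens M := U ⊓ ⟨(tsupport η)ᶜ, (isClosed_tsupport _).isOpen_compl⟩
      refine ⟨W₁, inf_le_left, ⟨hx, fun h => hxW (hη h)⟩, ?_⟩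
      have : SheafEnd.res I (inf_le_left : W₁ ≤ U) (SheafEnd.extend P.1 η hη) = 0 := by
        refine SheafEnd.ext fun W' f y => ?_
        refine (SheafEnd.extend_apply P.1 η hη ⟨W'.1, _⟩ f y).trans ?_
        rw [image_eq_zero_of_notMem_tsupport (W'.2 y.2).2, zero_mul]
        rfl
      rw [this]
      exact zero_mem _⟩

lemma DiffOp.extend_smul_apply {W U : Opens M} (hWU : W ≤ U) (P : DiffOp I W)
    (η : C^∞⟮I, M; 𝓘(ℝ, ℝ), ℝ⟯) (hη : tsupport η ⊆ W) (g : TestFn I W) (x : M) :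
    (DiffOp.extend hWU P η hη • TestFn.incl I hWU g).1 x = η x * (P • g).1 x := by
  by_cases hx : x ∈ W
  · refine (TestFn.smul_apply (DiffOp.extend hWU P η hη) _ ⟨x, hWU hx⟩).trans ?_
    refine (SheafEnd.extend_apply (U := U) P.1 η hη ⟨U, le_rfl⟩ _ ⟨x, hWU hx⟩).trans ?_
    refine congrArg (η x * ·) ?_
    have hx' : x ∈ W ⊓ U := ⟨hx, hWU hx⟩
    refine Eq.trans ?_ (TestFn.smul_apply P g ⟨x, hx⟩).symm
    refine (extendZero_coe _ (⟨x, hx'⟩ : ↥(W ⊓ U))).trans ?_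
    exact DFunLike.congr_fun (P.1.2 ⟨W, le_rfl⟩ ⟨W ⊓ U, inf_le_left⟩ inf_le_left
      (TestFn.toSmoothFn I g)) ⟨x, hx'⟩
  · rw [image_eq_zero_of_notMem_tsupport fun h => hx (hη h), zero_mul]
    exact image_eq_zero_of_notMem_tsupport fun h =>
      hx (g.2.2 ((DiffOp.extend hWU P η hη).tsupport_subset _ h))

/-! #### Distributions form a sheaf -/

lemma Distribution.map_add {U : Opens M} (T : Distribution I U) (g g' : TestFn I U) :
    T (g + g') = T g + T g' := _root_.map_add T.1 g g'

lemma Distribution.map_sum {U : Opens M} (T : Distribution I U) {α : Type*} (t : Finset α)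
    (g : α → TestFn I U) : T (∑ i ∈ t, g i) = ∑ i ∈ t, T (g i) := _root_.map_sum T.1 g t

lemma Distribution.ext {U : Opens M} {T T' : Distribution I U} (h : ∀ g, T g = T' g) : T = T' :=
  Subtype.ext (LinearMap.ext h)

variable [FiniteDimensional ℝ E] [SigmaCompactSpace M] [T2Space M]

/-- Two additive functionals on test functions that agree locally are equal. -/
lemma TestFn.functional_ext {U : Opens M} {A : Type*} [AddCommMonoid A] (T T' : TestFn I U → A)
    (hT0 : T 0 = 0) (hT0' : T' 0 = 0)
    (hT : ∀ g g', T (g + g') = T g + T g') (hT' : ∀ g g', T' (g + g') = T' g + T' g')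
    (h : ∀ x ∈ U, ∃ (W : Opens M), x ∈ W ∧ ∀ (g : TestFn I U), tsupport g.1 ⊆ W → T g = T' g)
    (g : TestFn I U) : T g = T' g := by
  choose W hxW hW using h
  obtain ⟨t, χ, hχ, hg⟩ := g.exists_decomposition (fun x : U => W x x.2) fun x hx =>
    mem_iUnion.2 ⟨⟨x, g.2.2 hx⟩, hxW x _⟩
  let L : TestFn I U →+ A := { toFun := T, map_zero' := hT0, map_add' := hT }
  let L' : TestFn I U →+ A := { toFun := T', map_zero' := hT0', map_add' := hT' }
  change L g = L' g
  rw [hg, _root_.map_sum, _root_.map_sum]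
  refine Finset.sum_congr rfl fun i _ => ?_
  exact hW _ _ _ ((TestFn.cutoff _ (χ i) (hχ i) g).2.2.trans inf_le_left)

lemma Distribution.eq_of_local {U : Opens M} {T T' : Distribution I U}
    (h : ∀ x ∈ U, ∃ (W : Opens M), x ∈ W ∧ ∀ (g : TestFn I U), tsupport g.1 ⊆ W → T g = T' g) :
    T = T' :=
  Distribution.ext fun g => TestFn.functional_ext (fun g => T g) (fun g => T' g) (map_zero T.1)
    (map_zero T'.1) T.map_add T'.map_add h g

open DirectSum in
/-- Compatible distributions on the members of an open cover of `U` come from a distribution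
on `U`. -/
lemma Distribution.exists_glue {U : Opens M} {α : Type*} (W : α → Opens M)
    (hWU : ∀ i, W i ≤ U) (hcov : (U : Set M) ⊆ ⋃ i, (W i : Set M)) (T : ∀ i, Distribution I (W i))
    (hT : ∀ i j, Distribution.res I (inf_le_left : W i ⊓ W j ≤ W i) (T i) =
      Distribution.res I (inf_le_right : W i ⊓ W j ≤ W j) (T j)) :
    ∃ T' : Distribution I U, ∀ i, Distribution.res I (hWU i) T' = T i := by
  classical
  let S : (⨁ i, TestFn I (W i)) →ₗ[ℝ] TestFn I U :=
    DirectSum.toModule ℝ α _ fun i => TestFn.incl I (hWU i)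
  let L : (⨁ i, TestFn I (W i)) →ₗ[ℝ] ℝ := DirectSum.toModule ℝ α _ fun i => (T i).1
  have hS : Function.Surjective S := fun g => by
    obtain ⟨t, χ, hχ, hg⟩ := g.exists_decomposition W (g.2.2.trans hcov)
    refine ⟨∑ i ∈ t, DirectSum.lof ℝ α (fun i => TestFn I (W i)) i
      (TestFn.incl I inf_le_left (TestFn.cutoff (W i) (χ i) (hχ i) g)), ?_⟩
    rw [_root_.map_sum]
    refine Eq.trans ?_ hg.symm
    refine Finset.sum_congr rfl fun i _ => ?_
    rw [DirectSum.toModule_lof]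
    rfl
  -- `L` factors through the surjection `S`: expand a zero sum of test functions by a partition of
  -- unity on the union of their supports
  have hker : LinearMap.ker S ≤ LinearMap.ker L := fun z hz => by
    rw [LinearMap.mem_ker] at hz ⊢
    let K : Set M := ⋃ i ∈ z.support, tsupport (z i).1
    have hK : IsCompact K := z.support.isCompact_biUnion fun i _ => (z i).2.1.isCompact
    have hKU : K ⊆ ⋃ i, (W i : Set M) := iUnion₂_subset fun i _ =>
      (z i).2.2.trans (subset_iUnion (fun i => (W i : Set M)) i)
    obtain ⟨t, χ, hχ, h1⟩ := exists_finite_partition (I := I) W hK hKU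
    have hz' : ∀ x, ∑ i ∈ z.support, (z i).1 x = 0 := fun x => by
      have h2 := congrArg (fun g : TestFn I U => g.1 x) hz
      rw [← DirectSum.sum_support_of z, _root_.map_sum] at h2
      simp only [TestFn.sum_apply] at h2
      refine Eq.trans (Finset.sum_congr rfl fun i _ => ?_) h2
      exact (congrArg (fun g : TestFn I U => g.1 x)
        (DirectSum.toModule_lof ℝ (M := fun i => TestFn I (W i))
          (φ := fun i => TestFn.incl I (hWU i)) i (z i))).symm
    have hLz : L z = ∑ i ∈ z.support, T i (z i) := by
      conv_lhs => rw [← DirectSum.sum_support_of z, _root_.map_sum]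
      exact Finset.sum_congr rfl fun i _ =>
        DirectSum.toModule_lof ℝ (M := fun i => TestFn I (W i)) (φ := fun i => (T i).1) i (z i)
    rw [hLz]
    have h3 : ∀ i ∈ z.support, T i (z i) = ∑ j ∈ t,
        T j (TestFn.incl I inf_le_left (TestFn.cutoff (W j) (χ j) (hχ j) (z i))) := fun i hi => by
      have h4 : z i = ∑ j ∈ t,
          TestFn.incl I inf_le_right (TestFn.cutoff (W j) (χ j) (hχ j) (z i)) := by
        refine TestFn.ext_apply fun x => ?_
        rw [TestFn.sum_apply]
        simp only [TestFn.incl_apply, TestFn.cutoff_apply]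
        rw [← Finset.sum_mul]
        by_cases hx : x ∈ tsupport (z i).1
        · rw [h1 x (mem_biUnion hi hx), one_mul]
        · rw [image_eq_zero_of_notMem_tsupport hx, mul_zero]
      conv_lhs => rw [h4, Distribution.map_sum]
      exact Finset.sum_congr rfl fun j _ => congrArg (fun T : Distribution I (W j ⊓ W i) =>
        T (TestFn.cutoff (W j) (χ j) (hχ j) (z i))) (hT j i).symm
    rw [Finset.sum_congr rfl h3, Finset.sum_comm]
    refine Finset.sum_eq_zero fun j _ => ?_
    rw [← Distribution.map_sum]
    refine (congrArg (T j).1 (TestFn.ext_apply fun x => ?_)).trans (map_zero (T j).1)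
    rw [TestFn.sum_apply]
    simp only [TestFn.incl_apply, TestFn.cutoff_apply]
    rw [← Finset.mul_sum, hz' x, mul_zero]
    rfl
  let T₀ : TestFn I U →ₗ[ℝ] ℝ :=
    (Submodule.liftQ _ L hker).comp (S.quotKerEquivOfSurjective hS).symm.toLinearMap
  have hT₀ : ∀ z, T₀ (S z) = L z := fun z => by
    change (Submodule.liftQ _ L hker) ((S.quotKerEquivOfSurjective hS).symm (S z)) = L z
    have : (S.quotKerEquivOfSurjective hS).symm (S z) = Submodule.Quotient.mk z := by
      rw [LinearEquiv.symm_apply_eq]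
      rfl
    rw [this]
    rfl
  have hT₁ : ∀ i (g : TestFn I (W i)), T₀ (TestFn.incl I (hWU i) g) = T i g := fun i g => by
    have h5 := hT₀ (DirectSum.lof ℝ α (fun i => TestFn I (W i)) i g)
    rw [DirectSum.toModule_lof, DirectSum.toModule_lof] at h5
    exact h5
  refine ⟨⟨T₀, fun K hK hKU => ?_⟩, fun i => Distribution.ext (hT₁ i)⟩
  obtain ⟨t, χ, hχ, h1⟩ := exists_finite_partition (I := I) W hK (hKU.trans hcov)
  -- cutoff functions equal to one on the support of `χ i` within `K`
  have h2 : ∀ i, ∃ η : C^∞⟮I, M; 𝓘(ℝ, ℝ), ℝ⟯, tsupport η ⊆ W i ∧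
      ∀ x ∈ K ∩ tsupport (χ i), η x = 1 := fun i => by
    obtain ⟨t', χ', hχ', h1'⟩ := exists_finite_partition (I := I) (fun _ : Unit => W i)
      (hK.inter_right (isClosed_tsupport (χ i))) (by
        rw [iUnion_const]
        exact inter_subset_right.trans (hχ i))
    refine ⟨∑ j ∈ t', χ' j, ?_, fun x hx => ?_⟩
    · refine (closure_minimal (fun x hx => ?_) (isClosed_tsupport (χ' ()))).trans (hχ' ())
      by_contra hx'
      apply hx
      have : χ' () x = 0 := image_eq_zero_of_notMem_tsupport hx'
      rw [← ContMDiffMap.coeFnAddMonoidHom_apply, _root_.map_sum, Finset.sum_apply]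
      exact Finset.sum_eq_zero fun j _ => this
    · rw [← ContMDiffMap.coeFnAddMonoidHom_apply, _root_.map_sum, Finset.sum_apply]
      exact h1' x hx
  choose η hη hη1 using h2
  have h6 : ∀ i, ∃ (s : Finset (DiffOp I (W i))) (C : ℝ), 0 ≤ C ∧ ∀ g : TestFn I (W i),
      tsupport g.1 ⊆ K ∩ tsupport (χ i) → ∀ b : ℝ, 0 ≤ b →
      (∀ P ∈ s, ∀ x : M, |(P • g).1 x| ≤ b) → |T i g| ≤ C * b := fun i => by
    obtain ⟨s, C, hs⟩ := (T i).2 (K ∩ tsupport (χ i)) (hK.inter_right (isClosed_tsupport (χ i)))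
      (inter_subset_right.trans (hχ i))
    refine ⟨s, |C|, abs_nonneg _, fun g hg b hb hP => (hs g hg b hb hP).trans ?_⟩
    exact mul_le_mul_of_nonneg_right (le_abs_self C) hb
  choose s C hC hs using h6
  let χU : α → SmoothFn I U := fun i => ⟨fun y => χ i y, (χ i).contMDiff.comp contMDiff_subtype_val⟩
  refine ⟨t.biUnion fun i => (s i).image fun P =>
    DiffOp.extend (hWU i) P (η i) (hη i) * DiffOp.ofFn I U (χU i), ∑ i ∈ t, C i,
    fun g hg b hb hP => ?_⟩
  have h7 : g = ∑ i ∈ t, TestFn.incl I (hWU i)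
      (TestFn.incl I inf_le_left (TestFn.cutoff (W i) (χ i) (hχ i) g)) := by
    refine TestFn.ext_apply fun x => ?_
    rw [TestFn.sum_apply]
    simp only [TestFn.incl_apply, TestFn.cutoff_apply]
    rw [← Finset.sum_mul]
    by_cases hx : x ∈ tsupport g.1
    · rw [h1 x (hg hx), one_mul]
    · rw [image_eq_zero_of_notMem_tsupport hx, mul_zero]
  have h8 : T₀ g = ∑ i ∈ t, T i (TestFn.incl I inf_le_left
      (TestFn.cutoff (W i) (χ i) (hχ i) g)) := by
    conv_lhs => rw [h7, _root_.map_sum]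
    exact Finset.sum_congr rfl fun i _ => hT₁ i _
  rw [h8, Finset.sum_mul]
  refine (Finset.abs_sum_le_sum_abs _ _).trans (Finset.sum_le_sum fun i hi => ?_)
  have hsupp : tsupport (TestFn.incl I inf_le_left (TestFn.cutoff (W i) (χ i) (hχ i) g)
      : TestFn I (W i)).1 ⊆ K ∩ tsupport (χ i) := fun x hx =>
    ⟨hg (tsupport_mul_subset_right hx), tsupport_mul_subset_left hx⟩
  refine hs i _ hsupp b hb fun P hPs x => ?_
  by_cases hx : x ∈ K ∩ tsupport (χ i)
  · have h9 := hP _ (Finset.mem_biUnion.2 ⟨i, hi, Finset.mem_image_of_mem _ hPs⟩) x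
    rw [mul_smul] at h9
    have h10 : DiffOp.ofFn I U (χU i) • g = TestFn.incl I (hWU i)
        (TestFn.incl I inf_le_left (TestFn.cutoff (W i) (χ i) (hχ i) g)) :=
      TestFn.ext_on fun y => TestFn.smul_apply _ g y
    rw [h10, DiffOp.extend_smul_apply, hη1 i x hx, one_mul] at h9
    exact h9
  · have h11 := P.extendZero_eq_zero _ x fun h => hx (hsupp h)
    exact (congrArg abs h11).trans_le (abs_zero.trans_le hb)

end Gluing

/-! ### Vector fields and local coordinates -/

section VectorFields

variable {E : Type*} [NormedAddCommGroup E] [NormedSpace ℝ E]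
  {H : Type*} [TopologicalSpace H] {I : ModelWithCorners ℝ E H}
  {M : Type*} [TopologicalSpace M] [ChartedSpace H M]

/-- The derivative of a real function in the direction of a tangent vector. -/
def dirDeriv (F : M → ℝ) (x : M) (v : TangentSpace I x) : ℝ := mfderiv I 𝓘(ℝ, ℝ) F x v

lemma dirDeriv_congr {F G : M → ℝ} {x : M} (h : F =ᶠ[𝓝 x] G) (v : TangentSpace I x) :
    dirDeriv F x v = dirDeriv G x v := by
  unfold dirDeriv
  have := h.mfderiv_eq (I := I) (I' := 𝓘(ℝ, ℝ))
  exact DFunLike.congr_fun (F := E →L[ℝ] ℝ) this v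

lemma dirDeriv_add {F G : M → ℝ} {x : M} (hF : MDifferentiableAt I 𝓘(ℝ, ℝ) F x)
    (hG : MDifferentiableAt I 𝓘(ℝ, ℝ) G x) (v : TangentSpace I x) :
    dirDeriv (F + G) x v = dirDeriv F x v + dirDeriv G x v :=
  DFunLike.congr_fun (F := E →L[ℝ] ℝ) (mfderiv_add hF hG) v

lemma dirDeriv_mul {F G : M → ℝ} {x : M} (hF : MDifferentiableAt I 𝓘(ℝ, ℝ) F x)
    (hG : MDifferentiableAt I 𝓘(ℝ, ℝ) G x) (v : TangentSpace I x) :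
    dirDeriv (F * G) x v = F x * dirDeriv G x v + G x * dirDeriv F x v :=
  DFunLike.congr_fun (F := E →L[ℝ] ℝ) (hF.hasMFDerivAt.mul hG.hasMFDerivAt).mfderiv v

lemma dirDeriv_const_mul {F : M → ℝ} {x : M} (hF : MDifferentiableAt I 𝓘(ℝ, ℝ) F x) (r : ℝ)
    (v : TangentSpace I x) : dirDeriv (fun y => r * F y) x v = r * dirDeriv F x v := by
  have h1 := dirDeriv_mul (F := fun _ => r) (mdifferentiableAt_const) hF v
  have h2 : dirDeriv (fun _ : M => r) x v = 0 :=
    DFunLike.congr_fun (F := E →L[ℝ] ℝ) mfderiv_const v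
  rw [h2, mul_zero, add_zero] at h1
  exact h1

lemma contMDiffOn_extendZero {W : Opens M} (f : SmoothFn I W) :
    ContMDiffOn I 𝓘(ℝ, ℝ) ∞ (extendZero f) W := fun x hx => by
  refine ContMDiffAt.contMDiffWithinAt ?_
  refine (contMDiffAt_subtype_iff (I := I) (I' := 𝓘(ℝ, ℝ)) (n := ∞) (U := W)
    (f := extendZero f) (x := ⟨x, hx⟩)).1 ?_
  rw [show (fun y : W => extendZero f (y : M)) = f from funext fun y => extendZero_coe _ y]
  exact f.contMDiff.contMDiffAt

lemma mdifferentiableAt_extendZero {W : Opens M} (f : SmoothFn I W) {x : M} (hx : x ∈ W) :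
    MDifferentiableAt I 𝓘(ℝ, ℝ) (extendZero f) x :=
  ((contMDiffOn_extendZero f).contMDiffAt (W.2.mem_nhds hx)).mdifferentiableAt (by simp)

lemma extendZero_of_mem {W : Opens M} (f : W → ℝ) {x : M} (hx : x ∈ W) :
    extendZero f x = f ⟨x, hx⟩ := dif_pos hx

lemma extendZero_of_notMem {W : Opens M} (f : W → ℝ) {x : M} (hx : x ∉ W) :
    extendZero f x = 0 := dif_neg hx

lemma extendZero_eventuallyEq {W : Opens M} (f : W → ℝ) (F : M → ℝ) {x : M} (hx : x ∈ W)
    (h : ∀ y : W, f y = F y) : extendZero f =ᶠ[𝓝 x] F := by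
  filter_upwards [W.2.mem_nhds hx] with y hy
  rw [extendZero_of_mem f hy, h]

/-- A smooth function on an open subset `W`, given by a function on all of `M`. -/
def SmoothFn.ofContMDiffOn {W : Opens M} (F : M → ℝ) (hF : ContMDiffOn I 𝓘(ℝ, ℝ) ∞ F W) :
    SmoothFn I W :=
  ⟨fun x => F x, fun x => contMDiffAt_subtype_iff.2 (hF.contMDiffAt (W.2.mem_nhds x.2))⟩

variable [IsManifold I ∞ M]

lemma contMDiffOn_dirDeriv {W : Opens M} {F : M → ℝ} (hF : ContMDiffOn I 𝓘(ℝ, ℝ) ∞ F W)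
    {X : ∀ x : M, TangentSpace I x}
    (hX : ContMDiffOn I I.tangent ∞ (fun x => (⟨x, X x⟩ : TangentBundle I M)) (W : Set M)) :
    ContMDiffOn I 𝓘(ℝ, ℝ) ∞ (fun x => dirDeriv F x (X x)) W := by
  have h1 := (hF.contMDiffOn_tangentMapWithin (m := ∞) (by simp) W.2.uniqueMDiffOn).comp hX
    (fun x hx => hx)
  have h2 := (contMDiff_snd_tangentBundle_modelSpace ℝ 𝓘(ℝ, ℝ) (n := ∞)).comp_contMDiffOn h1
  refine h2.congr fun x hx => ?_
  change _ = (mfderivWithin I 𝓘(ℝ, ℝ) F W x (X x) : ℝ)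
  rw [mfderivWithin_of_mem_nhds (W.isOpen.mem_nhds hx)]
  rfl

/-- A smooth vector field on `U` as a differential operator. -/
def DiffOp.ofVectorField {U : Opens M} (X : ∀ x : M, TangentSpace I x)
    (hX : ContMDiffOn I I.tangent ∞ (fun x => (⟨x, X x⟩ : TangentBundle I M)) (U : Set M)) :
    DiffOp I U :=
  ⟨⟨fun W =>
    { toFun := fun f => SmoothFn.ofContMDiffOn (fun x => dirDeriv (extendZero f) x (X x))
        (contMDiffOn_dirDeriv (contMDiffOn_extendZero f) (hX.mono W.2))
      map_add' := fun f g => DFunLike.ext _ _ fun x => by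
        refine Eq.trans (dirDeriv_congr ?_ _) (dirDeriv_add (mdifferentiableAt_extendZero f x.2)
          (mdifferentiableAt_extendZero g x.2) (X x))
        exact extendZero_eventuallyEq _ _ x.2 fun y => by
          rw [Pi.add_apply, extendZero_coe, extendZero_coe]; rfl
      map_smul' := fun r f => DFunLike.ext _ _ fun x => by
        refine Eq.trans (dirDeriv_congr ?_ _) (dirDeriv_const_mul
          (mdifferentiableAt_extendZero f x.2) r (X x))
        exact extendZero_eventuallyEq _ _ x.2 fun y => by
          rw [extendZero_coe]; rfl },
    fun W W' h f => DFunLike.ext _ _ fun x => by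
      refine dirDeriv_congr ?_ _
      exact extendZero_eventuallyEq _ _ x.2 fun y => (extendZero_of_mem f (h y.2)).symm⟩,
  fun x hx => ⟨U, le_rfl, hx, Algebra.subset_adjoin (Or.inr ⟨X, hX, fun W f x => rfl⟩)⟩⟩

lemma DiffOp.isVectorFieldOp_ofVectorField {U : Opens M} (X : ∀ x : M, TangentSpace I x)
    (hX : ContMDiffOn I I.tangent ∞ (fun x => (⟨x, X x⟩ : TangentBundle I M)) (U : Set M)) :
    IsVectorFieldOp I U X (DiffOp.ofVectorField X hX).1 := ⟨hX, fun _ _ _ => rfl⟩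

/-- Vector fields act as derivations. -/
lemma IsVectorFieldOp.apply_mul {U : Opens M} {X : ∀ x : M, TangentSpace I x} {P : DiffOp I U}
    (hP : IsVectorFieldOp I U X P.1) {W : Opens M} (hW : W ≤ U) (f g : SmoothFn I W) :
    (DiffOp.res I hW P).apply I (f * g) =
      f * (DiffOp.res I hW P).apply I g + g * (DiffOp.res I hW P).apply I f := by
  refine DFunLike.ext _ _ fun x => ?_
  refine (hP.2 ⟨W, hW⟩ (f * g) x).trans ?_
  have h1 : (mfderiv I 𝓘(ℝ, ℝ) (extendZero (f * g)) (x : M) (X x) : ℝ) =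
      dirDeriv (extendZero f * extendZero g) (x : M) (X x) :=
    dirDeriv_congr (extendZero_eventuallyEq _ _ x.2 fun y => by
      rw [Pi.mul_apply, extendZero_coe, extendZero_coe]; rfl) _
  refine h1.trans ((dirDeriv_mul (mdifferentiableAt_extendZero f x.2)
    (mdifferentiableAt_extendZero g x.2) _).trans ?_)
  rw [extendZero_coe, extendZero_coe]
  exact congrArg₂ (fun a b => f x * a + g x * b) (hP.2 ⟨W, hW⟩ g x).symm (hP.2 ⟨W, hW⟩ f x).symm

lemma IsVectorFieldOp.mul_ofFn {U : Opens M} {X : ∀ x : M, TangentSpace I x} {P : DiffOp I U}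
    (hP : IsVectorFieldOp I U X P.1) (a : SmoothFn I U) :
    P * DiffOp.ofFn I U a = DiffOp.ofFn I U a * P + DiffOp.ofFn I U (P.apply I a) := by
  refine DiffOp.ext_apply fun W hW f => ?_
  refine (hP.apply_mul hW (SmoothFn.res I hW a) f).trans ?_
  rw [DiffOp.apply_res, mul_comm f]
  rfl

end VectorFields

section Coordinates

variable {E : Type*} [NormedAddCommGroup E] [NormedSpace ℝ E]
  {H : Type*} [TopologicalSpace H] (I : ModelWithCorners ℝ E H)
  {M : Type*} [TopologicalSpace M] [ChartedSpace H M]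

/-- Smooth coordinates on an open subset `W` of `M` with values in a subset `image` of `ℝⁿ` on which
derivatives are unique and mixed second derivatives commute. The coordinate map and its inverse are
smooth on `W` and on `image`, and arbitrary elsewhere. -/
structure Coordinates (W : Opens M) (n : ℕ) where
  toFun : M → EuclideanSpace ℝ (Fin n)
  inv : EuclideanSpace ℝ (Fin n) → M
  image : Set (EuclideanSpace ℝ (Fin n))
  contMDiffOn_toFun : ContMDiffOn I 𝓘(ℝ, EuclideanSpace ℝ (Fin n)) ∞ toFun W
  contMDiffOn_inv : ContMDiffOn 𝓘(ℝ, EuclideanSpace ℝ (Fin n)) I ∞ inv image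
  map_mem : ∀ x ∈ W, toFun x ∈ image
  inv_mem : ∀ u ∈ image, inv u ∈ W
  left_inv : ∀ x ∈ W, inv (toFun x) = x
  right_inv : ∀ u ∈ image, toFun (inv u) = u
  uniqueDiffOn : UniqueDiffOn ℝ image
  subset_closure : image ⊆ closure (interior image)

namespace Coordinates

variable {I} {W : Opens M} {n : ℕ} (c : Coordinates I W n)

/-- The coordinate vector field `∂/∂x_i`. -/
def field (i : Fin n) (x : M) : TangentSpace I x :=
  (mfderivWithin 𝓘(ℝ, EuclideanSpace ℝ (Fin n)) I c.inv c.image (c.toFun x)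
    (EuclideanSpace.single i (1 : ℝ) : EuclideanSpace ℝ (Fin n)) : E)

/-- The coordinate function `x_i`. -/
def coord (i : Fin n) : SmoothFn I W :=
  SmoothFn.ofContMDiffOn (fun x => c.toFun x i)
    ((EuclideanSpace.proj i : EuclideanSpace ℝ (Fin n) →L[ℝ] ℝ).contDiff.contMDiff.comp_contMDiffOn
      c.contMDiffOn_toFun)

lemma mdifferentiableAt_toFun {x : M} (hx : x ∈ W) :
    MDifferentiableAt I 𝓘(ℝ, EuclideanSpace ℝ (Fin n)) c.toFun x :=
  (c.contMDiffOn_toFun.contMDiffAt (W.2.mem_nhds hx)).mdifferentiableAt (by simp)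

lemma dirDeriv_field {F : M → ℝ} {x : M} (hx : x ∈ W) (hF : MDifferentiableAt I 𝓘(ℝ, ℝ) F x)
    (i : Fin n) : dirDeriv F x (c.field i x) =
      fderivWithin ℝ (F ∘ c.inv) c.image (c.toFun x) (EuclideanSpace.single i 1) := by
  have h1 : mfderivWithin 𝓘(ℝ, EuclideanSpace ℝ (Fin n)) 𝓘(ℝ, ℝ) (F ∘ c.inv) c.image (c.toFun x) =
      (mfderiv I 𝓘(ℝ, ℝ) F x).comp
        (mfderivWithin 𝓘(ℝ, EuclideanSpace ℝ (Fin n)) I c.inv c.image (c.toFun x)) :=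
    mfderiv_comp_mfderivWithin_of_eq hF
      ((c.contMDiffOn_inv _ (c.map_mem x hx)).mdifferentiableWithinAt (by simp))
      (c.uniqueDiffOn _ (c.map_mem x hx)).uniqueMDiffWithinAt (c.left_inv x hx)
  rw [← mfderivWithin_eq_fderivWithin, h1]
  rfl

variable [IsManifold I ∞ M]

lemma contMDiffOn_field (i : Fin n) :
    ContMDiffOn I I.tangent ∞ (fun x => (⟨x, c.field i x⟩ : TangentBundle I M)) (W : Set M) := by
  have h1 := c.contMDiffOn_inv.contMDiffOn_tangentMapWithin (m := ∞) (by simp)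
    c.uniqueDiffOn.uniqueMDiffOn
  have h2 : ContMDiffOn I (𝓘(ℝ, EuclideanSpace ℝ (Fin n)).prod 𝓘(ℝ, EuclideanSpace ℝ (Fin n))) ∞
      (fun x => (c.toFun x, (EuclideanSpace.single i 1 : EuclideanSpace ℝ (Fin n)))) (W : Set M) :=
    c.contMDiffOn_toFun.prodMk contMDiffOn_const
  rw [chartedSpaceSelf_prod] at h2
  have h3 := (contMDiff_tangentBundleModelSpaceHomeomorph_symm
    (I := 𝓘(ℝ, EuclideanSpace ℝ (Fin n))) (n := ∞)).comp_contMDiffOn h2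
  refine (h1.comp h3 fun x hx => c.map_mem x hx).congr fun x hx => ?_
  have h4 : ∀ (y z : M) (v : E), y = z →
      (⟨y, v⟩ : TangentBundle I M) = (⟨z, v⟩ : TangentBundle I M) := by
    rintro y _ v rfl
    rfl
  exact h4 x (c.inv (c.toFun x)) _ (c.left_inv x hx).symm

/-- The partial derivative in the direction of the `i`-th coordinate. -/
def partialDeriv (i : Fin n) : DiffOp I W :=
  DiffOp.ofVectorField (c.field i) (c.contMDiffOn_field i)

lemma isVectorFieldOp_partialDeriv (i : Fin n) :
    IsVectorFieldOp I W (c.field i) (c.partialDeriv i).1 :=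
  DiffOp.isVectorFieldOp_ofVectorField _ _

lemma partialDeriv_apply {W' : Opens M} (hW : W' ≤ W) (i : Fin n) (f : SmoothFn I W') (x : W') :
    (DiffOp.res I hW (c.partialDeriv i)).apply I f x =
      fderivWithin ℝ (extendZero f ∘ c.inv) c.image (c.toFun x) (EuclideanSpace.single i 1) :=
  c.dirDeriv_field (hW x.2) (mdifferentiableAt_extendZero f x.2) i

omit [IsManifold I ∞ M] in
lemma preimage_mem_nhdsWithin {W' : Opens M} {x : M} (hx : x ∈ W) (hx' : x ∈ W') :
    c.inv ⁻¹' W' ∈ 𝓝[c.image] (c.toFun x) := by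
  have h1 : ContinuousWithinAt c.inv c.image (c.toFun x) :=
    c.contMDiffOn_inv.continuousOn _ (c.map_mem x hx)
  refine h1 (W'.2.mem_nhds ?_)
  rwa [c.left_inv x hx]

lemma partialDeriv_coord (i j : Fin n) :
    (c.partialDeriv i).apply I (c.coord j) = if j = i then 1 else 0 := by
  refine DFunLike.ext _ _ fun x => ?_
  refine (c.partialDeriv_apply le_rfl i (c.coord j) x).trans ?_
  have h1 : fderivWithin ℝ (extendZero (c.coord j) ∘ c.inv) c.image (c.toFun x) =
      fderivWithin ℝ (EuclideanSpace.proj j : EuclideanSpace ℝ (Fin n) →L[ℝ] ℝ) c.image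
        (c.toFun x) := by
    have h2 : ∀ u ∈ c.image, (extendZero (c.coord j) ∘ c.inv) u =
        (EuclideanSpace.proj j : EuclideanSpace ℝ (Fin n) →L[ℝ] ℝ) u := fun u hu => by
      rw [Function.comp_apply, extendZero_of_mem _ (c.inv_mem u hu)]
      change c.toFun (c.inv u) j = u j
      rw [c.right_inv u hu]
    exact fderivWithin_congr h2 (h2 _ (c.map_mem x x.2))
  rw [h1, ContinuousLinearMap.fderivWithin _ (c.uniqueDiffOn _ (c.map_mem x x.2))]
  change (EuclideanSpace.single i (1 : ℝ) : EuclideanSpace ℝ (Fin n)) j = _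
  rw [PiLp.single_apply]
  split_ifs <;> rfl

omit [IsManifold I ∞ M] in
lemma contDiffWithinAt_comp_inv {W' : Opens M} (f : SmoothFn I W') {x : M} (hx : x ∈ W)
    (hx' : x ∈ W') : ContDiffWithinAt ℝ ∞ (extendZero f ∘ c.inv) c.image (c.toFun x) := by
  have h1 : ContMDiffAt I 𝓘(ℝ, ℝ) ∞ (extendZero f) (c.inv (c.toFun x)) := by
    rw [c.left_inv x hx]
    exact (contMDiffOn_extendZero f).contMDiffAt (W'.2.mem_nhds hx')
  exact (h1.comp_contMDiffWithinAt _ (c.contMDiffOn_inv _ (c.map_mem x hx))).contDiffWithinAt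

lemma partialDeriv_mul_comm (i j : Fin n) :
    c.partialDeriv i * c.partialDeriv j = c.partialDeriv j * c.partialDeriv i := by
  have key : ∀ (i j : Fin n) (W' : Opens M) (hW : W' ≤ W) (f : SmoothFn I W') (x : W'),
      (DiffOp.res I hW (c.partialDeriv i)).apply I
        ((DiffOp.res I hW (c.partialDeriv j)).apply I f) x =
      fderivWithin ℝ (fderivWithin ℝ (extendZero f ∘ c.inv) c.image) c.image (c.toFun x)
        (EuclideanSpace.single i 1) (EuclideanSpace.single j 1) := fun i j W' hW f x => by
    rw [c.partialDeriv_apply]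
    have h1 : extendZero ((DiffOp.res I hW (c.partialDeriv j)).apply I f) ∘ c.inv
        =ᶠ[𝓝[c.image] (c.toFun x)] fun u =>
          fderivWithin ℝ (extendZero f ∘ c.inv) c.image u (EuclideanSpace.single j 1) := by
      filter_upwards [c.preimage_mem_nhdsWithin (hW x.2) x.2, self_mem_nhdsWithin] with u hu hu'
      rw [Function.comp_apply, extendZero_of_mem _ hu, c.partialDeriv_apply]
      change fderivWithin ℝ (extendZero f ∘ c.inv) c.image (c.toFun (c.inv u)) _ = _
      rw [c.right_inv u hu']
    have h2 := c.map_mem x (hW x.2)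
    rw [h1.fderivWithin_eq_of_mem h2]
    have h3 : DifferentiableWithinAt ℝ (fderivWithin ℝ (extendZero f ∘ c.inv) c.image) c.image
        (c.toFun x) :=
      ((c.contDiffWithinAt_comp_inv f (hW x.2) x.2).fderivWithin_right (m := ∞) c.uniqueDiffOn
        (by simp) h2).differentiableWithinAt (by simp)
    rw [fderivWithin_clm_apply (c.uniqueDiffOn _ h2) h3 (differentiableWithinAt_const _)]
    simp
  refine DiffOp.ext_apply fun W' hW f => DFunLike.ext _ _ fun x => ?_
  refine (key i j W' hW f x).trans (Eq.trans ?_ (key j i W' hW f x).symm)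
  exact ((c.contDiffWithinAt_comp_inv f (hW x.2) x.2).isSymmSndFDerivWithinAt
    (by simpa using WithTop.coe_le_coe.2 (le_top : (2 : ℕ∞) ≤ ⊤))
    c.uniqueDiffOn (c.subset_closure (c.map_mem x (hW x.2))) (c.map_mem x (hW x.2))).eq _ _

omit [IsManifold I ∞ M] in
/-- A vector field is the linear combination of the coordinate vector fields with its values on
the coordinate functions as coefficients. -/
lemma dirDeriv_eq_sum {F : M → ℝ} {x : M} (hx : x ∈ W)
    (hF : MDifferentiableAt I 𝓘(ℝ, ℝ) F x) (v : TangentSpace I x) :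
    dirDeriv F x v = ∑ i, dirDeriv (fun y => c.toFun y i) x v *
      fderivWithin ℝ (F ∘ c.inv) c.image (c.toFun x) (EuclideanSpace.single i 1) := by
  have h1 : mfderivWithin I 𝓘(ℝ, ℝ) ((F ∘ c.inv) ∘ c.toFun) W x =
      (mfderivWithin 𝓘(ℝ, EuclideanSpace ℝ (Fin n)) 𝓘(ℝ, ℝ) (F ∘ c.inv) c.image (c.toFun x)).comp
        (mfderivWithin I 𝓘(ℝ, EuclideanSpace ℝ (Fin n)) c.toFun W x) := by
    refine mfderivWithin_comp _ ?_ (c.mdifferentiableAt_toFun hx).mdifferentiableWithinAt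
      (fun y hy => c.map_mem y hy) (W.2.uniqueMDiffWithinAt hx)
    refine MDifferentiableAt.comp_mdifferentiableWithinAt _ ?_
      ((c.contMDiffOn_inv _ (c.map_mem x hx)).mdifferentiableWithinAt (by simp))
    rwa [c.left_inv x hx]
  rw [mfderivWithin_of_mem_nhds (W.isOpen.mem_nhds hx),
    mfderivWithin_of_mem_nhds (W.isOpen.mem_nhds hx),
    mfderivWithin_eq_fderivWithin] at h1
  have h2 : dirDeriv F x v = dirDeriv ((F ∘ c.inv) ∘ c.toFun) x v := by
    refine dirDeriv_congr ?_ v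
    filter_upwards [W.2.mem_nhds hx] with y hy
    rw [Function.comp_apply, Function.comp_apply, c.left_inv y hy]
  let w : EuclideanSpace ℝ (Fin n) := mfderiv I 𝓘(ℝ, EuclideanSpace ℝ (Fin n)) c.toFun x v
  have h3 : dirDeriv ((F ∘ c.inv) ∘ c.toFun) x v =
      fderivWithin ℝ (F ∘ c.inv) c.image (c.toFun x) w :=
    DFunLike.congr_fun (F := E →L[ℝ] ℝ) h1 v
  have h4 : ∀ i, dirDeriv (fun y => c.toFun y i) x v = w i := fun i => by
    have h5 := mfderiv_comp x
      ((EuclideanSpace.proj i : EuclideanSpace ℝ (Fin n) →L[ℝ] ℝ).differentiableAt.mdifferentiableAt)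
      (c.mdifferentiableAt_toFun hx)
    rw [mfderiv_eq_fderiv, ContinuousLinearMap.fderiv] at h5
    exact DFunLike.congr_fun (F := E →L[ℝ] ℝ) h5 v
  rw [h2, h3]
  conv_lhs => rw [← (EuclideanSpace.basisFun (Fin n) ℝ).sum_repr w, map_sum]
  refine Finset.sum_congr rfl fun i _ => ?_
  rw [h4, map_smul, smul_eq_mul, EuclideanSpace.basisFun_repr, EuclideanSpace.basisFun_apply]

lemma _root_.BoundaryDensities.IsVectorFieldOp.eq_sum {W' : Opens M} (hW : W' ≤ W)
    {X : ∀ x : M, TangentSpace I x} {P : SheafEnd I W'} (hP : IsVectorFieldOp I W' X P) :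
    P = ∑ i, SheafEnd.mulFn I W' (P.1 ⟨W', le_rfl⟩ (SmoothFn.res I hW (c.coord i))) *
      SheafEnd.res I hW (c.partialDeriv i).1 := by
  refine SheafEnd.ext fun V f x => ?_
  have h1 : ∀ (s : Finset (Fin n)) (Q : Fin n → SheafEnd I W'),
      (∑ i ∈ s, Q i).1 V f x = ∑ i ∈ s, (Q i).1 V f x := fun s Q => by
    classical
    induction s using Finset.induction_on with
    | empty => rfl
    | insert a t ha ih =>
      rw [Finset.sum_insert ha, Finset.sum_insert ha, ← ih]
      rfl
  rw [h1, hP.2]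
  refine (c.dirDeriv_eq_sum (hW (V.2 x.2)) (mdifferentiableAt_extendZero f x.2) (X x)).trans ?_
  refine Finset.sum_congr rfl fun i _ => ?_
  refine congrArg₂ (· * ·) ?_ (c.partialDeriv_apply (V.2.trans hW) i f x).symm
  refine Eq.trans ?_ (hP.2 ⟨W', le_rfl⟩ (SmoothFn.res I hW (c.coord i)) ⟨x, V.2 x.2⟩).symm
  exact (dirDeriv_congr (extendZero_eventuallyEq _ _ (V.2 x.2) fun y => rfl) _).symm

/-- Locally, differential operators are polynomials in functions and partial derivatives. -/
lemma exists_res_mem_closure {U : Opens M} (P : DiffOp I U) {x : M} (hx : x ∈ U) (hxW : x ∈ W) :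
    ∃ (W' : Opens M) (hU : W' ≤ U) (hW : W' ≤ W), x ∈ W' ∧ DiffOp.res I hU P ∈
      Subring.closure (range (DiffOp.ofFn I W') ∪
        range fun i => DiffOp.res I hW (c.partialDeriv i)) := by
  obtain ⟨W₁, hW₁, hxW₁, hP⟩ := P.2 x hx
  let W' := W₁ ⊓ W
  have hW : W' ≤ W := inf_le_right
  have hU : W' ≤ U := inf_le_left.trans hW₁
  refine ⟨W', hU, hW, ⟨hxW₁, hxW⟩, ?_⟩
  set S := Subring.closure (range (DiffOp.ofFn I W') ∪
    range fun i => DiffOp.res I hW (c.partialDeriv i)) with hS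
  let val : DiffOp I W' →+* SheafEnd I W' := (diffOpSubalgebra I W').val.toRingHom
  have h1 : ∀ Q ∈ Algebra.adjoin ℝ (diffOpGenerators I W'), Q ∈ S.map val := fun Q hQ => by
    induction hQ using Algebra.adjoin_induction with
    | mem Q hQ =>
      rcases hQ with ⟨f, rfl⟩ | ⟨X, hX⟩
      · exact ⟨DiffOp.ofFn I W' f, Subring.subset_closure (Or.inl ⟨f, rfl⟩), rfl⟩
      · rw [IsVectorFieldOp.eq_sum c hW hX]
        refine sum_mem fun i _ => mul_mem ?_ ?_
        · exact ⟨DiffOp.ofFn I W' _, Subring.subset_closure (Or.inl ⟨_, rfl⟩), rfl⟩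
        · exact ⟨DiffOp.res I hW (c.partialDeriv i),
            Subring.subset_closure (Or.inr ⟨i, rfl⟩), rfl⟩
    | algebraMap r =>
      refine ⟨DiffOp.ofFn I W' (algebraMap ℝ _ r), Subring.subset_closure (Or.inl ⟨_, rfl⟩), ?_⟩
      exact (SheafEnd.mulFn I W').commutes r
    | add Q Q' _ _ h h' => exact add_mem h h'
    | mul Q Q' _ _ h h' => exact mul_mem h h'
  obtain ⟨Q, hQ, hQP⟩ := h1 _ (res_mem_adjoin I (inf_le_left : W' ≤ W₁) hP)
  have : DiffOp.res I hU P = Q := Subtype.ext hQP.symm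
  rw [this]
  exact hQ

/-- The ring of germs of differential operators is generated by functions and partial
derivatives. -/
lemma closure_stalk_eq_top {x : M} (hx : x ∈ W) :
    Subring.closure (range (DiffOpStalk.ofFn I x) ∪
      range fun i => DiffOpStalk.germ I x hx (c.partialDeriv i)) = ⊤ := by
  refine eq_top_iff.2 fun D _ => ?_
  obtain ⟨U, hU, P, hUW, rfl⟩ := D.exists_germ_le hx
  obtain ⟨W', hW'U, hW'W, hxW', hP⟩ := c.exists_res_mem_closure P hU hx
  rw [← DiffOpStalk.germ_res I hW'U x hxW']
  have h1 := ((DiffOpStalk.germ I x hxW').map_closure _).le ⟨_, hP, rfl⟩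
  refine Subring.closure_mono ?_ h1
  rintro _ ⟨_, ⟨f, rfl⟩ | ⟨i, rfl⟩, rfl⟩
  · exact Or.inl ⟨FnStalk.germ I x hxW' f, rfl⟩
  · exact Or.inr ⟨i, (DiffOpStalk.germ_res I hW'W x hxW' _).symm⟩

end Coordinates

end Coordinates

/-! ### Linear independence of the monomials in the partial derivatives -/

section Weyl

variable {A C C' : Type*} [Ring A] [CommRing C] [CommRing C'] {n : ℕ}

/-- A ring of differential operators in `n` coordinates: `A` acts on the commutative ring `C` of
functions and contains it, `d i` are the partial derivatives and `y i` the coordinate functions. -/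
structure IsCoordinateFrame (act : A →+* AddMonoid.End C) (ofFn : C →+* A) (d : Fin n → A)
    (y : Fin n → C) : Prop where
  comm : ∀ i j, d i * d j = d j * d i
  act_ofFn : ∀ a b, act (ofFn a) b = a * b
  mul_ofFn : ∀ i a, d i * ofFn a = ofFn a * d i + ofFn (act (d i) a)
  act_coord : ∀ i j, act (d i) (y j) = if j = i then 1 else 0
  closure_eq_top : Subring.closure (range ofFn ∪ range d) = ⊤

namespace IsCoordinateFrame

variable {act : A →+* AddMonoid.End C} {ofFn : C →+* A} {d : Fin n → A} {y : Fin n → C}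

open scoped IsMulCommutative in
/-- Polynomials in the commuting operators `d i`. -/
lemma exists_eval (h : IsCoordinateFrame act ofFn d y) :
    ∃ ev : MvPolynomial (Fin n) ℤ →+* A, ∀ i, ev (MvPolynomial.X i) = d i := by
  have hcomm : ∀ a ∈ range d, ∀ b ∈ range d, a * b = b * a := by
    rintro _ ⟨i, rfl⟩ _ ⟨j, rfl⟩
    exact h.comm i j
  have := Subring.isMulCommutative_closure hcomm
  let f : MvPolynomial (Fin n) ℤ →+* Subring.closure (range d) :=
    MvPolynomial.eval₂Hom (Int.castRingHom _) fun i => ⟨d i, Subring.subset_closure ⟨i, rfl⟩⟩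
  refine ⟨(Subring.closure (range d)).subtype.comp f, fun i => ?_⟩
  rw [RingHom.comp_apply, MvPolynomial.eval₂Hom_X']
  rfl

/-- The evaluation homomorphism `p ↦ p(d)`. -/
def eval (h : IsCoordinateFrame act ofFn d y) : MvPolynomial (Fin n) ℤ →+* A := h.exists_eval.choose

lemma eval_X (h : IsCoordinateFrame act ofFn d y) (i : Fin n) : h.eval (MvPolynomial.X i) = d i :=
  h.exists_eval.choose_spec i

lemma eval_mul_coord (h : IsCoordinateFrame act ofFn d y) (i : Fin n)
    (p : MvPolynomial (Fin n) ℤ) :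
    h.eval p * ofFn (y i) = ofFn (y i) * h.eval p + h.eval (MvPolynomial.pderiv i p) := by
  induction p using MvPolynomial.induction_on with
  | C a =>
    have : h.eval (MvPolynomial.C a) = (a : A) :=
      map_intCast (h.eval.comp (MvPolynomial.C (σ := Fin n))) a
    rw [MvPolynomial.pderiv_C, map_zero, add_zero, this]
    exact Int.cast_comm _ _
  | add p q hp hq => rw [map_add, map_add, map_add, add_mul, mul_add, hp, hq]; abel
  | mul_X p j hp =>
    rw [map_mul, eval_X, mul_assoc, h.mul_ofFn, h.act_coord, mul_add, ← mul_assoc, hp,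
      Derivation.leibniz, map_add, MvPolynomial.pderiv_X, smul_eq_mul, smul_eq_mul, map_mul,
      map_mul, eval_X, Pi.single_apply]
    have hc : d j * h.eval (MvPolynomial.pderiv i p) = h.eval (MvPolynomial.pderiv i p) * d j := by
      rw [← h.eval_X j, ← map_mul, mul_comm, map_mul]
    rw [hc]
    by_cases hij : i = j
    · subst hij
      simp only [if_true, map_one, mul_one]
      noncomm_ring
    · rw [if_neg hij, if_neg fun h => hij h.symm, map_zero, map_zero, mul_zero]
      noncomm_ring

/-- Every operator is a linear combination of monomials in the partial derivatives, with functions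
as coefficients on the left. -/
lemma closure_ofFn_mul_eval (h : IsCoordinateFrame act ofFn d y) :
    AddSubgroup.closure {D | ∃ a α, D = ofFn a * h.eval (MvPolynomial.monomial α 1)} = ⊤ := by
  set L := AddSubgroup.closure {D | ∃ a α, D = ofFn a * h.eval (MvPolynomial.monomial α 1)}
  have h1 : ∀ P : A, ∀ D ∈ L, P * D ∈ L := fun P => by
    have hP : P ∈ Subring.closure (range ofFn ∪ range d) := by
      rw [h.closure_eq_top]
      trivial
    induction hP using Subring.closure_induction with
    | mem P hP =>
      intro D hD
      induction hD using AddSubgroup.closure_induction with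
      | mem D hD =>
        obtain ⟨a, α, rfl⟩ := hD
        rcases hP with ⟨b, rfl⟩ | ⟨i, rfl⟩
        · exact AddSubgroup.subset_closure ⟨b * a, α, by rw [map_mul, mul_assoc]⟩
        · rw [← mul_assoc, h.mul_ofFn, add_mul]
          refine add_mem (AddSubgroup.subset_closure ⟨a, Finsupp.single i 1 + α, ?_⟩)
            (AddSubgroup.subset_closure ⟨_, α, rfl⟩)
          rw [mul_assoc, ← h.eval_X, ← map_mul, MvPolynomial.X, MvPolynomial.monomial_mul, one_mul]
      | zero => rw [mul_zero]; exact zero_mem _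
      | add D D' _ _ hD hD' => rw [mul_add]; exact add_mem hD hD'
      | neg D _ hD => rw [mul_neg]; exact neg_mem hD
    | zero => intro D _; rw [zero_mul]; exact zero_mem _
    | one => intro D hD; rwa [one_mul]
    | add P Q _ _ hP hQ => intro D hD; rw [add_mul]; exact add_mem (hP D hD) (hQ D hD)
    | neg P _ hP => intro D hD; rw [neg_mul]; exact neg_mem (hP D hD)
    | mul P Q _ _ hP hQ => intro D hD; rw [mul_assoc]; exact hP _ (hQ D hD)
  refine eq_top_iff.2 fun P _ => ?_
  rw [← mul_one P]
  refine h1 P 1 (AddSubgroup.subset_closure ⟨1, 0, ?_⟩)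
  rw [map_one, one_mul, MvPolynomial.monomial_zero', map_one, map_one]

/-- The operator `g ↦ ∑_α F_α · pull (∂^α g)` with the coefficients of `F`. -/
def symbolOperator (h : IsCoordinateFrame act ofFn d y) (pull : C →+* C') :
    MvPolynomial (Fin n) C' →ₗ[C'] (C → C') :=
  (MvPolynomial.basisMonomials (Fin n) C').constr C' fun α g =>
    pull (act (h.eval (MvPolynomial.monomial α 1)) g)

lemma symbolOperator_monomial (h : IsCoordinateFrame act ofFn d y) (pull : C →+* C')
    (α : Fin n →₀ ℕ) (f : C') (g : C) : h.symbolOperator pull (MvPolynomial.monomial α f) g =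
      f * pull (act (h.eval (MvPolynomial.monomial α 1)) g) := by
  have h1 : MvPolynomial.monomial α f = f • MvPolynomial.basisMonomials (Fin n) C' α := by
    rw [MvPolynomial.coe_basisMonomials, MvPolynomial.smul_monomial, smul_eq_mul, mul_one]
  rw [h1, map_smul, symbolOperator, Module.Basis.constr_basis]
  rfl

lemma symbolOperator_coord_mul (h : IsCoordinateFrame act ofFn d y) (pull : C →+* C') (i : Fin n)
    (F : MvPolynomial (Fin n) C') (g : C) : h.symbolOperator pull F (y i * g) =
      pull (y i) * h.symbolOperator pull F g +
        h.symbolOperator pull (MvPolynomial.pderiv i F) g := by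
  induction F using MvPolynomial.induction_on' with
  | monomial α f =>
    have hmul : ∀ (D D' : A) (b : C), act (D * D') b = act D (act D' b) := fun D D' b =>
      DFunLike.congr_fun (map_mul act D D') b
    have hadd : ∀ (D D' : A) (b : C), act (D + D') b = act D b + act D' b := fun D D' b =>
      DFunLike.congr_fun (map_add act D D') b
    have hsmul : ∀ (k : ℕ) (D : A) (b : C), act (k • D) b = k • act D b := fun k D b =>
      DFunLike.congr_fun (map_nsmul act k D) b
    rw [MvPolynomial.pderiv_monomial, symbolOperator_monomial, symbolOperator_monomial,
      symbolOperator_monomial, ← h.act_ofFn, ← hmul,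
      h.eval_mul_coord, hadd, MvPolynomial.pderiv_monomial, one_mul,
      hmul, h.act_ofFn, map_add, map_mul]
    have h2 : MvPolynomial.monomial (α - Finsupp.single i 1) ((α i : ℕ) : ℤ) =
        (α i) • MvPolynomial.monomial (α - Finsupp.single i 1) (1 : ℤ) := by
      rw [MvPolynomial.smul_monomial, nsmul_eq_mul, mul_one]
    rw [h2, map_nsmul, hsmul, map_nsmul, nsmul_eq_mul]
    ring
  | add F G hF hG =>
    rw [map_add, map_add, map_add, Pi.add_apply, Pi.add_apply, Pi.add_apply, hF, hG]
    ring

/-- The monomials in the partial derivatives are linearly independent, even after composition with a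
ring homomorphism `pull`: the commutator with the `i`-th coordinate is the operator of the `i`-th
partial derivative of the symbol, so that the degree of the symbol can be reduced. -/
lemma symbolOperator_injective (h : IsCoordinateFrame act ofFn d y) (pull : C →+* C')
    (htor : ∀ (k : ℕ) (f : C'), k ≠ 0 → (k : C') * f = 0 → f = 0) {F : MvPolynomial (Fin n) C'}
    (hF : h.symbolOperator pull F = 0) : F = 0 := by
  suffices H : ∀ (N : ℕ) (F : MvPolynomial (Fin n) C'), h.symbolOperator pull F = 0 →
      (∀ α : Fin n →₀ ℕ, N ≤ α.degree → F.coeff α = 0) → F = 0 by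
    refine H (F.totalDegree + 1) F hF fun α hα => ?_
    exact MvPolynomial.coeff_eq_zero_of_totalDegree_lt hα
  intro N
  induction N with
  | zero => exact fun F _ hN => MvPolynomial.ext _ _ fun α => hN α (Nat.zero_le _)
  | succ N ih =>
    intro F hF hN
    have h1 : ∀ i, MvPolynomial.pderiv i F = 0 := fun i => by
      refine ih _ (funext fun g => ?_) fun α hα => ?_
      · have h2 := h.symbolOperator_coord_mul pull i F g
        rw [hF, Pi.zero_apply, Pi.zero_apply, mul_zero, zero_add] at h2
        exact h2.symm
      · rw [MvPolynomial.coeff_pderiv, hN, zero_mul]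
        rw [map_add, Finsupp.degree_single]
        omega
    have h2 : ∀ α, α ≠ 0 → F.coeff α = 0 := fun α hα => by
      obtain ⟨i, hi⟩ := DFunLike.ne_iff.1 hα
      have h3 := congrArg (MvPolynomial.coeff (α - Finsupp.single i 1)) (h1 i)
      have h4 : α - Finsupp.single i 1 + Finsupp.single i 1 = α :=
        tsub_add_cancel_of_le (Finsupp.single_le_iff.2 (Nat.one_le_iff_ne_zero.2 hi))
      rw [MvPolynomial.coeff_pderiv, h4, MvPolynomial.coeff_zero, mul_comm] at h3
      refine htor ((α - Finsupp.single i 1 : Fin n →₀ ℕ) i + 1) _ (Nat.succ_ne_zero _) ?_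
      exact_mod_cast h3
    have h3 : F = MvPolynomial.monomial 0 (F.coeff 0) := by
      refine MvPolynomial.ext _ _ fun α => ?_
      rw [MvPolynomial.coeff_monomial]
      split_ifs with hα
      · rw [hα]
      · exact h2 α fun h => hα h.symm
    have h4 := congrFun hF 1
    have h5 : act (h.eval (MvPolynomial.monomial 0 1)) 1 = 1 := by
      have h6 : act (h.eval (MvPolynomial.monomial 0 1)) = 1 := by
        rw [MvPolynomial.monomial_zero', map_one, map_one, map_one]
      rw [h6]
      rfl
    rw [h3, symbolOperator_monomial, h5, map_one, mul_one, Pi.zero_apply] at h4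
    rw [h3, h4, map_zero]

end IsCoordinateFrame

end Weyl

/-! ### Integration of densities -/

section Integration

variable {m : ℕ} {N : Type*} [TopologicalSpace N] [ChartedSpace (EuclideanSpace ℝ (Fin m)) N]

/-- `g` is continuous with compact support in `V`. -/
structure IsCompactlySupportedIn (V : Opens N) (g : N → ℝ) : Prop where
  continuous : Continuous g
  hasCompactSupport : HasCompactSupport g
  tsupport_subset : tsupport g ⊆ V

namespace IsCompactlySupportedIn

variable {V : Opens N} {g : N → ℝ}

lemma continuous_mul_left (h : IsCompactlySupportedIn V g) {a : N → ℝ} (ha : Continuous a) :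
    IsCompactlySupportedIn V (fun x => a x * g x) :=
  ⟨ha.mul h.continuous, h.hasCompactSupport.mul_left,
    tsupport_mul_subset_right.trans h.tsupport_subset⟩

lemma continuousOn_mul (h : IsCompactlySupportedIn V g) {a : N → ℝ} {W : Opens N}
    (ha : ContinuousOn a W) (hW : tsupport g ⊆ W) :
    IsCompactlySupportedIn V (fun x => g x * a x) := by
  have h1 : tsupport (fun x => g x * a x) ⊆ tsupport g := tsupport_mul_subset_left
  exact ⟨continuous_of_tsupport fun x hx => h.continuous.continuousAt.mul
    (ha.continuousAt (W.isOpen.mem_nhds (hW (h1 hx)))), h.hasCompactSupport.mul_right,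
    h1.trans h.tsupport_subset⟩

lemma mono (h : IsCompactlySupportedIn V g) {V' : Opens N} (hV : tsupport g ⊆ V') :
    IsCompactlySupportedIn V' g := ⟨h.1, h.2, hV⟩

lemma eq_zero (h : IsCompactlySupportedIn V g) {x : N} (hx : x ∉ V) : g x = 0 :=
  image_eq_zero_of_notMem_tsupport fun h' => hx (h.tsupport_subset h')

end IsCompactlySupportedIn

variable (m) in
/-- The integral of a function over the domain of the chart at `i`, with respect to the Lebesgue
measure in the coordinates of that chart. -/
def chartIntegral (i : N) (h : N → ℝ) : ℝ :=
  ∫ y in (extChartAt (𝓡 m) i).target, h ((extChartAt (𝓡 m) i).symm y)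

variable (m) in
/-- The domain of the chart at `i`. -/
def chartDomain (i : N) : Opens N :=
  ⟨(chartAt (EuclideanSpace ℝ (Fin m)) i).source, (chartAt _ i).open_source⟩

lemma mem_chartDomain (i : N) : i ∈ chartDomain m i := mem_chart_source _ i

lemma chartIntegral_congr {i : N} {h h' : N → ℝ} (hh : ∀ x ∈ chartDomain m i, h x = h' x) :
    chartIntegral m i h = chartIntegral m i h' := by
  refine setIntegral_congr_fun (isOpen_extChartAt_target i).measurableSet fun y hy => ?_
  refine hh _ ?_
  have := (extChartAt (𝓡 m) i).map_target hy
  rwa [extChartAt_source] at this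

lemma chartIntegral_const_mul {i : N} (r : ℝ) (h : N → ℝ) :
    chartIntegral m i (fun x => r * h x) = r * chartIntegral m i h := integral_const_mul _ _

lemma IsCompactlySupportedIn.integrableOn {i : N} {h : N → ℝ}
    (hh : IsCompactlySupportedIn (chartDomain m i) h) :
    IntegrableOn (fun y => h ((extChartAt (𝓡 m) i).symm y)) (extChartAt (𝓡 m) i).target := by
  have hsub : tsupport h ⊆ (extChartAt (𝓡 m) i).source := by
    rw [extChartAt_source]
    exact hh.tsupport_subset
  have hK : IsCompact (extChartAt (𝓡 m) i '' tsupport h) :=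
    hh.hasCompactSupport.isCompact.image_of_continuousOn ((continuousOn_extChartAt i).mono hsub)
  have hKt : extChartAt (𝓡 m) i '' tsupport h ⊆ (extChartAt (𝓡 m) i).target := by
    rintro _ ⟨x, hx, rfl⟩
    exact (extChartAt (𝓡 m) i).map_source (hsub hx)
  refine IntegrableOn.of_forall_sdiff_eq_zero (s := extChartAt (𝓡 m) i '' tsupport h) ?_
    (isOpen_extChartAt_target i).measurableSet fun y hy => ?_
  · exact (hh.continuous.comp_continuousOn ((continuousOn_extChartAt_symm i).mono
      hKt)).integrableOn_compact hK
  · refine image_eq_zero_of_notMem_tsupport fun h' => hy.2 ⟨_, h', ?_⟩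
    exact (extChartAt (𝓡 m) i).right_inv hy.1

lemma chartIntegral_add {i : N} {h h' : N → ℝ}
    (hh : IsCompactlySupportedIn (chartDomain m i) h)
    (hh' : IsCompactlySupportedIn (chartDomain m i) h') :
    chartIntegral m i (fun x => h x + h' x) = chartIntegral m i h + chartIntegral m i h' :=
  integral_add hh.integrableOn hh'.integrableOn

lemma chartIntegral_sum {i : N} {α : Type*} (t : Finset α) (h : α → N → ℝ)
    (hh : ∀ a ∈ t, IsCompactlySupportedIn (chartDomain m i) (h a)) :
    chartIntegral m i (fun x => ∑ a ∈ t, h a x) = ∑ a ∈ t, chartIntegral m i (h a) :=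
  integral_finsetSum t fun a ha => (hh a ha).integrableOn

/-- A function whose support meets a compact set `K` only is integrated over the image of `K` in the
chart. -/
lemma abs_chartIntegral_le {i : N} {K : Set N} (hK : IsCompact K)
    (hKi : K ⊆ chartDomain m i) {C : ℝ} {h : N → ℝ} (h0 : ∀ x ∉ K, h x = 0)
    (hC : ∀ x ∈ K, |h x| ≤ C) :
    |chartIntegral m i h| ≤ C * volume.real (extChartAt (𝓡 m) i '' K) := by
  have hsub : K ⊆ (extChartAt (𝓡 m) i).source := by
    rw [extChartAt_source]
    exact hKi
  have hK' : IsCompact (extChartAt (𝓡 m) i '' K) :=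
    hK.image_of_continuousOn ((continuousOn_extChartAt i).mono hsub)
  have hKt : extChartAt (𝓡 m) i '' K ⊆ (extChartAt (𝓡 m) i).target := by
    rintro _ ⟨x, hx, rfl⟩
    exact (extChartAt (𝓡 m) i).map_source (hsub hx)
  have h1 : chartIntegral m i h =
      ∫ y in extChartAt (𝓡 m) i '' K, h ((extChartAt (𝓡 m) i).symm y) := by
    refine setIntegral_eq_of_subset_of_forall_sdiff_eq_zero
      (isOpen_extChartAt_target i).measurableSet hKt fun y hy => ?_
    exact h0 _ fun h' => hy.2 ⟨_, h', (extChartAt (𝓡 m) i).right_inv hy.1⟩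
  rw [h1, ← Real.norm_eq_abs]
  refine norm_setIntegral_le_of_norm_le_const hK'.measure_lt_top ?_
  rintro _ ⟨x, hx, rfl⟩
  rw [(extChartAt (𝓡 m) i).left_inv (hsub hx)]
  exact hC x hx

variable [IsManifold (𝓡 m) ∞ N]

lemma hasFDerivAt_extChartAt_comp_symm {i j : N} {x : N} (hi : x ∈ chartDomain m i)
    (hj : x ∈ chartDomain m j) :
    HasFDerivAt (extChartAt (𝓡 m) j ∘ (extChartAt (𝓡 m) i).symm)
      (tangentCoordChange (𝓡 m) i j x) (extChartAt (𝓡 m) i x) := by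
  have h := hasFDerivWithinAt_tangentCoordChange (I := 𝓡 m) (x := i) (y := j) (z := x)
    ⟨by rw [extChartAt_source]; exact hi, by rw [extChartAt_source]; exact hj⟩
  simp only [modelWithCornersSelf_coe, range_id] at h
  exact h.hasFDerivAt univ_mem

/-- Change of variables. -/
lemma chartIntegral_eq_of_density {V : Opens N} (ν : Density (𝓡 m) V) {g : N → ℝ} {i j : N}
    (hg : ∀ x, g x ≠ 0 → x ∈ V ∧ x ∈ chartDomain m i ∧ x ∈ chartDomain m j) :
    chartIntegral m i (fun x => g x * ν.1 i x) = chartIntegral m j (fun x => g x * ν.1 j x) := by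
  set φ := extChartAt (𝓡 m) i with hφ
  set ψ := extChartAt (𝓡 m) j with hψ
  have hφs : φ.source = chartDomain m i := extChartAt_source _ _
  have hψs : ψ.source = chartDomain m j := extChartAt_source _ _
  let S : Set N := φ.source ∩ ψ.source
  have hgS : ∀ x ∉ S, g x = 0 := fun x hx => by
    by_contra h
    exact hx ⟨hφs ▸ (hg x h).2.1, hψs ▸ (hg x h).2.2⟩
  have hmeas : MeasurableSet (φ '' S) := by
    refine IsOpen.measurableSet ?_
    rw [show φ '' S = φ.target ∩ φ.symm ⁻¹' ψ.source from φ.image_source_inter_eq' ψ.source]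
    exact (continuousOn_extChartAt_symm i).isOpen_inter_preimage (isOpen_extChartAt_target i)
      (isOpen_extChartAt_source j)
  have h1 : chartIntegral m i (fun x => g x * ν.1 i x) =
      ∫ y in φ '' S, g (φ.symm y) * ν.1 i (φ.symm y) := by
    refine setIntegral_eq_of_subset_of_forall_sdiff_eq_zero
      (isOpen_extChartAt_target i).measurableSet ?_ fun y hy => ?_
    · rintro _ ⟨x, hx, rfl⟩
      exact φ.map_source hx.1
    · exact mul_eq_zero_of_left (hgS _ fun h => hy.2 ⟨_, h, φ.right_inv hy.1⟩) _
  have h2 : chartIntegral m j (fun x => g x * ν.1 j x) =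
      ∫ y in (ψ ∘ φ.symm) '' (φ '' S), g (ψ.symm y) * ν.1 j (ψ.symm y) := by
    refine setIntegral_eq_of_subset_of_forall_sdiff_eq_zero
      (isOpen_extChartAt_target j).measurableSet ?_ fun y hy => ?_
    · rintro _ ⟨_, ⟨x, hx, rfl⟩, rfl⟩
      simp only [Function.comp_apply, φ.left_inv hx.1]
      exact ψ.map_source hx.2
    · refine mul_eq_zero_of_left (hgS _ fun h => hy.2 ⟨_, ⟨_, h, rfl⟩, ?_⟩) _
      simp only [Function.comp_apply, φ.left_inv h.1]
      exact ψ.right_inv hy.1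
  rw [h1, h2, integral_image_eq_integral_abs_det_fderiv_smul volume hmeas
    (f' := fun y => tangentCoordChange (𝓡 m) i j (φ.symm y))]
  · refine setIntegral_congr_fun hmeas ?_
    rintro _ ⟨x, hx, rfl⟩
    simp only [Function.comp_apply, φ.left_inv hx.1, ψ.left_inv hx.2, smul_eq_mul]
    by_cases hgx : g x = 0
    · simp [hgx]
    · rw [ν.2.2.2 i j x (hg x hgx).1 (hg x hgx).2.1 (hg x hgx).2.2]
      ring
  · rintro _ ⟨x, hx, rfl⟩
    simp only [φ.left_inv hx.1]
    exact (hasFDerivAt_extChartAt_comp_symm (hφs.subset hx.1) (hψs.subset hx.2)).hasFDerivWithinAt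
  · rintro _ ⟨x, hx, rfl⟩ _ ⟨x', hx', rfl⟩ h
    simp only [Function.comp_apply, φ.left_inv hx.1, φ.left_inv hx'.1] at h
    rw [ψ.injOn hx.2 hx'.2 h]

variable [T2Space N] [SigmaCompactSpace N]

lemma tsupport_chartPartition (i : N) :
    tsupport (chartPartition (𝓡 m) N i) ⊆ chartDomain m i :=
  (SmoothPartitionOfUnity.exists_isSubordinate_chartAt_source (𝓡 m) N).choose_spec i

omit [T2Space N] [SigmaCompactSpace N] in
lemma isCompactlySupportedIn_mul_density {V : Opens N} (ν : Density (𝓡 m) V) {g : N → ℝ} {i : N}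
    (hg : IsCompactlySupportedIn (V ⊓ chartDomain m i) g) :
    IsCompactlySupportedIn (chartDomain m i) (fun x => g x * ν.1 i x) :=
  (hg.mono (hg.tsupport_subset.trans inf_le_right)).continuousOn_mul
    (W := V ⊓ chartDomain m i) (ν.2.2.1 i).continuousOn hg.tsupport_subset

lemma isCompactlySupportedIn_chartPartition_mul {V : Opens N} {g : N → ℝ}
    (hg : IsCompactlySupportedIn V g) (i : N) :
    IsCompactlySupportedIn (V ⊓ chartDomain m i)
      (fun x => chartPartition (𝓡 m) N i x * g x) :=
  (hg.continuous_mul_left (chartPartition (𝓡 m) N i).contMDiff.continuous).mono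
    (subset_inter (tsupport_mul_subset_right.trans hg.tsupport_subset)
      (tsupport_mul_subset_left.trans (tsupport_chartPartition i)))

/-- The charts that contribute to the integral of a function with support in a compact set. -/
lemma exists_finset_integral_eq {K : Set N} (hK : IsCompact K) :
    ∃ t : Finset N, (∀ x ∈ K, ∑ i ∈ t, chartPartition (𝓡 m) N i x = 1) ∧
      ∀ {V : Opens N} (ν : Density (𝓡 m) V) (g : N → ℝ), tsupport g ⊆ K →
        ν.integral (𝓡 m) g = ∑ i ∈ t,
          chartIntegral m i (fun x => chartPartition (𝓡 m) N i x * g x * ν.1 i x) := by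
  have hfin := (chartPartition (𝓡 m) N).locallyFinite.finite_nonempty_inter_compact hK
  refine ⟨hfin.toFinset, fun x hx => ?_, fun {V} ν g hg => ?_⟩
  · rw [← (chartPartition (𝓡 m) N).sum_eq_one (mem_univ x)]
    exact (finsum_eq_sum_of_support_subset _ fun i hi => hfin.mem_toFinset.2 ⟨x, hi, hx⟩).symm
  · unfold Density.integral
    rw [finsum_eq_sum_of_support_subset]
    · refine Finset.sum_congr rfl fun i _ => ?_
      unfold chartIntegral
      simp only [mul_assoc]
    · intro i hi
      by_contra hit
      refine hi ?_
      refine integral_eq_zero_of_ae (Eventually.of_forall fun y => ?_)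
      by_cases hy : (extChartAt (𝓡 m) i).symm y ∈ K
      · have : chartPartition (𝓡 m) N i ((extChartAt (𝓡 m) i).symm y) = 0 := by
          by_contra h
          exact hit (hfin.mem_toFinset.2 ⟨_, h, hy⟩)
        change _ * _ = (0 : ℝ)
        rw [this, zero_mul]
      · change _ * (_ * _) = (0 : ℝ)
        rw [image_eq_zero_of_notMem_tsupport fun h => hy (hg h), zero_mul, mul_zero]

lemma Density.integral_congr {V V' : Opens N} (ν : Density (𝓡 m) V) (ν' : Density (𝓡 m) V')
    {g g' : N → ℝ} (h : ∀ i x, g x * ν.1 i x = g' x * ν'.1 i x) :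
    ν.integral (𝓡 m) g = ν'.integral (𝓡 m) g' := by
  unfold Density.integral
  simp only [h]

/-- If the support of `g` is contained in the domain of a chart, the integral of `g` against a
density is computed in that chart. -/
lemma Density.integral_eq_chartIntegral {V : Opens N} (ν : Density (𝓡 m) V) {g : N → ℝ} {j : N}
    (hg : IsCompactlySupportedIn (V ⊓ chartDomain m j) g) :
    ν.integral (𝓡 m) g = chartIntegral m j (fun x => g x * ν.1 j x) := by
  obtain ⟨t, ht1, ht⟩ := exists_finset_integral_eq (m := m) hg.hasCompactSupport.isCompact
  have h1 : ∀ i, IsCompactlySupportedIn (V ⊓ chartDomain m j)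
      (fun x => chartPartition (𝓡 m) N i x * g x) := fun i =>
    hg.continuous_mul_left (chartPartition (𝓡 m) N i).contMDiff.continuous
  rw [ht ν g subset_rfl, Finset.sum_congr rfl fun i _ =>
    chartIntegral_eq_of_density (j := j) ν (g := fun x => chartPartition (𝓡 m) N i x * g x)
      fun x hx => ?_, ← chartIntegral_sum t _ fun i _ =>
      isCompactlySupportedIn_mul_density ν (h1 i)]
  · refine chartIntegral_congr fun x _ => ?_
    rw [← Finset.sum_mul, ← Finset.sum_mul]
    by_cases hx : x ∈ tsupport g
    · rw [ht1 x hx, one_mul]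
    · simp [image_eq_zero_of_notMem_tsupport hx]
  · have h2 : x ∈ tsupport g := by
      by_contra h
      exact hx (by simp [image_eq_zero_of_notMem_tsupport h])
    have h3 : x ∈ tsupport (chartPartition (𝓡 m) N i) := by
      by_contra h
      exact hx (by simp [image_eq_zero_of_notMem_tsupport h])
    exact ⟨(hg.tsupport_subset h2).1, tsupport_chartPartition i h3, (hg.tsupport_subset h2).2⟩

lemma Density.integral_add {V : Opens N} (ν : Density (𝓡 m) V) {g g' : N → ℝ}
    (hg : IsCompactlySupportedIn V g) (hg' : IsCompactlySupportedIn V g') :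
    ν.integral (𝓡 m) (fun x => g x + g' x) = ν.integral (𝓡 m) g + ν.integral (𝓡 m) g' := by
  obtain ⟨t, -, ht⟩ := exists_finset_integral_eq (m := m)
    (hg.hasCompactSupport.isCompact.union hg'.hasCompactSupport.isCompact)
  rw [ht ν g subset_union_left, ht ν g' subset_union_right, ht ν _ (tsupport_add g g'),
    ← Finset.sum_add_distrib]
  refine Finset.sum_congr rfl fun i _ => ?_
  rw [← chartIntegral_add
    (isCompactlySupportedIn_mul_density ν (isCompactlySupportedIn_chartPartition_mul hg i))
    (isCompactlySupportedIn_mul_density ν (isCompactlySupportedIn_chartPartition_mul hg' i))]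
  refine chartIntegral_congr fun x _ => ?_
  ring

lemma Density.add_integral {V : Opens N} (ν ν' : Density (𝓡 m) V) {g : N → ℝ}
    (hg : IsCompactlySupportedIn V g) :
    (ν + ν').integral (𝓡 m) g = ν.integral (𝓡 m) g + ν'.integral (𝓡 m) g := by
  obtain ⟨t, -, ht⟩ := exists_finset_integral_eq (m := m) hg.hasCompactSupport.isCompact
  rw [ht _ g subset_rfl, ht _ g subset_rfl, ht _ g subset_rfl, ← Finset.sum_add_distrib]
  refine Finset.sum_congr rfl fun i _ => ?_
  rw [← chartIntegral_add
    (isCompactlySupportedIn_mul_density ν (isCompactlySupportedIn_chartPartition_mul hg i))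
    (isCompactlySupportedIn_mul_density ν' (isCompactlySupportedIn_chartPartition_mul hg i))]
  exact chartIntegral_congr fun x _ => mul_add _ (ν.1 i x) (ν'.1 i x)

lemma Density.integral_const_mul {V : Opens N} (ν : Density (𝓡 m) V) {g : N → ℝ} (r : ℝ)
    (hg : IsCompactlySupportedIn V g) :
    ν.integral (𝓡 m) (fun x => r * g x) = r * ν.integral (𝓡 m) g := by
  obtain ⟨t, -, ht⟩ := exists_finset_integral_eq (m := m) hg.hasCompactSupport.isCompact
  rw [ht ν g subset_rfl, ht ν _ tsupport_mul_subset_right, Finset.mul_sum]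
  refine Finset.sum_congr rfl fun i _ => ?_
  rw [← chartIntegral_const_mul]
  refine chartIntegral_congr fun x _ => ?_
  ring

lemma Density.integral_zero {V : Opens N} (ν : Density (𝓡 m) V) :
    ν.integral (𝓡 m) (fun _ => 0) = 0 := by
  unfold Density.integral
  simp

lemma Density.zero_integral {V : Opens N} (g : N → ℝ) :
    (0 : Density (𝓡 m) V).integral (𝓡 m) g = 0 :=
  (Density.integral_congr (0 : Density (𝓡 m) V) (0 : Density (𝓡 m) V) (g' := fun _ => 0)
    fun _ x => (mul_zero (g x)).trans (zero_mul _).symm).trans (Density.integral_zero _)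

/-- Integration against a density is continuous for the supremum norm. -/
lemma Density.exists_integral_bound {V : Opens N} (ν : Density (𝓡 m) V) {K : Set N}
    (hK : IsCompact K) (hKV : K ⊆ V) : ∃ C : ℝ, ∀ g : N → ℝ, tsupport g ⊆ K →
      ∀ b : ℝ, 0 ≤ b → (∀ x, |g x| ≤ b) → |ν.integral (𝓡 m) g| ≤ C * b := by
  obtain ⟨t, -, ht⟩ := exists_finset_integral_eq (m := m) hK
  have hKi : ∀ i, IsCompact (K ∩ tsupport (chartPartition (𝓡 m) N i)) := fun i =>
    hK.inter_right (isClosed_tsupport _)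
  have h1 : ∀ i, ∃ C : ℝ, 0 ≤ C ∧ ∀ x ∈ K ∩ tsupport (chartPartition (𝓡 m) N i),
      |chartPartition (𝓡 m) N i x * ν.1 i x| ≤ C := fun i => by
    obtain ⟨C, hC⟩ := (hKi i).exists_bound_of_continuousOn
      (f := fun x => chartPartition (𝓡 m) N i x * ν.1 i x)
      ((chartPartition (𝓡 m) N i).contMDiff.continuous.continuousOn.mul
        ((ν.2.2.1 i).continuousOn.mono fun x hx => ⟨hKV hx.1, tsupport_chartPartition i hx.2⟩))
    exact ⟨|C|, abs_nonneg _, fun x hx => (hC x hx).trans (le_abs_self C)⟩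
  choose C hC0 hC using h1
  refine ⟨∑ i ∈ t, C i * volume.real (extChartAt (𝓡 m) i ''
    (K ∩ tsupport (chartPartition (𝓡 m) N i))), fun g hg b hb hgb => ?_⟩
  rw [ht ν g hg, Finset.sum_mul]
  refine (Finset.abs_sum_le_sum_abs _ _).trans (Finset.sum_le_sum fun i _ => ?_)
  refine (abs_chartIntegral_le (C := C i * b) (hKi i)
    (inter_subset_right.trans (tsupport_chartPartition i)) (fun x hx => ?_) fun x hx => ?_).trans
    (le_of_eq (by ring))
  · by_cases hxK : x ∈ K
    · simp [image_eq_zero_of_notMem_tsupport fun h => hx ⟨hxK, h⟩]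
    · simp [image_eq_zero_of_notMem_tsupport fun h => hxK (hg h)]
  · rw [mul_right_comm, abs_mul]
    exact mul_le_mul (hC i x hx) (hgb x) (abs_nonneg _) (hC0 i)

/-- A density that does not vanish at `y` has non-zero integral against every non-negative function
that is positive at `y` and has small support. -/
lemma Density.exists_integral_ne_zero {V : Opens N} (ν : Density (𝓡 m) V) {y : N} (hy : y ∈ V)
    (hν : ν.1 y y ≠ 0) : ∃ V' : Opens N, y ∈ V' ∧ ∀ g : N → ℝ, IsCompactlySupportedIn V' g →
      (∀ x, 0 ≤ g x) → 0 < g y → ν.integral (𝓡 m) g ≠ 0 := by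
  set φ := extChartAt (𝓡 m) y with hφ
  have hφs : φ.source = chartDomain m y := extChartAt_source _ _
  have hcont := (ν.2.2.1 y).continuousOn
  have hopen : IsOpen ((V : Set N) ∩ (chartAt (EuclideanSpace ℝ (Fin m)) y).source) :=
    V.isOpen.inter (chartAt _ y).open_source
  have hV' : IsOpen (((V : Set N) ∩ (chartAt (EuclideanSpace ℝ (Fin m)) y).source) ∩
      (fun x => ν.1 y y * ν.1 y x) ⁻¹' Ioi 0) :=
    (continuousOn_const.mul hcont).isOpen_inter_preimage hopen isOpen_Ioi
  refine ⟨⟨_, hV'⟩, ⟨⟨hy, mem_chart_source _ y⟩, mul_self_pos.2 hν⟩, fun g hg hg0 hgy h0 => ?_⟩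
  have hg' : IsCompactlySupportedIn (V ⊓ chartDomain m y) g :=
    hg.mono (hg.tsupport_subset.trans inter_subset_left)
  rw [Density.integral_eq_chartIntegral ν hg'] at h0
  have h1 : chartIntegral m y (fun x => ν.1 y y * (g x * ν.1 y x)) = 0 := by
    rw [chartIntegral_const_mul, h0, mul_zero]
  have h2 : IsCompactlySupportedIn (chartDomain m y) (fun x => ν.1 y y * (g x * ν.1 y x)) :=
    (isCompactlySupportedIn_mul_density ν hg').continuous_mul_left continuous_const
  have h3 : ∀ x, 0 ≤ ν.1 y y * (g x * ν.1 y x) := fun x => by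
    by_cases hx : g x = 0
    · simp [hx]
    · have : x ∈ tsupport g := subset_tsupport g hx
      have h4 := (hg.tsupport_subset this).2
      rw [mul_left_comm]
      exact mul_nonneg (hg0 x) (le_of_lt h4)
  have h5 : 0 < chartIntegral m y (fun x => ν.1 y y * (g x * ν.1 y x)) := by
    unfold chartIntegral
    rw [setIntegral_pos_iff_support_of_nonneg_ae (Eventually.of_forall fun z => h3 _)
      h2.integrableOn]
    have hopen2 : IsOpen (φ.target ∩ (fun z => ν.1 y y * (g (φ.symm z) * ν.1 y (φ.symm z))) ⁻¹'
        {0}ᶜ) :=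
      (h2.continuous.comp_continuousOn (continuousOn_extChartAt_symm y)).isOpen_inter_preimage
        (isOpen_extChartAt_target y) isOpen_compl_singleton
    refine (hopen2.measure_pos volume ⟨φ y, mem_extChartAt_target y, ?_⟩).trans_le
      (measure_mono ?_)
    · have : φ.symm (φ y) = y := φ.left_inv (mem_extChartAt_source y)
      simp only [mem_preimage, this]
      exact mul_ne_zero hν (mul_ne_zero hgy.ne' hν)
    · exact fun z hz => ⟨hz.2, hz.1⟩
  exact h5.ne' h1

omit [T2Space N] [SigmaCompactSpace N] in
lemma Density.ext_diag {V : Opens N} {ν ν' : Density (𝓡 m) V} (h : ∀ y ∈ V, ν.1 y y = ν'.1 y y) :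
    ν = ν' := by
  refine Subtype.ext (funext fun i => funext fun x => ?_)
  by_cases hx : x ∈ (V : Set N) ∩ (chartAt (EuclideanSpace ℝ (Fin m)) i).source
  · rw [ν.2.2.2 i x x hx.1 hx.2 (mem_chart_source _ x), ν'.2.2.2 i x x hx.1 hx.2
      (mem_chart_source _ x), h x hx.1]
  · rw [ν.2.1 i x hx, ν'.2.1 i x hx]

omit [T2Space N] [SigmaCompactSpace N] in
lemma Density.res_apply {V V' : Opens N} (h : V' ≤ V) (ν : Density (𝓡 m) V) (i : N) {x : N}
    (hx : x ∈ V') : (Density.res (𝓡 m) h ν).1 i x = ν.1 i x :=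
  indicator_of_mem (show x ∈ (V' : Set N) from hx) _

lemma Density.integral_res {V V' : Opens N} (h : V' ≤ V) (ν : Density (𝓡 m) V) {g : N → ℝ}
    (hg : ∀ x ∉ V', g x = 0) :
    (Density.res (𝓡 m) h ν).integral (𝓡 m) g = ν.integral (𝓡 m) g := by
  refine Density.integral_congr _ _ fun i x => ?_
  by_cases hx : x ∈ V'
  · rw [Density.res_apply h ν i hx]
  · rw [hg x hx, zero_mul, zero_mul]

omit [T2Space N] [SigmaCompactSpace N] in
/-- The product of a smooth function and a density. -/
def Density.mulFn {V : Opens N} (a : SmoothFn (𝓡 m) V) (ν : Density (𝓡 m) V) : Density (𝓡 m) V :=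
  ⟨fun i x => extendZero a x * ν.1 i x, fun i x hx =>
    (congrArg (extendZero a x * ·) (ν.2.1 i x hx)).trans (mul_zero _),
    fun i => ((contMDiffOn_extendZero a).mono inter_subset_left).mul (ν.2.2.1 i),
    fun i j x hx hi hj => by
      beta_reduce
      refine (congrArg (extendZero a x * ·) (ν.2.2.2 i j x hx hi hj)).trans ?_
      ring⟩

lemma Density.integral_mulFn {V : Opens N} (a : SmoothFn (𝓡 m) V) (ν : Density (𝓡 m) V)
    (g : N → ℝ) : (ν.mulFn a).integral (𝓡 m) g =
      ν.integral (𝓡 m) (fun x => extendZero a x * g x) := by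
  refine Density.integral_congr _ _ fun i x => ?_
  change g x * (extendZero a x * ν.1 i x) = _
  ring

end Integration

/-! ### Formal adjoints of differential operators -/

section Adjoint

variable {m : ℕ} {N : Type*} [TopologicalSpace N] [ChartedSpace (EuclideanSpace ℝ (Fin m)) N]
  [IsManifold (𝓡 m) ∞ N]

lemma contDiff_det : ContDiff ℝ ∞
    (fun L : EuclideanSpace ℝ (Fin m) →L[ℝ] EuclideanSpace ℝ (Fin m) => L.det) := by
  have h1 : (fun L : EuclideanSpace ℝ (Fin m) →L[ℝ] EuclideanSpace ℝ (Fin m) => L.det) =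
      fun L => ∑ σ : Equiv.Perm (Fin m), ((Equiv.Perm.sign σ : ℤ) : ℝ) *
        ∏ i, L (EuclideanSpace.single i 1) (σ i) := by
    funext L
    rw [ContinuousLinearMap.det,
      ← LinearMap.det_toMatrix (EuclideanSpace.basisFun (Fin m) ℝ).toBasis, Matrix.det_apply']
    refine Finset.sum_congr rfl fun σ _ => congrArg _ (Finset.prod_congr rfl fun i _ => ?_)
    simp [LinearMap.toMatrix_apply]
  rw [h1]
  refine ContDiff.sum fun σ _ => contDiff_const.mul (contDiff_prod fun i _ => ?_)
  exact ((EuclideanSpace.proj (σ i) : EuclideanSpace ℝ (Fin m) →L[ℝ] ℝ).comp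
    (ContinuousLinearMap.apply ℝ (EuclideanSpace ℝ (Fin m))
      (EuclideanSpace.single i (1 : ℝ)))).contDiff

lemma det_tangentCoordChange_mul {i j k x : N} (hi : x ∈ chartDomain m i)
    (hj : x ∈ chartDomain m j) (hk : x ∈ chartDomain m k) :
    (tangentCoordChange (𝓡 m) i j x).det * (tangentCoordChange (𝓡 m) j k x).det =
      (tangentCoordChange (𝓡 m) i k x).det := by
  have h1 : (tangentCoordChange (𝓡 m) j k x).comp (tangentCoordChange (𝓡 m) i j x) =
      tangentCoordChange (𝓡 m) i k x := by
    ext1 v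
    refine tangentCoordChange_comp ⟨⟨?_, ?_⟩, ?_⟩ <;> rw [extChartAt_source]
    exacts [hi, hj, hk]
  rw [← h1, mul_comm]
  exact (LinearMap.det_comp (tangentCoordChange (𝓡 m) j k x).toLinearMap
    (tangentCoordChange (𝓡 m) i j x).toLinearMap).symm

lemma det_tangentCoordChange_self {i x : N} (hi : x ∈ chartDomain m i) :
    (tangentCoordChange (𝓡 m) i i x).det = 1 := by
  have h1 : tangentCoordChange (𝓡 m) i i x = ContinuousLinearMap.id ℝ _ := by
    ext1 v
    refine tangentCoordChange_self ?_
    rw [extChartAt_source]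
    exact hi
  rw [h1]
  exact LinearMap.det_id

lemma contMDiffOn_abs_det_tangentCoordChange (i j : N) :
    ContMDiffOn (𝓡 m) 𝓘(ℝ, ℝ) ∞ (fun x => |(tangentCoordChange (𝓡 m) i j x).det|)
      (chartDomain m i ∩ chartDomain m j) := by
  have h1 : ContMDiffOn (𝓡 m) 𝓘(ℝ, _) ∞ (tangentCoordChange (𝓡 m) i j)
      (chartDomain m i ∩ chartDomain m j) :=
    (tangentBundleCore.isContMDiff (n := ∞) (h := by simpa)).contMDiffOn_coordChange
      (achart (EuclideanSpace ℝ (Fin m)) i) (achart (EuclideanSpace ℝ (Fin m)) j)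
  intro x hx
  have h2 : (tangentCoordChange (𝓡 m) i j x).det ≠ 0 := fun h0 => by
    have := det_tangentCoordChange_mul hx.1 hx.2 hx.1
    rw [h0, zero_mul, det_tangentCoordChange_self hx.1] at this
    exact zero_ne_one this
  exact ((contDiffAt_abs h2).comp _ contDiff_det.contDiffAt).contMDiffAt.comp_contMDiffWithinAt x
    (h1 x hx)

/-- The density on a subset `V` of the domain of the chart at `j` with coefficient `a` in this
chart. -/
def Density.ofChart {V : Opens N} (j : N) (hV : V ≤ chartDomain m j) (a : SmoothFn (𝓡 m) V) :
    Density (𝓡 m) V :=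
  ⟨fun i => (((V : Set N) ∩ chartDomain m i)).indicator
      fun x => |(tangentCoordChange (𝓡 m) i j x).det| * extendZero a x,
    fun i x hx => indicator_of_notMem hx _,
    fun i => ContMDiffOn.congr
      (((contMDiffOn_abs_det_tangentCoordChange i j).mono fun x hx => ⟨hx.2, hV hx.1⟩).mul
        ((contMDiffOn_extendZero a).mono inter_subset_left))
      fun x hx => indicator_of_mem hx _,
    fun i k x hx hi hk => by
      beta_reduce
      rw [indicator_of_mem (show x ∈ (V : Set N) ∩ chartDomain m i from ⟨hx, hi⟩),
        indicator_of_mem (show x ∈ (V : Set N) ∩ chartDomain m k from ⟨hx, hk⟩),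
        ← det_tangentCoordChange_mul hi hk (hV hx), abs_mul, mul_assoc]⟩

lemma Density.ofChart_apply {V : Opens N} (j : N) (hV : V ≤ chartDomain m j)
    (a : SmoothFn (𝓡 m) V) {x : N} (hx : x ∈ V) :
    (Density.ofChart j hV a).1 j x = a ⟨x, hx⟩ := by
  refine (indicator_of_mem (show x ∈ (V : Set N) ∩ chartDomain m j from ⟨hx, hV hx⟩)
    fun x => |(tangentCoordChange (𝓡 m) j j x).det| * extendZero a x).trans ?_
  rw [det_tangentCoordChange_self (hV hx), abs_one, one_mul]
  exact extendZero_of_mem _ hx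

/-- The coordinates given by the chart at `j`. -/
def chartCoordinates (j : N) : Coordinates (𝓡 m) (chartDomain m j) m where
  toFun := extChartAt (𝓡 m) j
  inv := (extChartAt (𝓡 m) j).symm
  image := (extChartAt (𝓡 m) j).target
  contMDiffOn_toFun := contMDiffOn_extChartAt
  contMDiffOn_inv := contMDiffOn_extChartAt_symm j
  map_mem x hx := (extChartAt (𝓡 m) j).map_source (by rwa [extChartAt_source])
  inv_mem u hu := by
    have := (extChartAt (𝓡 m) j).map_target hu
    rwa [extChartAt_source] at this
  left_inv x hx := (extChartAt (𝓡 m) j).left_inv (by rwa [extChartAt_source])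
  right_inv u hu := (extChartAt (𝓡 m) j).right_inv hu
  uniqueDiffOn := (isOpen_extChartAt_target j).uniqueDiffOn
  subset_closure := by
    rw [(isOpen_extChartAt_target j).interior_eq]
    exact subset_closure

omit [IsManifold (𝓡 m) ∞ N] in
lemma TestFn.isCompactlySupportedIn {V : Opens N} (g : TestFn (𝓡 m) V) :
    IsCompactlySupportedIn V g.1 := ⟨g.1.contMDiff.continuous, g.2.1, g.2.2⟩

variable [T2Space N]

omit [T2Space N] in
/-- The integral of a partial derivative of a test function vanishes. -/
lemma chartIntegral_partialDeriv {V : Opens N} {j : N} (hV : V ≤ chartDomain m j) (i : Fin m)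
    (g : TestFn (𝓡 m) V) :
    chartIntegral m j (DiffOp.res (𝓡 m) hV ((chartCoordinates j).partialDeriv i) • g :
      TestFn (𝓡 m) V).1 = 0 := by
  classical
  set φ := extChartAt (𝓡 m) j with hφ
  have hφs : φ.source = chartDomain m j := extChartAt_source _ _
  have ho : IsOpen φ.target := isOpen_extChartAt_target j
  have hsub : tsupport g.1 ⊆ φ.source := fun x hx => hφs.symm.subset (hV (g.2.2 hx))
  -- `g` in the coordinates of the chart, extended by zero
  let G : EuclideanSpace ℝ (Fin m) → ℝ := φ.target.indicator (g.1 ∘ φ.symm)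
  have hK : IsCompact (φ '' tsupport g.1) :=
    g.2.1.isCompact.image_of_continuousOn ((continuousOn_extChartAt j).mono hsub)
  have hG0 : ∀ y ∉ φ '' tsupport g.1, G y = 0 := fun y hy => by
    by_cases hyt : y ∈ φ.target
    · refine (indicator_of_mem hyt _).trans ?_
      exact image_eq_zero_of_notMem_tsupport (f := g.1) fun h => hy ⟨_, h, φ.right_inv hyt⟩
    · exact indicator_of_notMem hyt _
  have hGt : tsupport G ⊆ φ '' tsupport g.1 := closure_minimal (fun y hy => by
    by_contra h
    exact hy (hG0 y h)) hK.isClosed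
  have hGc : HasCompactSupport G := hK.of_isClosed_subset (isClosed_tsupport _) hGt
  have hGe : ∀ y ∈ φ.target, G =ᶠ[𝓝 y] g.1 ∘ φ.symm := fun y hy => by
    filter_upwards [ho.mem_nhds hy] with z hz using indicator_of_mem hz _
  have hGs : ContDiff ℝ ∞ G := by
    refine contDiff_iff_contDiffAt.2 fun y => ?_
    by_cases hy : y ∈ tsupport G
    · have hyt : y ∈ φ.target := by
        obtain ⟨x, hx, rfl⟩ := hGt hy
        exact φ.map_source (hsub hx)
      refine ContDiffAt.congr_of_eventuallyEq ?_ (hGe y hyt)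
      have h1 : ContMDiffAt 𝓘(ℝ, EuclideanSpace ℝ (Fin m)) (𝓡 m) ∞ φ.symm y :=
        (contMDiffOn_extChartAt_symm j).contMDiffAt (ho.mem_nhds hyt)
      exact (g.1.contMDiff.contMDiffAt.comp y h1).contDiffAt
    · exact contDiffAt_const.congr_of_eventuallyEq (notMem_tsupport_iff_eventuallyEq.1 hy)
  have h1 : chartIntegral m j (DiffOp.res (𝓡 m) hV ((chartCoordinates j).partialDeriv i) • g :
      TestFn (𝓡 m) V).1 = ∫ y, fderiv ℝ G y (EuclideanSpace.single i 1) := by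
    rw [← setIntegral_eq_integral_of_forall_compl_eq_zero (s := φ.target)]
    · refine setIntegral_congr_fun ho.measurableSet fun y hy => ?_
      by_cases hyV : φ.symm y ∈ V
      · refine (TestFn.smul_apply _ g ⟨φ.symm y, hyV⟩).trans ?_
        refine ((chartCoordinates j).partialDeriv_apply hV i (TestFn.toSmoothFn (𝓡 m) g)
          ⟨φ.symm y, hyV⟩).trans ?_
        change fderivWithin ℝ _ φ.target (φ (φ.symm y)) _ = _
        rw [φ.right_inv hy, fderivWithin_of_mem_nhds (ho.mem_nhds hy)]
        refine congrArg (fun L : _ →L[ℝ] ℝ => L (EuclideanSpace.single i 1))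
          (EventuallyEq.fderiv_eq ?_)
        filter_upwards [ho.mem_nhds hy] with z hz
        refine Eq.trans ?_ (indicator_of_mem hz _).symm
        by_cases hzV : φ.symm z ∈ V
        · exact extendZero_of_mem _ hzV
        · refine (extendZero_of_notMem _ hzV).trans ?_
          exact (image_eq_zero_of_notMem_tsupport fun h => hzV (g.2.2 h)).symm
      · have h2 : G =ᶠ[𝓝 y] 0 := by
          refine notMem_tsupport_iff_eventuallyEq.1 fun h => hyV ?_
          obtain ⟨x, hx, rfl⟩ := hGt h
          rw [φ.left_inv (hsub hx)]
          exact g.2.2 hx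
        rw [h2.fderiv_eq]
        refine (image_eq_zero_of_notMem_tsupport (f := (DiffOp.res (𝓡 m) hV
          ((chartCoordinates j).partialDeriv i) • g : TestFn (𝓡 m) V).1) fun h =>
            hyV (Subtype.property (p := fun g => g ∈ testFnSubmodule (𝓡 m) V) _ |>.2 h)).trans ?_
        simp
    · intro y hy
      have h2 : G =ᶠ[𝓝 y] 0 := notMem_tsupport_iff_eventuallyEq.1 fun h => hy (by
        obtain ⟨x, hx, rfl⟩ := hGt h
        exact φ.map_source (hsub hx))
      rw [h2.fderiv_eq]
      simp
  rw [h1]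
  have h3 : Integrable (fun y => fderiv ℝ G y (EuclideanSpace.single i 1)) :=
    ((hGs.continuous_fderiv (by simp)).clm_apply continuous_const).integrable_of_hasCompactSupport
      (hGc.fderiv_apply ℝ _)
  have h4 := integral_mul_fderiv_eq_neg_fderiv_mul_of_integrable (μ := volume)
    (f := fun _ : EuclideanSpace ℝ (Fin m) => (1 : ℝ)) (g := G) (v := EuclideanSpace.single i 1)
    (by simp) (by simpa using h3)
    (by simpa using hGs.continuous.integrable_of_hasCompactSupport hGc)
    (fun x _ => differentiableAt_const _) (fun x _ => hGs.differentiable (by simp) x)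
  simpa using h4

variable [SigmaCompactSpace N]

/-- Densities are determined by their integrals against test functions. -/
lemma Density.ext_integral {V : Opens N} {ν ν' : Density (𝓡 m) V}
    (h : ∀ g : TestFn (𝓡 m) V, ν.integral (𝓡 m) g = ν'.integral (𝓡 m) g) : ν = ν' := by
  rw [← sub_eq_zero]
  refine Density.ext_diag fun y hy => ?_
  by_contra hne
  obtain ⟨V', hyV', h'⟩ := Density.exists_integral_ne_zero (ν - ν') hy hne
  obtain ⟨f, hf, hfc, hf1, hf01⟩ : ∃ f : C^∞⟮𝓡 m, N; 𝓘(ℝ, ℝ), ℝ⟯,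
      tsupport f ⊆ (V' ⊓ V : Opens N) ∧ HasCompactSupport f ∧ f y = 1 ∧ ∀ x, 0 ≤ f x := by
    obtain ⟨f, -, hf⟩ := (SmoothBumpFunction.nhds_basis_tsupport (I := 𝓡 m) y).mem_iff.1
      ((V' ⊓ V).isOpen.mem_nhds ⟨hyV', hy⟩)
    exact ⟨⟨f, f.contMDiff⟩, hf, f.hasCompactSupport, f.eq_one, fun x => f.nonneg⟩
  let g : TestFn (𝓡 m) V := ⟨f, hfc, hf.trans inf_le_right⟩
  refine h' f ⟨f.contMDiff.continuous, hfc, hf.trans inf_le_left⟩ hf01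
    (by rw [hf1]; exact one_pos) ?_
  have h1 := Density.add_integral (ν - ν') ν' g.isCompactlySupportedIn
  rw [sub_add_cancel] at h1
  have h2 := h g
  change Density.integral (𝓡 m) (ν - ν') g.1 = 0
  linarith

/-- `ν'` is the result of the formal adjoint of `Q` on `ν`. -/
def IsAdjoint {V : Opens N} (Q : DiffOp (𝓡 m) V) (ν ν' : Density (𝓡 m) V) : Prop :=
  ∀ g : TestFn (𝓡 m) V, ν'.integral (𝓡 m) g.1 = ν.integral (𝓡 m) (Q • g : TestFn (𝓡 m) V).1

namespace IsAdjoint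

variable {V : Opens N} {Q Q' : DiffOp (𝓡 m) V} {ν ν' ν'' : Density (𝓡 m) V}

lemma unique (h : IsAdjoint Q ν ν') (h' : IsAdjoint Q ν ν'') : ν' = ν'' :=
  Density.ext_integral fun g => (h g).trans (h' g).symm

lemma mul (h : IsAdjoint Q ν ν') (h' : IsAdjoint Q' ν' ν'') : IsAdjoint (Q * Q') ν ν'' := fun g => by
  rw [h' g, h, mul_smul]

lemma one : IsAdjoint (1 : DiffOp (𝓡 m) V) ν ν := fun g => by rw [one_smul]

lemma zero : IsAdjoint (0 : DiffOp (𝓡 m) V) ν 0 := fun g => by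
  rw [zero_smul]
  exact (Density.zero_integral _).trans (Density.integral_zero ν).symm

lemma add (h : IsAdjoint Q ν ν') (h' : IsAdjoint Q' ν ν'') : IsAdjoint (Q + Q') ν (ν' + ν'') :=
  fun g => by
    rw [Density.add_integral _ _ g.isCompactlySupportedIn, h g, h' g, add_smul]
    exact (Density.integral_add ν (TestFn.isCompactlySupportedIn _)
      (TestFn.isCompactlySupportedIn _)).symm

lemma add_density {ν₁ ν₁' : Density (𝓡 m) V} (h : IsAdjoint Q ν ν') (h' : IsAdjoint Q ν₁ ν₁') :
    IsAdjoint Q (ν + ν₁) (ν' + ν₁') := fun g => by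
  rw [Density.add_integral _ _ g.isCompactlySupportedIn, h g, h' g,
    Density.add_integral _ _ (TestFn.isCompactlySupportedIn _)]

lemma ofFn (a : SmoothFn (𝓡 m) V) : IsAdjoint (DiffOp.ofFn (𝓡 m) V a) ν (ν.mulFn a) := fun g => by
  rw [Density.integral_mulFn]
  refine Density.integral_congr _ _ fun i x => ?_
  by_cases hx : x ∈ V
  · refine congrArg (· * ν.1 i x) ?_
    rw [extendZero_of_mem _ hx]
    exact (TestFn.smul_apply (DiffOp.ofFn (𝓡 m) V a) g ⟨x, hx⟩).symm
  · have : ν.1 i x = 0 := ν.2.1 i x fun h => hx h.1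
    rw [this, mul_zero, mul_zero]

lemma neg (h : IsAdjoint Q ν ν') : IsAdjoint (-Q) ν (ν'.mulFn (-1)) := by
  have h1 : -Q = Q * DiffOp.ofFn (𝓡 m) V (-1) := by rw [map_neg, map_one, mul_neg_one]
  rw [h1]
  exact h.mul (ofFn (-1))

lemma res {V' : Opens N} (hV : V' ≤ V) (h : IsAdjoint Q ν ν') :
    IsAdjoint (DiffOp.res (𝓡 m) hV Q) (Density.res (𝓡 m) hV ν) (Density.res (𝓡 m) hV ν') :=
  fun g => by
    rw [Density.integral_res hV _ fun x hx => g.isCompactlySupportedIn.eq_zero hx,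
      Density.integral_res hV _ fun x hx => (TestFn.isCompactlySupportedIn _).eq_zero hx]
    refine (h (TestFn.incl (𝓡 m) hV g)).trans ?_
    rw [TestFn.smul_incl]
    rfl

/-- Integration by parts. -/
lemma partialDeriv {j : N} (hV : V ≤ chartDomain m j) (i : Fin m) :
    ∃ ν', IsAdjoint (DiffOp.res (𝓡 m) hV ((chartCoordinates j).partialDeriv i)) ν ν' := by
  let P := DiffOp.res (𝓡 m) hV ((chartCoordinates j).partialDeriv i)
  let a : SmoothFn (𝓡 m) V := SmoothFn.ofContMDiffOn (ν.1 j)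
    ((ν.2.2.1 j).mono fun x hx => ⟨hx, hV hx⟩)
  refine ⟨Density.ofChart j hV (-(P.apply (𝓡 m) a)), fun g => ?_⟩
  have hsupp : ∀ g : TestFn (𝓡 m) V, IsCompactlySupportedIn (V ⊓ chartDomain m j) g.1 := fun g =>
    g.isCompactlySupportedIn.mono (subset_inter g.2.2 (g.2.2.trans hV))
  rw [Density.integral_eq_chartIntegral _ (hsupp g), Density.integral_eq_chartIntegral _ (hsupp _)]
  have h1 := chartIntegral_partialDeriv hV i (DiffOp.ofFn (𝓡 m) V a • g)
  have h2 : P * DiffOp.ofFn (𝓡 m) V a =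
      DiffOp.ofFn (𝓡 m) V a * P + DiffOp.ofFn (𝓡 m) V (P.apply (𝓡 m) a) :=
    IsVectorFieldOp.mul_ofFn (DiffOp.isVectorFieldOp_ofVectorField
      ((chartCoordinates j).field i) (((chartCoordinates j).contMDiffOn_field i).mono hV)) a
  rw [← mul_smul, h2, add_smul] at h1
  have h3 := chartIntegral_add (i := j) (m := m)
    (((hsupp ((DiffOp.ofFn (𝓡 m) V a * P) • g))).mono
      ((hsupp ((DiffOp.ofFn (𝓡 m) V a * P) • g)).tsupport_subset.trans inter_subset_right))
    (((hsupp (DiffOp.ofFn (𝓡 m) V (P.apply (𝓡 m) a) • g))).mono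
      ((hsupp (DiffOp.ofFn (𝓡 m) V (P.apply (𝓡 m) a) • g)).tsupport_subset.trans
        inter_subset_right))
  have h4 : chartIntegral m j ((DiffOp.ofFn (𝓡 m) V a * P) • g : TestFn (𝓡 m) V).1 =
      chartIntegral m j (fun x => (P • g : TestFn (𝓡 m) V).1 x * ν.1 j x) := by
    refine chartIntegral_congr fun x _ => ?_
    rw [mul_smul]
    by_cases hx : x ∈ V
    · exact (TestFn.smul_apply (DiffOp.ofFn (𝓡 m) V a) (P • g) ⟨x, hx⟩).trans (mul_comm _ _)
    · rw [(TestFn.isCompactlySupportedIn _).eq_zero hx,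
        (TestFn.isCompactlySupportedIn _).eq_zero hx, zero_mul]
  have h5 : chartIntegral m j (DiffOp.ofFn (𝓡 m) V (P.apply (𝓡 m) a) • g : TestFn (𝓡 m) V).1 =
      -1 * chartIntegral m j
        (fun x => g.1 x * (Density.ofChart j hV (-(P.apply (𝓡 m) a))).1 j x) := by
    rw [← chartIntegral_const_mul]
    refine chartIntegral_congr fun x _ => ?_
    by_cases hx : x ∈ V
    · refine (TestFn.smul_apply (DiffOp.ofFn (𝓡 m) V (P.apply (𝓡 m) a)) g ⟨x, hx⟩).trans ?_
      rw [Density.ofChart_apply j hV _ hx]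
      change P.apply (𝓡 m) a ⟨x, hx⟩ * g.1 x = -1 * (g.1 x * -(P.apply (𝓡 m) a ⟨x, hx⟩))
      ring
    · rw [(TestFn.isCompactlySupportedIn _).eq_zero hx, g.isCompactlySupportedIn.eq_zero hx,
        zero_mul, mul_zero]
  have h6 := h3.symm.trans h1
  rw [h4, h5] at h6
  linarith

end IsAdjoint

omit [T2Space N] [SigmaCompactSpace N] in
/-- Compatible densities on the members of an open cover come from a global one. -/
lemma Density.exists_glue {V : Opens N} {α : Type*} (W : α → Opens N) (hW : ∀ a, W a ≤ V)
    (hcov : (V : Set N) ⊆ ⋃ a, (W a : Set N)) (ν : ∀ a, Density (𝓡 m) (W a))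
    (hν : ∀ a b, Density.res (𝓡 m) (inf_le_left : W a ⊓ W b ≤ W a) (ν a) =
      Density.res (𝓡 m) (inf_le_right : W a ⊓ W b ≤ W b) (ν b)) :
    ∃ ν' : Density (𝓡 m) V, ∀ a, Density.res (𝓡 m) (hW a) ν' = ν a := by
  classical
  have h1 : ∀ x : V, ∃ a, (x : N) ∈ W a := fun x => mem_iUnion.1 (hcov x.2)
  choose r hr using h1
  let ρ : N → N → ℝ := fun i x => if h : x ∈ V then (ν (r ⟨x, h⟩)).1 i x else 0
  have h2 : ∀ a, ∀ x ∈ W a, ∀ i, ρ i x = (ν a).1 i x := fun a x hx i => by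
    have hxV : x ∈ V := hW a hx
    have h3 := congrArg (fun ν : Density (𝓡 m) (W (r ⟨x, hxV⟩) ⊓ W a) => ν.1 i x)
      (hν (r ⟨x, hxV⟩) a)
    have h4 : x ∈ W (r ⟨x, hxV⟩) ⊓ W a := ⟨hr ⟨x, hxV⟩, hx⟩
    refine (dif_pos hxV).trans ?_
    exact ((Density.res_apply inf_le_left _ i h4).symm.trans h3).trans
      (Density.res_apply inf_le_right _ i h4)
  refine ⟨⟨ρ, fun i x hx => ?_, fun i x hx => ?_, fun i j x hx hi hj => ?_⟩, fun a => ?_⟩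
  · by_cases hxV : x ∈ V
    · exact (h2 _ x (hr ⟨x, hxV⟩) i).trans ((ν _).2.1 i x fun h => hx ⟨hxV, h.2⟩)
    · exact dif_neg hxV
  · have ho : ((W (r ⟨x, hx.1⟩) ⊓ chartDomain m i : Opens N) : Set N) ∈ 𝓝 x :=
      (W (r ⟨x, hx.1⟩) ⊓ chartDomain m i).isOpen.mem_nhds ⟨hr ⟨x, hx.1⟩, hx.2⟩
    refine ContMDiffAt.contMDiffWithinAt (ContMDiffAt.congr_of_eventuallyEq
      (((ν (r ⟨x, hx.1⟩)).2.2.1 i).contMDiffAt ho) ?_)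
    filter_upwards [ho] with y hy using h2 _ y hy.1 i
  · rw [h2 _ x (hr ⟨x, hx⟩) i, h2 _ x (hr ⟨x, hx⟩) j]
    exact (ν _).2.2.2 i j x (hr ⟨x, hx⟩) hi hj
  · refine Density.ext_diag fun y hy => ?_
    exact (Density.res_apply (hW a) _ y hy).trans (h2 a y hy y)

/-- Formal adjoints exist: functions and coordinate fields, which generate the operators on small open
sets, have adjoints there, and by uniqueness the local adjoints glue. -/
lemma exists_isAdjoint {V : Opens N} (Q : DiffOp (𝓡 m) V) (ν : Density (𝓡 m) V) :
    ∃ ν', IsAdjoint Q ν ν' := by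
  have h1 : ∀ x : V, ∃ (W : Opens N) (hW : W ≤ V), (x : N) ∈ W ∧
      ∃ ν', IsAdjoint (DiffOp.res (𝓡 m) hW Q) (Density.res (𝓡 m) hW ν) ν' := fun x => by
    obtain ⟨W, hWV, hWj, hxW, hQ⟩ := (chartCoordinates (x : N)).exists_res_mem_closure Q x.2
      (mem_chartDomain (x : N))
    refine ⟨W, hWV, hxW, ?_⟩
    have h2 : ∀ ν : Density (𝓡 m) W, ∃ ν', IsAdjoint (DiffOp.res (𝓡 m) hWV Q) ν ν' := by
      generalize DiffOp.res (𝓡 m) hWV Q = Q' at hQ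
      induction hQ using Subring.closure_induction with
      | mem P hP =>
        intro ν
        rcases hP with ⟨a, rfl⟩ | ⟨i, rfl⟩
        · exact ⟨_, IsAdjoint.ofFn a⟩
        · exact IsAdjoint.partialDeriv hWj i
      | zero => exact fun ν => ⟨0, IsAdjoint.zero⟩
      | one => exact fun ν => ⟨ν, IsAdjoint.one⟩
      | add P P' _ _ h h' =>
        intro ν
        obtain ⟨ν₁, h₁⟩ := h ν
        obtain ⟨ν₂, h₂⟩ := h' ν
        exact ⟨_, h₁.add h₂⟩
      | mul P P' _ _ h h' =>
        intro ν
        obtain ⟨ν₁, h₁⟩ := h ν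
        obtain ⟨ν₂, h₂⟩ := h' ν₁
        exact ⟨_, h₁.mul h₂⟩
      | neg P _ h =>
        intro ν
        obtain ⟨ν₁, h₁⟩ := h ν
        exact ⟨_, h₁.neg⟩
    exact h2 _
  choose W hWV hxW ν' hν' using h1
  have hres : ∀ {W₁ W₂ : Opens N} (h₂ : W₂ ≤ W₁) (h₁ : W₁ ≤ V),
      DiffOp.res (𝓡 m) h₂ (DiffOp.res (𝓡 m) h₁ Q) = DiffOp.res (𝓡 m) (h₂.trans h₁) Q :=
    fun _ _ => rfl
  have hres' : ∀ {W₁ W₂ : Opens N} (h₂ : W₂ ≤ W₁) (h₁ : W₁ ≤ V),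
      Density.res (𝓡 m) h₂ (Density.res (𝓡 m) h₁ ν) = Density.res (𝓡 m) (h₂.trans h₁) ν :=
    fun h₂ h₁ => Density.ext_diag fun y hy => by
      rw [Density.res_apply h₂ _ y hy, Density.res_apply h₁ _ y (h₂ hy),
        Density.res_apply (h₂.trans h₁) _ y hy]
  obtain ⟨ν'', hν''⟩ := Density.exists_glue W hWV (fun x hx => mem_iUnion.2 ⟨⟨x, hx⟩, hxW ⟨x, hx⟩⟩)
    ν' fun a b => by
      have h3 := (hν' a).res (inf_le_left : W a ⊓ W b ≤ W a)
      have h4 := (hν' b).res (inf_le_right : W a ⊓ W b ≤ W b)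
      rw [hres, hres'] at h3 h4
      exact h3.unique h4
  refine ⟨ν'', fun g => ?_⟩
  -- both sides are additive in `g`, hence it suffices to treat `g` with small support
  refine TestFn.functional_ext (fun g => ν''.integral (𝓡 m) g.1)
    (fun g => ν.integral (𝓡 m) (Q • g : TestFn (𝓡 m) V).1) (Density.integral_zero ν'') ?_
    (fun g g' => Density.integral_add ν'' g.isCompactlySupportedIn g'.isCompactlySupportedIn)
    (fun g g' => ?_) (fun x hx => ⟨W ⟨x, hx⟩, hxW _, fun g hg => ?_⟩) g
  · beta_reduce
    rw [smul_zero]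
    exact Density.integral_zero ν
  · beta_reduce
    rw [smul_add]
    exact Density.integral_add ν (TestFn.isCompactlySupportedIn _)
      (TestFn.isCompactlySupportedIn _)
  · let g' : TestFn (𝓡 m) (W ⟨x, hx⟩) := ⟨g.1, g.2.1, hg⟩
    have h5 := hν' ⟨x, hx⟩ g'
    rw [← hν'' ⟨x, hx⟩, Density.integral_res _ _ fun x hx => g'.isCompactlySupportedIn.eq_zero hx,
      Density.integral_res _ _ fun x hx => (TestFn.isCompactlySupportedIn _).eq_zero hx] at h5
    refine h5.trans ?_
    exact congrArg (fun g : TestFn (𝓡 m) V => ν.integral (𝓡 m) g.1)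
      (TestFn.smul_incl (𝓡 m) (hWV ⟨x, hx⟩) Q g').symm

/-- The right action of differential operators on densities by formal adjoints. -/
def Density.adjoint {V : Opens N} (Q : DiffOp (𝓡 m) V) (ν : Density (𝓡 m) V) : Density (𝓡 m) V :=
  (exists_isAdjoint Q ν).choose

lemma Density.isAdjoint_adjoint {V : Opens N} (Q : DiffOp (𝓡 m) V) (ν : Density (𝓡 m) V) :
    IsAdjoint Q ν (Density.adjoint Q ν) := (exists_isAdjoint Q ν).choose_spec

/-! #### The right module of germs of densities -/

/-- The right action of a germ of a differential operator on a germ of a density. -/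
def DensityStalk.adjoint {x : N} (D : DiffOpStalk (𝓡 m) x) (φ : DensityStalk (𝓡 m) x) :
    DensityStalk (𝓡 m) x :=
  DirectLimit.map₂ (ι := (OpenNhdsOf x)ᵒᵈ)
    (F₁ := fun U => DiffOp (𝓡 m) (OrderDual.ofDual U).1)
    (F₂ := fun U => Density (𝓡 m) (OrderDual.ofDual U).1)
    (F := fun U => Density (𝓡 m) (OrderDual.ofDual U).1)
    (fun _ _ h => DiffOp.res (𝓡 m) h) (fun _ _ h => Density.res (𝓡 m) h)
    (fun _ _ h => Density.res (𝓡 m) h) (fun _ P ν => Density.adjoint P ν)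
    (fun _ _ h P ν => ((Density.isAdjoint_adjoint P ν).res h).unique
      (Density.isAdjoint_adjoint _ _)) D φ

lemma DensityStalk.adjoint_germ' {x : N} {U : Opens N} (hx : x ∈ U) (P : DiffOp (𝓡 m) U)
    (ν : Density (𝓡 m) U) :
    DensityStalk.adjoint (DiffOpStalk.germ (𝓡 m) x hx P) (DensityStalk.germ (𝓡 m) x hx ν) =
      DensityStalk.germ (𝓡 m) x hx (Density.adjoint P ν) :=
  DirectLimit.map₂_def (ι := (OpenNhdsOf x)ᵒᵈ)
    (F₁ := fun U => DiffOp (𝓡 m) (OrderDual.ofDual U).1)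
    (F₂ := fun U => Density (𝓡 m) (OrderDual.ofDual U).1)
    (F := fun U => Density (𝓡 m) (OrderDual.ofDual U).1)
    (fun _ _ h => DiffOp.res (𝓡 m) h) (fun _ _ h => Density.res (𝓡 m) h)
    (fun _ _ h => Density.res (𝓡 m) h) (fun _ P ν => Density.adjoint P ν)
    (fun _ _ h P ν => ((Density.isAdjoint_adjoint P ν).res h).unique
      (Density.isAdjoint_adjoint _ _)) (OrderDual.toDual ⟨U, hx⟩) P ν

lemma DensityStalk.adjoint_germ {x : N} {U : Opens N} (hx : x ∈ U) {P : DiffOp (𝓡 m) U}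
    {ν ν' : Density (𝓡 m) U} (h : IsAdjoint P ν ν') :
    DensityStalk.adjoint (DiffOpStalk.germ (𝓡 m) x hx P) (DensityStalk.germ (𝓡 m) x hx ν) =
      DensityStalk.germ (𝓡 m) x hx ν' := by
  rw [adjoint_germ', (Density.isAdjoint_adjoint P ν).unique h]

omit [T2Space N] [SigmaCompactSpace N] in
lemma DensityStalk.exists_germ_diffOpGerm {x : N} (D : DiffOpStalk (𝓡 m) x)
    (φ : DensityStalk (𝓡 m) x) : ∃ (U : Opens N) (hx : x ∈ U) (P : DiffOp (𝓡 m) U)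
      (ν : Density (𝓡 m) U), DiffOpStalk.germ (𝓡 m) x hx P = D ∧
        DensityStalk.germ (𝓡 m) x hx ν = φ := by
  obtain ⟨U, hU, P, -, rfl⟩ := D.exists_germ_le (V := ⊤) trivial
  obtain ⟨V, hV, ν, hVU, rfl⟩ := φ.exists_germ_le hU
  exact ⟨V, hV, DiffOp.res (𝓡 m) hVU P, ν, DiffOpStalk.germ_res (𝓡 m) hVU x hV P, rfl⟩

lemma DensityStalk.adjoint_add {x : N} (D : DiffOpStalk (𝓡 m) x) (φ ψ : DensityStalk (𝓡 m) x) :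
    adjoint D (φ + ψ) = adjoint D φ + adjoint D ψ := by
  obtain ⟨U, hU, P, f, rfl, rfl⟩ := exists_germ_diffOpGerm D φ
  obtain ⟨V, hV, g, hVU, rfl⟩ := ψ.exists_germ_le hU
  rw [← DiffOpStalk.germ_res (𝓡 m) hVU x hV, ← DensityStalk.germ_res (𝓡 m) hVU x hV,
    ← germ_add, adjoint_germ', adjoint_germ', adjoint_germ', ← germ_add]
  exact congrArg _ ((Density.isAdjoint_adjoint _ _).unique
    ((Density.isAdjoint_adjoint _ _).add_density (Density.isAdjoint_adjoint _ _)))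

lemma DensityStalk.add_adjoint {x : N} (D D' : DiffOpStalk (𝓡 m) x) (φ : DensityStalk (𝓡 m) x) :
    adjoint (D + D') φ = adjoint D φ + adjoint D' φ := by
  obtain ⟨U, hU, P, f, rfl, rfl⟩ := exists_germ_diffOpGerm D φ
  obtain ⟨V, hV, Q, hVU, rfl⟩ := D'.exists_germ_le hU
  rw [← DiffOpStalk.germ_res (𝓡 m) hVU x hV, ← DensityStalk.germ_res (𝓡 m) hVU x hV,
    ← map_add, adjoint_germ', adjoint_germ', adjoint_germ', ← germ_add]
  exact congrArg _ ((Density.isAdjoint_adjoint _ _).unique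
    ((Density.isAdjoint_adjoint _ _).add (Density.isAdjoint_adjoint _ _)))

lemma DensityStalk.mul_adjoint {x : N} (D D' : DiffOpStalk (𝓡 m) x) (φ : DensityStalk (𝓡 m) x) :
    adjoint (D * D') φ = adjoint D' (adjoint D φ) := by
  obtain ⟨U, hU, P, f, rfl, rfl⟩ := exists_germ_diffOpGerm D φ
  obtain ⟨V, hV, Q, hVU, rfl⟩ := D'.exists_germ_le hU
  rw [← DiffOpStalk.germ_res (𝓡 m) hVU x hV, ← DensityStalk.germ_res (𝓡 m) hVU x hV,
    ← map_mul, adjoint_germ', adjoint_germ', adjoint_germ']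
  exact congrArg _ ((Density.isAdjoint_adjoint _ _).unique
    ((Density.isAdjoint_adjoint _ _).mul (Density.isAdjoint_adjoint _ _)))

/-- The right module structure on germs of densities by formal adjoints. -/
@[reducible]
def densityStalkModule (x : N) : Module (DiffOpStalk (𝓡 m) x)ᵐᵒᵖ (DensityStalk (𝓡 m) x) where
  smul D φ := DensityStalk.adjoint (unop D) φ
  one_smul φ := by
    obtain ⟨U, hU, f, -, rfl⟩ := φ.exists_germ_le (V := ⊤) trivial
    change DensityStalk.adjoint (1 : DiffOpStalk (𝓡 m) x) _ = _
    rw [← map_one (DiffOpStalk.germ (𝓡 m) x hU)]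
    exact DensityStalk.adjoint_germ hU IsAdjoint.one
  mul_smul D D' φ := DensityStalk.mul_adjoint (unop D') (unop D) φ
  smul_zero D := by
    have h := DensityStalk.adjoint_add (unop D) (0 : DensityStalk (𝓡 m) x) 0
    rw [add_zero] at h
    exact left_eq_add.1 h
  smul_add D φ ψ := DensityStalk.adjoint_add (unop D) φ ψ
  add_smul D D' φ := DensityStalk.add_adjoint (unop D) (unop D') φ
  zero_smul φ := by
    have h := DensityStalk.add_adjoint (0 : DiffOpStalk (𝓡 m) x) 0 φ
    rw [add_zero] at h
    exact left_eq_add.1 h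

end Adjoint

/-! ### Coordinates adapted to the boundary -/

section ChartCoordinates

lemma subset_closure_interior_inter {X : Type*} [TopologicalSpace X] {A O : Set X}
    (hA : A ⊆ closure (interior A)) (hO : IsOpen O) : A ∩ O ⊆ closure (interior (A ∩ O)) := by
  rw [interior_inter, hO.interior_eq, inter_comm, inter_comm _ O]
  exact (inter_subset_inter_right _ hA).trans hO.inter_closure

variable {n : ℕ} {H : Type*} [TopologicalSpace H]
  {I : ModelWithCorners ℝ (EuclideanSpace ℝ (Fin n)) H}
  {M : Type*} [TopologicalSpace M] [ChartedSpace H M] [IsManifold I ∞ M]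

/-- The coordinates given by a chart. -/
def Coordinates.ofChart (e : OpenPartialHomeomorph M H)
    (he : e ∈ IsManifold.maximalAtlas I ∞ M) {U : Opens M} (hU : (U : Set M) ⊆ e.source) :
    Coordinates I U n where
  toFun := e.extend I
  inv := (e.extend I).symm
  image := range I ∩ I.symm ⁻¹' (e.target ∩ e.symm ⁻¹' U)
  contMDiffOn_toFun := (e.contMDiffOn_extend he).mono hU
  contMDiffOn_inv := by
    refine (contMDiffOn_extend_symm he).mono ?_
    rintro _ ⟨⟨y, rfl⟩, hy⟩
    exact mem_image_of_mem I (by simpa using hy.1)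
  map_mem x hx := ⟨mem_range_self _, by simpa [e.map_source (hU hx), e.left_inv (hU hx)] using hx⟩
  inv_mem u hu := hu.2.2
  left_inv x hx := e.extend_left_inv (hU hx)
  right_inv := by
    rintro _ ⟨⟨y, rfl⟩, hy⟩
    have : y ∈ e.target := by simpa using hy.1
    simp [e.right_inv this]
  uniqueDiffOn := I.uniqueDiffOn.inter
    ((e.isOpen_inter_preimage_symm U.isOpen).preimage I.continuous_symm)
  subset_closure := subset_closure_interior_inter I.range_subset_closure_interior
    ((e.isOpen_inter_preimage_symm U.isOpen).preimage I.continuous_symm)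

end ChartCoordinates

section

variable {E : Type*} [NormedAddCommGroup E] [NormedSpace ℝ E]
  {H : Type*} [TopologicalSpace H] {I : ModelWithCorners ℝ E H}
  {M : Type*} [TopologicalSpace M] [ChartedSpace H M]

/-- The composition of coordinates with a linear automorphism. -/
def Coordinates.compEquiv {W : Opens M} {n : ℕ} (c : Coordinates I W n)
    (L : EuclideanSpace ℝ (Fin n) ≃L[ℝ] EuclideanSpace ℝ (Fin n)) : Coordinates I W n where
  toFun := L ∘ c.toFun
  inv := c.inv ∘ L.symm
  image := L.symm ⁻¹' c.image
  contMDiffOn_toFun := L.contDiff.contMDiff.comp_contMDiffOn c.contMDiffOn_toFun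
  contMDiffOn_inv := c.contMDiffOn_inv.comp L.symm.contDiff.contMDiff.contMDiffOn subset_rfl
  map_mem x hx := by simpa using c.map_mem x hx
  inv_mem u hu := c.inv_mem _ hu
  left_inv x hx := by simpa using c.left_inv x hx
  right_inv u hu := by simp [c.right_inv _ hu]
  uniqueDiffOn := L.symm.uniqueDiffOn_preimage_iff.2 c.uniqueDiffOn
  subset_closure := by
    have h1 := preimage_mono (f := L.symm.toHomeomorph) c.subset_closure
    rwa [L.symm.toHomeomorph.preimage_closure, L.symm.toHomeomorph.preimage_interior] at h1

variable [IsManifold I ∞ M]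

omit [IsManifold I ∞ M] in
/-- A point with coordinates in the interior of the image is an interior point of the manifold. -/
lemma Coordinates.isInteriorPoint {W : Opens M} {n : ℕ} (c : Coordinates I W n) {x : M}
    (hx : x ∈ W) (hu : c.toFun x ∈ interior c.image) : I.IsInteriorPoint x := by
  have hd : MDifferentiableAt 𝓘(ℝ, EuclideanSpace ℝ (Fin n)) I c.inv (c.toFun x) :=
    (c.contMDiffOn_inv.contMDiffAt (mem_interior_iff_mem_nhds.1 hu)).mdifferentiableAt (by simp)
  have h1 : (mfderiv 𝓘(ℝ, EuclideanSpace ℝ (Fin n)) I c.inv (c.toFun x)).comp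
      (mfderiv I 𝓘(ℝ, EuclideanSpace ℝ (Fin n)) c.toFun x) = ContinuousLinearMap.id ℝ _ := by
    rw [← mfderiv_comp x hd (c.mdifferentiableAt_toFun hx), ← mfderiv_id]
    refine Filter.EventuallyEq.mfderiv_eq ?_
    filter_upwards [W.isOpen.mem_nhds hx] with y hy using c.left_inv y hy
  have h2 := hd.isInteriorPoint_of_surjective_mfderiv (fun v => ⟨_, DFunLike.congr_fun h1 v⟩)
    BoundarylessManifold.isInteriorPoint
  rwa [c.left_inv x hx] at h2

end

section BoundaryCoordinates

variable (m : ℕ)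

/-- The first coordinate and the remaining coordinates of a point of `ℝ^(m+1)`. -/
def splitEquiv : EuclideanSpace ℝ (Fin (m + 1)) ≃L[ℝ] ℝ × EuclideanSpace ℝ (Fin m) :=
  LinearEquiv.toContinuousLinearEquiv
    { toFun := fun y => (y 0, WithLp.toLp 2 fun i => y i.succ)
      map_add' := fun _ _ => rfl
      map_smul' := fun _ _ => rfl
      invFun := fun p => WithLp.toLp 2 (Fin.cons p.1 p.2)
      left_inv := fun y => by
        ext i
        refine Fin.cases ?_ (fun j => ?_) i <;> rfl
      right_inv := fun _ => rfl }

variable {m}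

lemma splitEquiv_symm_zero (p : ℝ × EuclideanSpace ℝ (Fin m)) : (splitEquiv m).symm p 0 = p.1 := rfl

lemma splitEquiv_symm_succ (p : ℝ × EuclideanSpace ℝ (Fin m)) (i : Fin m) :
    (splitEquiv m).symm p i.succ = p.2 i := rfl

lemma splitEquiv_symm_single_zero :
    (splitEquiv m).symm (1, 0) = EuclideanSpace.single 0 (1 : ℝ) := by
  ext i
  refine Fin.cases ?_ (fun j => ?_) i
  · simp [splitEquiv_symm_zero]
  · simp [splitEquiv_symm_succ]

lemma splitEquiv_symm_single_succ (i : Fin m) :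
    (splitEquiv m).symm (0, EuclideanSpace.single i 1) = EuclideanSpace.single i.succ (1 : ℝ) := by
  ext k
  refine Fin.cases ?_ (fun j => ?_) k
  · simp [splitEquiv_symm_zero, Fin.succ_ne_zero]
  · simp [splitEquiv_symm_succ]

variable {M : Type*} [TopologicalSpace M] [ChartedSpace (EuclideanHalfSpace (m + 1)) M]
  {N : Type*} [TopologicalSpace N] [ChartedSpace (EuclideanSpace ℝ (Fin m)) N]

/-- Coordinates on an open subset `U` of `M` and on its intersection with the boundary, such that
the inclusion of the boundary is given by `u ↦ (0, u)`. -/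
structure BoundaryCoordinates (ι : C^∞⟮𝓡 m, N; 𝓡∂ (m + 1), M⟯) (U : Opens M) where
  ambient : Coordinates (𝓡∂ (m + 1)) U (m + 1)
  boundary : Coordinates (𝓡 m) (preim ι U) m
  toFun_comp : ∀ z ∈ preim ι U, ambient.toFun (ι z) = (splitEquiv m).symm (0, boundary.toFun z)

variable [IsManifold (𝓡∂ (m + 1)) ∞ M] [IsManifold (𝓡 m) ∞ N] {ι : C^∞⟮𝓡 m, N; 𝓡∂ (m + 1), M⟯}

namespace BoundaryCoordinates

variable {U : Opens M} (b : BoundaryCoordinates ι U)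

/-- The normal derivative. -/
def normal : DiffOp (𝓡∂ (m + 1)) U := b.ambient.partialDeriv 0

/-- The coordinate function that vanishes on the boundary. -/
def normalCoord : SmoothFn (𝓡∂ (m + 1)) U := b.ambient.coord 0

omit [IsManifold (𝓡∂ (m + 1)) ∞ M] [IsManifold (𝓡 m) ∞ N] in
lemma pullFn_normalCoord : pullFn ι U b.normalCoord = 0 := by
  refine DFunLike.ext _ _ fun z => ?_
  change b.ambient.toFun (ι z) 0 = 0
  rw [b.toFun_comp z z.2]
  rfl

omit [IsManifold (𝓡∂ (m + 1)) ∞ M] [IsManifold (𝓡 m) ∞ N] in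
lemma inv_comp {u : EuclideanSpace ℝ (Fin m)} (hu : u ∈ b.boundary.image) :
    b.ambient.inv ((splitEquiv m).symm (0, u)) = ι (b.boundary.inv u) := by
  have h1 := b.toFun_comp _ (b.boundary.inv_mem u hu)
  rw [b.boundary.right_inv u hu] at h1
  rw [← h1]
  exact b.ambient.left_inv _ (b.boundary.inv_mem u hu)

/-- Tangential derivatives commute with the restriction to the boundary. -/
lemma pullFn_partialDeriv {W : Opens M} (hW : W ≤ U) (hW' : preim ι W ≤ preim ι U) (i : Fin m)
    (f : SmoothFn (𝓡∂ (m + 1)) W) :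
    (DiffOp.res (𝓡 m) hW' (b.boundary.partialDeriv i)).apply (𝓡 m) (pullFn ι W f) =
      pullFn ι W ((DiffOp.res (𝓡∂ (m + 1)) hW (b.ambient.partialDeriv i.succ)).apply _ f) := by
  refine DFunLike.ext _ _ fun z => ?_
  have hz : (z : N) ∈ preim ι U := hW' z.2
  refine (b.boundary.partialDeriv_apply hW' i (pullFn ι W f) z).trans ?_
  refine Eq.trans ?_ (b.ambient.partialDeriv_apply hW i.succ f ⟨ι z, z.2⟩).symm
  let L : EuclideanSpace ℝ (Fin m) →L[ℝ] EuclideanSpace ℝ (Fin (m + 1)) :=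
    ((splitEquiv m).symm : _ →L[ℝ] _).comp (ContinuousLinearMap.inr ℝ ℝ _)
  have hL : ∀ u ∈ b.boundary.image, L u ∈ b.ambient.image := fun u hu => by
    have h1 := b.ambient.map_mem _ (b.boundary.inv_mem u hu)
    rwa [b.toFun_comp _ (b.boundary.inv_mem u hu), b.boundary.right_inv u hu] at h1
  have h2 : ∀ u ∈ b.boundary.image, (extendZero (pullFn ι W f) ∘ b.boundary.inv) u =
      ((extendZero f ∘ b.ambient.inv) ∘ L) u := fun u hu => by
    have h3 : b.ambient.inv (L u) = ι (b.boundary.inv u) := b.inv_comp hu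
    simp only [Function.comp_apply, h3]
    by_cases h4 : b.boundary.inv u ∈ preim ι W
    · rw [extendZero_of_mem _ h4, extendZero_of_mem _ (show ι (b.boundary.inv u) ∈ W from h4)]
      rfl
    · rw [extendZero_of_notMem _ h4, extendZero_of_notMem _ (show ι (b.boundary.inv u) ∉ W from h4)]
  have hu := b.boundary.map_mem z hz
  have hp : b.ambient.toFun (ι z) = L (b.boundary.toFun z) := b.toFun_comp z hz
  have hd : DifferentiableWithinAt ℝ (extendZero f ∘ b.ambient.inv) b.ambient.image
      (L (b.boundary.toFun z)) := by
    rw [← hp]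
    exact (b.ambient.contDiffWithinAt_comp_inv f hz z.2).differentiableWithinAt (by simp)
  rw [fderivWithin_congr h2 (h2 _ hu), fderivWithin_comp _ hd
    L.differentiableAt.differentiableWithinAt hL (b.boundary.uniqueDiffOn _ hu),
    L.fderivWithin (b.boundary.uniqueDiffOn _ hu), ← hp]
  exact congrArg _ (splitEquiv_symm_single_succ i)

end BoundaryCoordinates

omit [IsManifold (𝓡∂ (m + 1)) ∞ M] in
lemma Coordinates.ofChart_zero_eq_zero (e : OpenPartialHomeomorph M (EuclideanHalfSpace (m + 1)))
    (he : e ∈ IsManifold.maximalAtlas (𝓡∂ (m + 1)) ∞ M) {x : M} (hx : x ∈ e.source)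
    (hb : x ∈ (𝓡∂ (m + 1)).boundary M) : e.extend (𝓡∂ (m + 1)) x 0 = 0 := by
  by_contra h0
  have hr : e.extend (𝓡∂ (m + 1)) x ∈ range (𝓡∂ (m + 1)) := mem_range_self _
  have hpos : e.extend (𝓡∂ (m + 1)) x ∈ interior (range (𝓡∂ (m + 1))) := by
    rw [interior_range_modelWithCornersEuclideanHalfSpace]
    rw [range_modelWithCornersEuclideanHalfSpace] at hr
    exact lt_of_le_of_ne hr (Ne.symm h0)
  let U : Opens M := ⟨e.source, e.open_source⟩
  let c : Coordinates (𝓡∂ (m + 1)) U (m + 1) := Coordinates.ofChart e he subset_rfl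
  refine ((𝓡∂ (m + 1)).isBoundaryPoint_iff_not_isInteriorPoint x).1 hb
    (c.isInteriorPoint (x := x) hx ?_)
  change _ ∈ interior (range (𝓡∂ (m + 1)) ∩ _)
  rw [interior_inter, ((e.isOpen_inter_preimage_symm U.isOpen).preimage
    (𝓡∂ (m + 1)).continuous_symm).interior_eq]
  exact ⟨hpos, (c.map_mem x hx).2⟩

omit [IsManifold (𝓡∂ (m + 1)) ∞ M] [IsManifold (𝓡 m) ∞ N] in
/-- The charts of an immersion whose image lies in the boundary give coordinates adapted to the
boundary. -/
lemma exists_boundaryCoordinates (hι : Manifold.IsSmoothEmbedding (𝓡 m) (𝓡∂ (m + 1)) ∞ ι)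
    (hrange : Set.range ι ⊆ (𝓡∂ (m + 1)).boundary M) (x : N) :
    ∃ U : Opens M, ι x ∈ U ∧ Nonempty (BoundaryCoordinates ι U) := by
  have hx := hι.isImmersion.isImmersionAt x
  set φ := hx.domChart
  set ψ := hx.codChart
  have hφ := hx.domChart_mem_maximalAtlas
  have hψ := hx.codChart_mem_maximalAtlas
  obtain ⟨O, hO, hOφ⟩ := hι.isEmbedding.isOpen_iff.1 φ.open_source
  let U : Opens M := ⟨O ∩ ψ.source, hO.inter ψ.open_source⟩
  have hU : ∀ z, z ∈ preim ι U ↔ z ∈ φ.source := fun z => by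
    constructor
    · intro hz
      rw [← hOφ]
      exact hz.1
    · intro hz
      refine ⟨?_, hx.source_subset_preimage_source hz⟩
      rw [← hOφ] at hz
      exact hz
  let L : EuclideanSpace ℝ (Fin m) →L[ℝ] EuclideanSpace ℝ (Fin (m + 1)) :=
    hx.equiv.toContinuousLinearMap.comp (ContinuousLinearMap.inl ℝ _ _)
  have hw : ∀ z ∈ φ.source, ψ.extend (𝓡∂ (m + 1)) (ι z) = L (φ.extend (𝓡 m) z) := fun z hz => by
    have h1 := hx.writtenInCharts ((φ.extend (𝓡 m)).map_source (by rwa [φ.extend_source]))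
    simp only [Function.comp_apply] at h1
    rwa [φ.extend_left_inv hz] at h1
  have hL0 : ∀ u, L u 0 = 0 := fun u => by
    let ℓ : EuclideanSpace ℝ (Fin m) →ₗ[ℝ] ℝ :=
      ((EuclideanSpace.proj 0 : EuclideanSpace ℝ (Fin (m + 1)) →L[ℝ] ℝ).comp L).toLinearMap
    have h2 : LinearMap.ker ℓ = ⊤ := by
      refine Submodule.eq_top_of_nonempty_interior' _ ?_
      refine ⟨φ.extend (𝓡 m) x, mem_interior.2 ⟨(φ.extend (𝓡 m)).target, fun v hv => ?_,
        φ.isOpen_extend_target, ?_⟩⟩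
      · obtain ⟨z, hz, rfl⟩ : ∃ z ∈ φ.source, φ.extend (𝓡 m) z = v :=
          ⟨(φ.extend (𝓡 m)).symm v, by
            have := (φ.extend (𝓡 m)).map_target hv
            rwa [φ.extend_source] at this, (φ.extend (𝓡 m)).right_inv hv⟩
        change L (φ.extend (𝓡 m) z) 0 = 0
        rw [← hw z hz]
        exact Coordinates.ofChart_zero_eq_zero ψ hψ (hx.source_subset_preimage_source hz)
          (hrange ⟨z, rfl⟩)
      · exact (φ.extend (𝓡 m)).map_source (by
          rw [φ.extend_source]
          exact hx.mem_domChart_source)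
    have h3 : u ∈ LinearMap.ker ℓ := h2 ▸ Submodule.mem_top
    exact h3
  let L' : EuclideanSpace ℝ (Fin m) →ₗ[ℝ] EuclideanSpace ℝ (Fin m) :=
    (((ContinuousLinearMap.snd ℝ ℝ _).comp (splitEquiv m).toContinuousLinearMap).comp L).toLinearMap
  have hLL' : ∀ u, L u = (splitEquiv m).symm (0, L' u) := fun u => by
    rw [ContinuousLinearEquiv.eq_symm_apply]
    exact Prod.ext (hL0 u) rfl
  have hinj : Function.Injective L' := fun u v huv => by
    have h4 : L u = L v := by rw [hLL', hLL', huv]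
    have h5 := hx.equiv.injective h4
    exact congrArg Prod.fst h5
  let Λ := (LinearEquiv.ofInjectiveEndo L' hinj).toContinuousLinearEquiv
  refine ⟨U, (hU x).2 hx.mem_domChart_source, ⟨⟨Coordinates.ofChart ψ hψ inter_subset_right,
    (Coordinates.ofChart φ hφ fun z hz => (hU z).1 hz).compEquiv Λ, fun z hz => ?_⟩⟩⟩
  exact (hw z ((hU z).1 hz)).trans (hLL' _)

/-! #### Coordinates from a collar -/

section Collar

variable (c : Collar ι)

/-- The part of the collar over the domain of the chart at `j`. -/
def Collar.domain (j : N) : Opens M :=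
  ⟨c.toFun '' (univ ×ˢ Ico 0 c.ε) ∩ (fun w => (c.inv w).1) ⁻¹' chartDomain m j,
    (continuous_fst.comp_continuousOn c.contMDiffOn_inv.continuousOn).isOpen_inter_preimage
      c.isOpen_image (chartDomain m j).isOpen⟩

omit [IsManifold (𝓡∂ (m + 1)) ∞ M] [IsManifold (𝓡 m) ∞ N] in
lemma Collar.mem_domain {j z : N} : ι z ∈ c.domain j ↔ z ∈ chartDomain m j := by
  have h0 : (z, (0 : ℝ)) ∈ (univ ×ˢ Ico 0 c.ε : Set (N × ℝ)) := ⟨trivial, le_rfl, c.ε_pos⟩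
  have h1 : c.inv (ι z) = (z, 0) := by
    rw [← c.toFun_zero]
    exact c.inv_toFun _ h0
  constructor
  · intro h
    have := h.2
    rwa [mem_preimage, h1] at this
  · intro h
    refine ⟨⟨_, h0, c.toFun_zero z⟩, ?_⟩
    rwa [mem_preimage, h1]

/-- The coordinates given by a collar and the chart at `j`. -/
def Collar.coordinates (j : N) : BoundaryCoordinates ι (c.domain j) where
  ambient :=
    { toFun := fun w => (splitEquiv m).symm ((c.inv w).2, extChartAt (𝓡 m) j (c.inv w).1)
      inv := fun y => c.toFun ((extChartAt (𝓡 m) j).symm (splitEquiv m y).2, (splitEquiv m y).1)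
      image := splitEquiv m ⁻¹' (Ico 0 c.ε ×ˢ (extChartAt (𝓡 m) j).target)
      contMDiffOn_toFun := by
        have h1 : ContMDiffOn (𝓡∂ (m + 1)) ((𝓡 m).prod 𝓘(ℝ, ℝ)) ∞ c.inv (c.domain j) :=
          c.contMDiffOn_inv.mono inter_subset_left
        have h2 : ContMDiffOn (𝓡∂ (m + 1)) 𝓘(ℝ, EuclideanSpace ℝ (Fin m)) ∞
            (fun w => extChartAt (𝓡 m) j (c.inv w).1) (c.domain j) :=
          contMDiffOn_extChartAt.comp (contMDiff_fst.comp_contMDiffOn h1) fun w hw => hw.2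
        exact (splitEquiv m).symm.contDiff.contMDiff.comp_contMDiffOn
          ((contMDiff_snd.comp_contMDiffOn h1).prodMk_space h2)
      contMDiffOn_inv := by
        have h1 : ContMDiffOn 𝓘(ℝ, EuclideanSpace ℝ (Fin (m + 1))) (𝓡 m) ∞
            (fun y => (extChartAt (𝓡 m) j).symm (splitEquiv m y).2)
            (splitEquiv m ⁻¹' (Ico 0 c.ε ×ˢ (extChartAt (𝓡 m) j).target)) :=
          (contMDiffOn_extChartAt_symm j).comp
            (contDiff_snd.comp (splitEquiv m).contDiff).contMDiff.contMDiffOn fun y hy => hy.2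
        exact c.contMDiffOn_toFun.comp (h1.prodMk
          (contDiff_fst.comp (splitEquiv m).contDiff).contMDiff.contMDiffOn)
          fun y hy => ⟨trivial, hy.1⟩
      map_mem := by
        rintro w ⟨⟨p, hp, rfl⟩, hw⟩
        rw [mem_preimage, c.inv_toFun p hp] at hw
        rw [mem_preimage, c.inv_toFun p hp, ContinuousLinearEquiv.apply_symm_apply]
        exact ⟨hp.2, (extChartAt (𝓡 m) j).map_source (by rw [extChartAt_source]; exact hw)⟩
      inv_mem := fun y hy => by
        have h1 : ((extChartAt (𝓡 m) j).symm (splitEquiv m y).2, (splitEquiv m y).1) ∈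
          (univ ×ˢ Ico 0 c.ε : Set (N × ℝ)) := ⟨trivial, hy.1⟩
        refine ⟨⟨_, h1, rfl⟩, ?_⟩
        rw [mem_preimage, c.inv_toFun _ h1]
        have := (extChartAt (𝓡 m) j).map_target hy.2
        rwa [extChartAt_source] at this
      left_inv := by
        rintro w ⟨⟨p, hp, rfl⟩, hw⟩
        rw [mem_preimage, c.inv_toFun p hp] at hw
        simp only [c.inv_toFun p hp, ContinuousLinearEquiv.apply_symm_apply]
        rw [(extChartAt (𝓡 m) j).left_inv (by rw [extChartAt_source]; exact hw)]
      right_inv := fun y hy => by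
        have h1 : ((extChartAt (𝓡 m) j).symm (splitEquiv m y).2, (splitEquiv m y).1) ∈
          (univ ×ˢ Ico 0 c.ε : Set (N × ℝ)) := ⟨trivial, hy.1⟩
        rw [c.inv_toFun _ h1, ContinuousLinearEquiv.symm_apply_eq]
        simp only [(extChartAt (𝓡 m) j).right_inv hy.2]
      uniqueDiffOn := (splitEquiv m).uniqueDiffOn_preimage_iff.2
        ((uniqueDiffOn_Ico 0 c.ε).prod (isOpen_extChartAt_target j).uniqueDiffOn)
      subset_closure := by
        refine (preimage_mono (f := (splitEquiv m).toHomeomorph) ?_).trans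
          (((splitEquiv m).toHomeomorph.preimage_closure _).trans
            (congrArg closure ((splitEquiv m).toHomeomorph.preimage_interior _))).subset
        rw [interior_prod_eq, closure_prod_eq, interior_Ico, closure_Ioo c.ε_pos.ne,
          (isOpen_extChartAt_target j).interior_eq]
        exact prod_mono Ico_subset_Icc_self subset_closure }
  boundary := Coordinates.ofChart (chartAt _ j) (IsManifold.chart_mem_maximalAtlas j)
    fun _ hz => c.mem_domain.1 hz
  toFun_comp z hz := by
    have h1 : c.inv (ι z) = (z, 0) := by
      rw [← c.toFun_zero]
      exact c.inv_toFun _ ⟨trivial, le_rfl, c.ε_pos⟩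
    simp only [h1]
    rfl

lemma Collar.derivWithin_eq {j : N} {z : N} (hz : z ∈ chartDomain m j)
    (f : SmoothFn (𝓡∂ (m + 1)) (c.domain j)) {t : ℝ} (ht : t ∈ Ico 0 c.ε) :
    derivWithin (fun t => extendZero f (c.toFun (z, t))) (Ico 0 c.ε) t =
      extendZero ((c.coordinates j).normal.apply _ f) (c.toFun (z, t)) := by
  set a := (c.coordinates j).ambient with ha
  have hzs : z ∈ (extChartAt (𝓡 m) j).source := by rwa [extChartAt_source]
  let p : ℝ → EuclideanSpace ℝ (Fin (m + 1)) := fun t => (splitEquiv m).symm (t, extChartAt (𝓡 m) j z)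
  have hp : ∀ t ∈ Ico 0 c.ε, p t ∈ a.image := fun t ht => by
    change splitEquiv m ((splitEquiv m).symm (t, extChartAt (𝓡 m) j z)) ∈
      Ico 0 c.ε ×ˢ (extChartAt (𝓡 m) j).target
    rw [ContinuousLinearEquiv.apply_symm_apply]
    exact ⟨ht, (extChartAt (𝓡 m) j).map_source hzs⟩
  have hinv : ∀ t ∈ Ico 0 c.ε, a.inv (p t) = c.toFun (z, t) := fun t ht => by
    change c.toFun ((extChartAt (𝓡 m) j).symm (splitEquiv m ((splitEquiv m).symm
      (t, extChartAt (𝓡 m) j z))).2, (splitEquiv m ((splitEquiv m).symm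
      (t, extChartAt (𝓡 m) j z))).1) = _
    rw [ContinuousLinearEquiv.apply_symm_apply, (extChartAt (𝓡 m) j).left_inv hzs]
  have hy : ∀ t ∈ Ico 0 c.ε, c.toFun (z, t) ∈ c.domain j := fun t ht => by
    rw [← hinv t ht]
    exact a.inv_mem _ (hp t ht)
  have hpy : a.toFun (c.toFun (z, t)) = p t := by
    rw [← hinv t ht]
    exact a.right_inv _ (hp t ht)
  have h1 : HasDerivWithinAt p (EuclideanSpace.single 0 (1 : ℝ)) (Ico 0 c.ε) t := by
    rw [← splitEquiv_symm_single_zero]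
    exact (splitEquiv m).symm.toContinuousLinearMap.hasFDerivAt.comp_hasDerivWithinAt t
      ((hasDerivWithinAt_id t _).prodMk (hasDerivWithinAt_const t _ _))
  have h2 : DifferentiableWithinAt ℝ (extendZero f ∘ a.inv) a.image (p t) := by
    rw [← hpy]
    exact (a.contDiffWithinAt_comp_inv f (hy t ht) (hy t ht)).differentiableWithinAt (by simp)
  have h3 : ∀ t ∈ Ico 0 c.ε, extendZero f (c.toFun (z, t)) = ((extendZero f ∘ a.inv) ∘ p) t :=
    fun t ht => by simp only [Function.comp_apply, hinv t ht]
  rw [derivWithin_congr h3 (h3 t ht), (h2.hasFDerivWithinAt.comp_hasDerivWithinAt t h1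
    hp).derivWithin (uniqueDiffOn_Ico 0 c.ε t ht)]
  refine Eq.trans ?_ (extendZero_of_mem _ (hy t ht)).symm
  refine Eq.trans ?_ (a.partialDeriv_apply le_rfl 0 f ⟨_, hy t ht⟩).symm
  rw [← hpy]

/-- The restriction of a smooth function on `M` to an open subset. -/
def SmoothFn.restrict (U : Opens M) (g : C^∞⟮𝓡∂ (m + 1), M; 𝓘(ℝ, ℝ), ℝ⟯) :
    SmoothFn (𝓡∂ (m + 1)) U := ⟨fun x => g x, g.contMDiff.comp contMDiff_subtype_val⟩

/-- The normal derivatives at the boundary are the powers of the normal coordinate vector field. -/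
lemma Collar.normalDeriv_eq {j : N} {z : N} (hz : z ∈ chartDomain m j) (k : ℕ)
    (g : C^∞⟮𝓡∂ (m + 1), M; 𝓘(ℝ, ℝ), ℝ⟯) :
    c.normalDeriv k g z = ((c.coordinates j).normal ^ k).apply _ (SmoothFn.restrict (c.domain j) g)
        ⟨ι z, c.mem_domain.2 hz⟩ := by
  have hy : ∀ t ∈ Ico 0 c.ε, c.toFun (z, t) ∈ c.domain j := fun t ht => by
    have h0 : (z, t) ∈ (univ ×ˢ Ico 0 c.ε : Set (N × ℝ)) := ⟨trivial, ht⟩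
    refine ⟨⟨_, h0, rfl⟩, ?_⟩
    rwa [mem_preimage, c.inv_toFun _ h0]
  have h1 : ∀ k, ∀ t ∈ Ico 0 c.ε,
      iteratedDerivWithin k (fun t => g (c.toFun (z, t))) (Ico 0 c.ε) t =
        extendZero (((c.coordinates j).normal ^ k).apply _ (SmoothFn.restrict (c.domain j) g))
          (c.toFun (z, t)) := by
    intro k
    induction k with
    | zero =>
      intro t ht
      rw [iteratedDerivWithin_zero, pow_zero, DiffOp.one_apply, extendZero_of_mem _ (hy t ht)]
      rfl
    | succ k ih =>
      intro t ht
      rw [iteratedDerivWithin_succ, derivWithin_congr ih (ih t ht), c.derivWithin_eq hz _ ht,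
        pow_succ', DiffOp.mul_apply]
  refine (h1 k 0 ⟨le_rfl, c.ε_pos⟩).trans ?_
  rw [c.toFun_zero]
  exact extendZero_of_mem _ (c.mem_domain.2 hz)

end Collar

end BoundaryCoordinates

/-! ### The transfer module -/

section Frame

variable {E : Type*} [NormedAddCommGroup E] [NormedSpace ℝ E]
  {H : Type*} [TopologicalSpace H] {I : ModelWithCorners ℝ E H}
  {M : Type*} [TopologicalSpace M] [ChartedSpace H M] [IsManifold I ∞ M]

lemma DiffOpStalk.mul_act {x : M} (D D' : DiffOpStalk I x) (φ : FnStalk I x) :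
    DiffOpStalk.act x (D * D') φ = DiffOpStalk.act x D (DiffOpStalk.act x D' φ) :=
  DFunLike.congr_fun (map_mul (DiffOpStalk.act x) D D') φ

lemma DiffOpStalk.add_act {x : M} (D D' : DiffOpStalk I x) (φ : FnStalk I x) :
    DiffOpStalk.act x (D + D') φ = DiffOpStalk.act x D φ + DiffOpStalk.act x D' φ :=
  DFunLike.congr_fun (map_add (DiffOpStalk.act x) D D') φ

/-- Germs of coordinate vector fields act as derivations. -/
lemma IsVectorFieldOp.act_mul {U : Opens M} {X : ∀ x : M, TangentSpace I x} {P : DiffOp I U}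
    (hP : IsVectorFieldOp I U X P.1) {x : M} (hx : x ∈ U) (a b : FnStalk I x) :
    DiffOpStalk.act x (DiffOpStalk.germ I x hx P) (a * b) =
      a * DiffOpStalk.act x (DiffOpStalk.germ I x hx P) b +
        DiffOpStalk.act x (DiffOpStalk.germ I x hx P) a * b := by
  obtain ⟨V, hV, f, hVU, rfl⟩ := a.exists_germ_le hx
  obtain ⟨W, hW, g, hWV, rfl⟩ := b.exists_germ_le hV
  rw [← FnStalk.germ_res I hWV x hW, ← DiffOpStalk.germ_res I (hWV.trans hVU) x hW, ← map_mul,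
    DiffOpStalk.act_germ, DiffOpStalk.act_germ, DiffOpStalk.act_germ, ← map_mul, ← map_mul,
    ← map_add]
  exact congrArg _ ((IsVectorFieldOp.apply_mul hP (hWV.trans hVU) _ _).trans
    (congrArg _ (mul_comm _ _)))

lemma IsVectorFieldOp.germ_mul_ofFn {U : Opens M} {X : ∀ x : M, TangentSpace I x} {P : DiffOp I U}
    (hP : IsVectorFieldOp I U X P.1) {x : M} (hx : x ∈ U) (a : FnStalk I x) :
    DiffOpStalk.germ I x hx P * DiffOpStalk.ofFn I x a =
      DiffOpStalk.ofFn I x a * DiffOpStalk.germ I x hx P +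
        DiffOpStalk.ofFn I x (DiffOpStalk.act x (DiffOpStalk.germ I x hx P) a) := by
  obtain ⟨V, hV, f, hVU, rfl⟩ := a.exists_germ_le hx
  have hP' : IsVectorFieldOp I V X (DiffOp.res I hVU P).1 :=
    ⟨hP.1.mono hVU, fun W f x => hP.2 ⟨W.1, W.2.trans hVU⟩ f x⟩
  rw [← DiffOpStalk.germ_res I hVU x hV, DiffOpStalk.act_germ, DiffOpStalk.ofFn_germ,
    DiffOpStalk.ofFn_germ, ← map_mul, hP'.mul_ofFn, map_add, map_mul]

/-- The germs of the coordinate vector fields and of the coordinate functions. -/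
lemma Coordinates.isCoordinateFrame {W : Opens M} {n : ℕ} (c : Coordinates I W n) {x : M}
    (hx : x ∈ W) : IsCoordinateFrame (DiffOpStalk.act x) (DiffOpStalk.ofFn I x)
      (fun i => DiffOpStalk.germ I x hx (c.partialDeriv i))
      (fun i => FnStalk.germ I x hx (c.coord i)) where
  comm i j := by rw [← map_mul, ← map_mul, c.partialDeriv_mul_comm]
  act_ofFn := DiffOpStalk.act_ofFn
  mul_ofFn i a := (c.isVectorFieldOp_partialDeriv i).germ_mul_ofFn hx a
  act_coord i j := by
    rw [DiffOpStalk.act_germ, c.partialDeriv_coord]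
    split_ifs
    · exact map_one _
    · exact map_zero _
  closure_eq_top := c.closure_stalk_eq_top hx

end Frame

section Transfer

variable {E : Type*} [NormedAddCommGroup E] [NormedSpace ℝ E]
  {H : Type*} [TopologicalSpace H] {I : ModelWithCorners ℝ E H}
  {M : Type*} [TopologicalSpace M] [ChartedSpace H M] [IsManifold I ∞ M]
  {E' : Type*} [NormedAddCommGroup E'] [NormedSpace ℝ E']
  {H' : Type*} [TopologicalSpace H'] {J : ModelWithCorners ℝ E' H'}
  {N : Type*} [TopologicalSpace N] [ChartedSpace H' N] [IsManifold J ∞ N]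
  {ι : C^∞⟮J, N; I, M⟯}

omit [IsManifold I ∞ M] in
lemma pullStalk_germ {U : Opens M} {x : N} (hx : ι x ∈ U) (f : SmoothFn I U) :
    pullStalk ι x (FnStalk.germ I (ι x) hx f) =
      FnStalk.germ J (U := preim ι U) x hx (pullFn ι U f) := rfl

namespace TransferStalk

variable (x : N)

lemma add_tmul (f f' : FnStalk J x) (D : DiffOpStalk I (ι x)) :
    tmul ι x (f + f') D = tmul ι x f D + tmul ι x f' D := TensorProduct.tmul_add _ _ _

lemma tmul_add (f : FnStalk J x) (D D' : DiffOpStalk I (ι x)) :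
    tmul ι x f (D + D') = tmul ι x f D + tmul ι x f D' := TensorProduct.add_tmul _ _ _

lemma tmul_ofFn_mul (f : FnStalk J x) (a : FnStalk I (ι x)) (D : DiffOpStalk I (ι x)) :
    tmul ι x f (DiffOpStalk.ofFn I (ι x) a * D) = tmul ι x (pullStalk ι x a * f) D :=
  TensorProduct.smul_tmul a D (show PullFnStalk ι x from f)

lemma op_smul_tmul (f : FnStalk J x) (D P : DiffOpStalk I (ι x)) :
    op P • tmul ι x f D = tmul ι x f (D * P) := rfl

variable {x} in
lemma induction_on {p : TransferStalk ι x → Prop} (t : TransferStalk ι x) (h0 : p 0)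
    (ht : ∀ f D, p (tmul ι x f D)) (ha : ∀ t t', p t → p t' → p (t + t')) : p t :=
  TensorProduct.induction_on (motive := p) t h0 (fun D f => ht f D) ha

variable (ι) in
/-- The operator `φ ↦ f · ι^* (D φ)` given by `f ⊗ D`. -/
def toOperator : TransferStalk ι x →+ (FnStalk I (ι x) → FnStalk J x) :=
  TensorProduct.liftAddHom
    { toFun := fun D =>
        { toFun := fun f φ => (show FnStalk J x from f) * pullStalk ι x (DiffOpStalk.act (ι x) D φ)
          map_zero' := funext fun φ => zero_mul _
          map_add' := fun f f' => funext fun φ => by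
            have h := add_mul (R := FnStalk J x) f f' (pullStalk ι x (DiffOpStalk.act (ι x) D φ))
            exact h }
      map_zero' := AddMonoidHom.ext fun f => funext fun φ => by
        change (show FnStalk J x from f) * _ = 0
        rw [map_zero]
        exact (congrArg _ (map_zero (pullStalk ι x))).trans (mul_zero _)
      map_add' := fun D D' => AddMonoidHom.ext fun f => funext fun φ => by
        change (show FnStalk J x from f) * _ = _ * _ + _ * _
        rw [DiffOpStalk.add_act, map_add]
        exact mul_add _ _ _ }
    fun a D f => funext fun φ => by
      change (show FnStalk J x from f) * pullStalk ι x (DiffOpStalk.act (ι x)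
        (DiffOpStalk.ofFn I (ι x) a * D) φ) =
          (pullStalk ι x a * (show FnStalk J x from f)) * pullStalk ι x (DiffOpStalk.act (ι x) D φ)
      rw [DiffOpStalk.mul_act, DiffOpStalk.act_ofFn, map_mul]
      ring

lemma toOperator_tmul (f : FnStalk J x) (D : DiffOpStalk I (ι x)) (φ : FnStalk I (ι x)) :
    toOperator ι x (tmul ι x f D) φ = f * pullStalk ι x (DiffOpStalk.act (ι x) D φ) := rfl

lemma toOperator_op_smul (t : TransferStalk ι x) (P : DiffOpStalk I (ι x)) (φ : FnStalk I (ι x)) :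
    toOperator ι x (op P • t) φ = toOperator ι x t (DiffOpStalk.act (ι x) P φ) := by
  induction t using induction_on with
  | h0 => rw [smul_zero, map_zero]; rfl
  | ht f D =>
    rw [op_smul_tmul, toOperator_tmul, toOperator_tmul, DiffOpStalk.mul_act]
  | ha t t' h h' =>
    rw [smul_add, map_add, map_add, Pi.add_apply, Pi.add_apply, h, h']

/-- An element of the transfer module is determined by the operator that it defines. -/
lemma toOperator_injective {W : Opens M} {n : ℕ} (c : Coordinates I W n) (hx : ι x ∈ W) :
    Function.Injective (toOperator ι x) := by
  rw [injective_iff_map_eq_zero]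
  intro t ht
  set h := c.isCoordinateFrame hx
  let T : ((Fin n →₀ ℕ) →₀ FnStalk J x) →+ TransferStalk ι x :=
    Finsupp.liftAddHom fun α : Fin n →₀ ℕ =>
      { toFun := fun f => tmul ι x f (h.eval (MvPolynomial.monomial α 1))
        map_zero' := TensorProduct.tmul_zero _ _
        map_add' := fun f f' => add_tmul x f f' _ }
  let S : MvPolynomial (Fin n) (FnStalk J x) →+ TransferStalk ι x :=
    T.comp (MvPolynomial.basisMonomials (Fin n) (FnStalk J x)).repr.toLinearMap.toAddMonoidHom
  have hS : ∀ α f, S (MvPolynomial.monomial α f) =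
      tmul ι x f (h.eval (MvPolynomial.monomial α 1)) := fun α f => by
    have h1 : MvPolynomial.monomial α f =
        f • MvPolynomial.basisMonomials (Fin n) (FnStalk J x) α := by
      rw [MvPolynomial.coe_basisMonomials, MvPolynomial.smul_monomial, smul_eq_mul, mul_one]
    have h2 : (MvPolynomial.basisMonomials (Fin n) (FnStalk J x)).repr (MvPolynomial.monomial α f) =
        Finsupp.single α f := by
      rw [h1, map_smul, Module.Basis.repr_self, Finsupp.smul_single, smul_eq_mul, mul_one]
    refine (congrArg T h2).trans ?_
    exact Finsupp.liftAddHom_apply_single _ _ _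
  have hsurj : ∀ t, ∃ F, S F = t := fun t => by
    induction t using induction_on with
    | h0 => exact ⟨0, map_zero S⟩
    | ha t t' ht ht' =>
      obtain ⟨F, rfl⟩ := ht
      obtain ⟨F', rfl⟩ := ht'
      exact ⟨F + F', map_add S _ _⟩
    | ht f D =>
      have hD : D ∈ AddSubgroup.closure _ := h.closure_ofFn_mul_eval ▸ AddSubgroup.mem_top D
      induction hD using AddSubgroup.closure_induction with
      | mem D hD =>
        obtain ⟨a, α, rfl⟩ := hD
        exact ⟨MvPolynomial.monomial α (pullStalk ι x a * f), by rw [hS, tmul_ofFn_mul]⟩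
      | zero => exact ⟨0, (map_zero S).trans (TensorProduct.zero_tmul _ _).symm⟩
      | add D D' _ _ hD hD' =>
        obtain ⟨F, hF⟩ := hD
        obtain ⟨F', hF'⟩ := hD'
        exact ⟨F + F', by rw [map_add, hF, hF', tmul_add]⟩
      | neg D _ hD =>
        obtain ⟨F, hF⟩ := hD
        refine ⟨-F, ?_⟩
        rw [map_neg, hF]
        refine neg_eq_of_add_eq_zero_right ?_
        rw [← tmul_add, add_neg_cancel]
        exact TensorProduct.zero_tmul _ _
  have hSop : ∀ F, toOperator ι x (S F) = h.symbolOperator (pullStalk ι x) F := fun F => by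
    induction F using MvPolynomial.induction_on' with
    | monomial α f =>
      rw [hS]
      exact funext fun φ => (h.symbolOperator_monomial (pullStalk ι x) α f φ).symm
    | add F G hF hG => rw [map_add, map_add, map_add, hF, hG]
  obtain ⟨F, rfl⟩ := hsurj t
  rw [hSop] at ht
  rw [h.symbolOperator_injective (pullStalk ι x) (fun k f hk hf => FnStalk.nsmul_eq_zero hk hf) ht,
    map_zero]

end TransferStalk

/-- If the vector fields `X` and `X'` are related by `ι`, then restriction along `ι` intertwines
their actions on functions. -/
lemma IsVectorFieldOp.act_pullStalk {U : Opens M} {X : ∀ y : N, TangentSpace J y}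
    {X' : ∀ y : M, TangentSpace I y} {P : DiffOp J (preim ι U)} {P' : DiffOp I U}
    (hP : IsVectorFieldOp J (preim ι U) X P.1) (hP' : IsVectorFieldOp I U X' P'.1)
    (h : ∀ y ∈ preim ι U, X' (ι y) = mfderiv J I ι y (X y)) {x : N} (hx : x ∈ preim ι U)
    (φ : FnStalk I (ι x)) :
    DiffOpStalk.act x (DiffOpStalk.germ J x hx P) (pullStalk ι x φ) =
      pullStalk ι x (DiffOpStalk.act (ι x) (DiffOpStalk.germ I (ι x) hx P') φ) := by
  obtain ⟨V, hV, f, hVU, rfl⟩ := φ.exists_germ_le (show ι x ∈ U from hx)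
  have hVU' : preim ι V ≤ preim ι U := fun _ hy => hVU hy
  have hxV : x ∈ preim ι V := hV
  rw [pullStalk_germ, ← DiffOpStalk.germ_res J hVU' x hxV, DiffOpStalk.act_germ,
    ← DiffOpStalk.germ_res I hVU (ι x) hV, DiffOpStalk.act_germ, pullStalk_germ]
  refine congrArg _ (DFunLike.ext _ _ fun z => ?_)
  refine (hP.2 ⟨preim ι V, hVU'⟩ (pullFn ι V f) z).trans ?_
  refine Eq.trans ?_ (hP'.2 ⟨V, hVU⟩ f ⟨ι z, z.2⟩).symm
  have h1 : extendZero (pullFn ι V f) = extendZero f ∘ ι := funext fun y => by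
    by_cases hy : ι y ∈ V
    · exact (extendZero_of_mem _ (show y ∈ preim ι V from hy)).trans (extendZero_of_mem _ hy).symm
    · exact (extendZero_of_notMem _ (show y ∉ preim ι V from hy)).trans
        (extendZero_of_notMem _ hy).symm
  rw [h1, mfderiv_comp (I' := I) (z : N) (mdifferentiableAt_extendZero f z.2)
    ((ι.contMDiff.mdifferentiable (by simp)) z), h z (hVU' z.2)]
  rfl

end Transfer

section TransferModule

variable {m : ℕ} {M : Type*} [TopologicalSpace M] [ChartedSpace (EuclideanHalfSpace (m + 1)) M]
  {N : Type*} [TopologicalSpace N] [ChartedSpace (EuclideanSpace ℝ (Fin m)) N]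
  [IsManifold (𝓡∂ (m + 1)) ∞ M] [IsManifold (𝓡 m) ∞ N] {ι : C^∞⟮𝓡 m, N; 𝓡∂ (m + 1), M⟯}
  {U : Opens M}

lemma BoundaryCoordinates.act_pullStalk (b : BoundaryCoordinates ι U) {x : N} (hx : x ∈ preim ι U)
    (i : Fin m) (φ : FnStalk (𝓡∂ (m + 1)) (ι x)) :
    DiffOpStalk.act x (DiffOpStalk.germ (𝓡 m) x hx (b.boundary.partialDeriv i)) (pullStalk ι x φ) =
      pullStalk ι x (DiffOpStalk.act (ι x)
        (DiffOpStalk.germ (𝓡∂ (m + 1)) (ι x) hx (b.ambient.partialDeriv i.succ)) φ) := by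
  obtain ⟨V, hV, f, hVU, rfl⟩ := φ.exists_germ_le (show ι x ∈ U from hx)
  have hVU' : preim ι V ≤ preim ι U := fun _ hy => hVU hy
  have hxV : x ∈ preim ι V := hV
  rw [pullStalk_germ, ← DiffOpStalk.germ_res (𝓡 m) hVU' x hxV, DiffOpStalk.act_germ,
    ← DiffOpStalk.germ_res (𝓡∂ (m + 1)) hVU (ι x) hV, DiffOpStalk.act_germ, pullStalk_germ,
    b.pullFn_partialDeriv]

/-- The operators defined by the transfer module are stable under composition with differential
operators of the boundary. -/
lemma BoundaryCoordinates.exists_toOperator_eq (b : BoundaryCoordinates ι U) {x : N}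
    (hx : x ∈ preim ι U) (Q : DiffOpStalk (𝓡 m) x) (t : TransferStalk ι x) :
    ∃ t' : TransferStalk ι x, ∀ φ, TransferStalk.toOperator ι x t' φ =
      DiffOpStalk.act x Q (TransferStalk.toOperator ι x t φ) := by
  have hQ : Q ∈ Subring.closure _ := b.boundary.closure_stalk_eq_top hx ▸ Subring.mem_top Q
  induction hQ using Subring.closure_induction generalizing t with
  | mem Q hQ =>
    induction t using TransferStalk.induction_on with
    | h0 => exact ⟨0, fun φ => by simp only [map_zero, Pi.zero_apply]⟩
    | ha t t' ht ht' =>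
      obtain ⟨s, hs⟩ := ht
      obtain ⟨s', hs'⟩ := ht'
      exact ⟨s + s', fun φ => by
        rw [map_add, map_add, Pi.add_apply, Pi.add_apply, map_add, hs, hs']⟩
    | ht f D =>
      rcases hQ with ⟨a, rfl⟩ | ⟨i, rfl⟩
      · refine ⟨TransferStalk.tmul ι x (a * f) D, fun φ => ?_⟩
        rw [TransferStalk.toOperator_tmul, TransferStalk.toOperator_tmul, DiffOpStalk.act_ofFn,
          mul_assoc]
      · refine ⟨TransferStalk.tmul ι x f (DiffOpStalk.germ (𝓡∂ (m + 1)) (ι x) hx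
            (b.ambient.partialDeriv i.succ) * D) + TransferStalk.tmul ι x (DiffOpStalk.act x
            (DiffOpStalk.germ (𝓡 m) x hx (b.boundary.partialDeriv i)) f) D, fun φ => ?_⟩
        rw [map_add, Pi.add_apply, TransferStalk.toOperator_tmul, TransferStalk.toOperator_tmul,
          TransferStalk.toOperator_tmul,
          (b.boundary.isVectorFieldOp_partialDeriv i).act_mul hx, b.act_pullStalk hx,
          DiffOpStalk.mul_act]
  | zero => exact ⟨0, fun φ => by rw [map_zero, map_zero]; rfl⟩
  | one => exact ⟨t, fun φ => by rw [map_one]; rfl⟩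
  | add Q Q' _ _ hQ hQ' =>
    obtain ⟨s, hs⟩ := hQ t
    obtain ⟨s', hs'⟩ := hQ' t
    exact ⟨s + s', fun φ => by rw [map_add, Pi.add_apply, hs, hs', DiffOpStalk.add_act]⟩
  | neg Q _ hQ =>
    obtain ⟨s, hs⟩ := hQ t
    exact ⟨-s, fun φ => by rw [map_neg, Pi.neg_apply, hs, map_neg]; rfl⟩
  | mul Q Q' _ _ hQ hQ' =>
    obtain ⟨s, hs⟩ := hQ' t
    obtain ⟨s', hs'⟩ := hQ s
    exact ⟨s', fun φ => by rw [hs', hs, DiffOpStalk.mul_act]⟩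

/-- Every point of the boundary has adapted coordinates. -/
def HasBoundaryCoordinates (ι : C^∞⟮𝓡 m, N; 𝓡∂ (m + 1), M⟯) : Prop :=
  ∀ x : N, ∃ U : Opens M, ι x ∈ U ∧ Nonempty (BoundaryCoordinates ι U)

namespace HasBoundaryCoordinates

variable (hb : HasBoundaryCoordinates ι)

include hb

lemma toOperator_injective (x : N) : Function.Injective (TransferStalk.toOperator ι x) := by
  obtain ⟨U, hx, ⟨b⟩⟩ := hb x
  exact TransferStalk.toOperator_injective x b.ambient hx

lemma exists_toOperator_eq (x : N) (Q : DiffOpStalk (𝓡 m) x) (t : TransferStalk ι x) :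
    ∃ t' : TransferStalk ι x, ∀ φ, TransferStalk.toOperator ι x t' φ =
      DiffOpStalk.act x Q (TransferStalk.toOperator ι x t φ) := by
  obtain ⟨U, hx, ⟨b⟩⟩ := hb x
  exact b.exists_toOperator_eq hx Q t

lemma transfer_ext {x : N} {t t' : TransferStalk ι x}
    (h : ∀ φ, TransferStalk.toOperator ι x t φ = TransferStalk.toOperator ι x t' φ) : t = t' :=
  hb.toOperator_injective x (funext h)

/-- The left module structure on the transfer module by composition of operators. -/
@[reducible]
def transferModule (x : N) : Module (DiffOpStalk (𝓡 m) x) (TransferStalk ι x) :=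
  have h := fun Q t => (hb.exists_toOperator_eq x Q t).choose_spec
  { smul := fun Q t => (hb.exists_toOperator_eq x Q t).choose
    one_smul := fun t => hb.transfer_ext fun φ => (h 1 t φ).trans (by rw [map_one]; rfl)
    mul_smul := fun Q Q' t => hb.transfer_ext fun φ => (h (Q * Q') t φ).trans
      (((h Q _ φ).trans (congrArg _ (h Q' t φ))).trans (DiffOpStalk.mul_act _ _ _).symm).symm
    smul_zero := fun Q => hb.transfer_ext fun φ => (h Q 0 φ).trans (by
      rw [map_zero, Pi.zero_apply, map_zero])
    smul_add := fun Q t t' => hb.transfer_ext fun φ => by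
      refine (h Q (t + t') φ).trans ?_
      rw [map_add, map_add, Pi.add_apply, Pi.add_apply, map_add]
      exact congrArg₂ _ (h Q t φ).symm (h Q t' φ).symm
    add_smul := fun Q Q' t => hb.transfer_ext fun φ => by
      refine (h (Q + Q') t φ).trans ?_
      rw [DiffOpStalk.add_act, map_add (TransferStalk.toOperator ι x), Pi.add_apply]
      exact congrArg₂ _ (h Q t φ).symm (h Q' t φ).symm
    zero_smul := fun t => hb.transfer_ext fun φ => (h 0 t φ).trans (by
      rw [map_zero, map_zero]; rfl) }

lemma toOperator_smul (x : N) (Q : DiffOpStalk (𝓡 m) x) (t : TransferStalk ι x)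
    (φ : FnStalk (𝓡∂ (m + 1)) (ι x)) : letI := hb.transferModule x
    TransferStalk.toOperator ι x (Q • t) φ =
      DiffOpStalk.act x Q (TransferStalk.toOperator ι x t φ) :=
  (hb.exists_toOperator_eq x Q t).choose_spec φ

lemma isPullbackConnection : letI := hb.transferModule
    IsPullbackConnection ι := by
  let := hb.transferModule
  refine ⟨fun x h f D => hb.transfer_ext fun φ => ?_,
    fun U x hx X X' P P' hP hP' hXX' f D => hb.transfer_ext fun φ => ?_,
    fun x Q P t => hb.transfer_ext fun φ => ?_⟩
  · rw [hb.toOperator_smul, TransferStalk.toOperator_tmul, TransferStalk.toOperator_tmul,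
      DiffOpStalk.act_ofFn, mul_assoc]
  · rw [hb.toOperator_smul, map_add, Pi.add_apply, TransferStalk.toOperator_tmul,
      TransferStalk.toOperator_tmul, TransferStalk.toOperator_tmul, hP.act_mul hx,
      hP.act_pullStalk hP' hXX' hx, DiffOpStalk.act_germ, DiffOpStalk.mul_act, add_comm]
  · rw [hb.toOperator_smul, TransferStalk.toOperator_op_smul, TransferStalk.toOperator_op_smul,
      hb.toOperator_smul]

end HasBoundaryCoordinates

end TransferModule

/-! ### Germs of distributions -/

section DistStalk

variable {E : Type*} [NormedAddCommGroup E] [NormedSpace ℝ E]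
  {H : Type*} [TopologicalSpace H] {I : ModelWithCorners ℝ E H}
  {M : Type*} [TopologicalSpace M] [ChartedSpace H M] [IsManifold I ∞ M]

instance (p : M) : DirectedSystem
    (fun U : (OpenNhdsOf p)ᵒᵈ => Distribution I (OrderDual.ofDual U).1)
    (fun _ _ h => Distribution.res I h) where
  map_self _ _ := rfl
  map_map _ _ _ _ _ _ := rfl

variable (I) in
/-- The space of germs of distributions at `p`. -/
def DistStalk (p : M) : Type _ :=
  DirectLimit (fun U : (OpenNhdsOf p)ᵒᵈ => Distribution I (OrderDual.ofDual U).1)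
    (fun _ _ h => Distribution.res I h)

namespace DistStalk

instance (p : M) : AddCommGroup (DistStalk I p) :=
  DirectLimit.instAddCommGroupOfAddMonoidHomClass

variable {p : M}

/-- The germ at `p` of a distribution. -/
def germ {U : Opens M} (p : M) (hp : p ∈ U) (T : Distribution I U) : DistStalk I p :=
  Quotient.mk _ ⟨OrderDual.toDual ⟨U, hp⟩, T⟩

lemma germ_res {U W : Opens M} (h : W ≤ U) (hp : p ∈ W) (T : Distribution I U) :
    germ p hp (Distribution.res I h T) = germ p (h hp) T :=
  DirectLimit.mk_apply (F := fun U : (OpenNhdsOf p)ᵒᵈ => Distribution I (OrderDual.ofDual U).1)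
    (f := fun _ _ h => Distribution.res I h)
    (OrderDual.toDual ⟨U, h hp⟩) (OrderDual.toDual ⟨W, hp⟩) T h

lemma exists_germ_le (φ : DistStalk I p) {V : Opens M} (hV : p ∈ V) :
    ∃ (U : Opens M) (hp : p ∈ U) (T : Distribution I U), U ≤ V ∧ germ p hp T = φ := by
  obtain ⟨U, T, rfl⟩ := DirectLimit.exists_eq_mk _ φ
  exact ⟨(OrderDual.ofDual U).1 ⊓ V, ⟨(OrderDual.ofDual U).2, hV⟩,
    Distribution.res I inf_le_left T, inf_le_right,
    germ_res (U := (OrderDual.ofDual U).1) inf_le_left ⟨(OrderDual.ofDual U).2, hV⟩ T⟩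

lemma germ_eq {U V : Opens M} {hU : p ∈ U} {hV : p ∈ V} {T : Distribution I U}
    {T' : Distribution I V} (h : germ p hU T = germ p hV T') :
    ∃ (W : Opens M) (h₁ : W ≤ U) (h₂ : W ≤ V), p ∈ W ∧
      Distribution.res I h₁ T = Distribution.res I h₂ T' := by
  obtain ⟨W, h₁, h₂, h⟩ := Quotient.exact h
  exact ⟨(OrderDual.ofDual W).1, h₁, h₂, (OrderDual.ofDual W).2, h⟩

lemma germ_add {U : Opens M} (hp : p ∈ U) (T T' : Distribution I U) :
    germ p hp (T + T') = germ p hp T + germ p hp T' :=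
  (DirectLimit.add_def (G := fun U : (OpenNhdsOf p)ᵒᵈ => Distribution I (OrderDual.ofDual U).1)
    (f := fun _ _ h => Distribution.res I h) (OrderDual.toDual ⟨U, hp⟩) T T').symm

lemma germ_zero {U : Opens M} (hp : p ∈ U) : germ p hp (0 : Distribution I U) = 0 :=
  (DirectLimit.zero_def (G := fun U : (OpenNhdsOf p)ᵒᵈ => Distribution I (OrderDual.ofDual U).1)
    (f := fun _ _ h => Distribution.res I h) (OrderDual.toDual ⟨U, hp⟩)).symm

/-- The right action of a germ of a differential operator on a germ of a distribution. -/
def smulGerm (D : DiffOpStalk I p) (φ : DistStalk I p) : DistStalk I p :=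
  DirectLimit.map₂ (ι := (OpenNhdsOf p)ᵒᵈ)
    (F₁ := fun U => DiffOp I (OrderDual.ofDual U).1)
    (F₂ := fun U => Distribution I (OrderDual.ofDual U).1)
    (F := fun U => Distribution I (OrderDual.ofDual U).1)
    (fun _ _ h => DiffOp.res I h) (fun _ _ h => Distribution.res I h)
    (fun _ _ h => Distribution.res I h) (fun _ P T => op P • T)
    (fun _ _ h P T => Distribution.ext fun g => congrArg T.1 (TestFn.smul_incl I h P g)) D φ

lemma smulGerm_germ {U : Opens M} (hp : p ∈ U) (P : DiffOp I U) (T : Distribution I U) :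
    smulGerm (DiffOpStalk.germ I p hp P) (germ p hp T) = germ p hp (op P • T) :=
  DirectLimit.map₂_def (ι := (OpenNhdsOf p)ᵒᵈ)
    (F₁ := fun U => DiffOp I (OrderDual.ofDual U).1)
    (F₂ := fun U => Distribution I (OrderDual.ofDual U).1)
    (F := fun U => Distribution I (OrderDual.ofDual U).1)
    (fun _ _ h => DiffOp.res I h) (fun _ _ h => Distribution.res I h)
    (fun _ _ h => Distribution.res I h) (fun _ P T => op P • T)
    (fun _ _ h P T => Distribution.ext fun g => congrArg T.1 (TestFn.smul_incl I h P g))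
    (OrderDual.toDual ⟨U, hp⟩) P T

lemma exists_germ_diffOpGerm (D : DiffOpStalk I p) (φ : DistStalk I p) {V : Opens M}
    (hV : p ∈ V) : ∃ (U : Opens M) (hp : p ∈ U) (P : DiffOp I U) (T : Distribution I U),
      U ≤ V ∧ DiffOpStalk.germ I p hp P = D ∧ germ p hp T = φ := by
  obtain ⟨U, hU, P, hUV, rfl⟩ := D.exists_germ_le hV
  obtain ⟨W, hW, T, hWU, rfl⟩ := φ.exists_germ_le hU
  exact ⟨W, hW, DiffOp.res I hWU P, T, hWU.trans hUV, DiffOpStalk.germ_res I hWU p hW P, rfl⟩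

lemma smulGerm_add (D : DiffOpStalk I p) (φ ψ : DistStalk I p) :
    smulGerm D (φ + ψ) = smulGerm D φ + smulGerm D ψ := by
  obtain ⟨U, hU, P, T, -, rfl, rfl⟩ := exists_germ_diffOpGerm D φ (V := ⊤) trivial
  obtain ⟨V, hV, T', hVU, rfl⟩ := ψ.exists_germ_le hU
  rw [← DiffOpStalk.germ_res I hVU p hV, ← germ_res hVU hV, ← germ_add, smulGerm_germ,
    smulGerm_germ, smulGerm_germ, ← germ_add, smul_add]

lemma add_smulGerm (D D' : DiffOpStalk I p) (φ : DistStalk I p) :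
    smulGerm (D + D') φ = smulGerm D φ + smulGerm D' φ := by
  obtain ⟨U, hU, P, T, -, rfl, rfl⟩ := exists_germ_diffOpGerm D φ (V := ⊤) trivial
  obtain ⟨V, hV, P', hVU, rfl⟩ := D'.exists_germ_le hU
  rw [← DiffOpStalk.germ_res I hVU p hV, ← germ_res hVU hV, ← map_add, smulGerm_germ,
    smulGerm_germ, smulGerm_germ, ← germ_add, op_add, add_smul]

lemma mul_smulGerm (D D' : DiffOpStalk I p) (φ : DistStalk I p) :
    smulGerm (D * D') φ = smulGerm D' (smulGerm D φ) := by
  obtain ⟨U, hU, P, T, -, rfl, rfl⟩ := exists_germ_diffOpGerm D φ (V := ⊤) trivial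
  obtain ⟨V, hV, P', hVU, rfl⟩ := D'.exists_germ_le hU
  rw [← DiffOpStalk.germ_res I hVU p hV, ← germ_res hVU hV, ← map_mul, smulGerm_germ,
    smulGerm_germ, smulGerm_germ, op_mul, mul_smul]

instance : Module (DiffOpStalk I p)ᵐᵒᵖ (DistStalk I p) where
  smul D φ := smulGerm (unop D) φ
  one_smul φ := by
    obtain ⟨U, hU, T, -, rfl⟩ := φ.exists_germ_le (V := ⊤) trivial
    change smulGerm (1 : DiffOpStalk I p) _ = _
    rw [← map_one (DiffOpStalk.germ I p hU), smulGerm_germ, op_one, one_smul]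
  mul_smul D D' φ := mul_smulGerm (unop D') (unop D) φ
  smul_zero D := by
    have h := smulGerm_add (unop D) (0 : DistStalk I p) 0
    rw [add_zero] at h
    exact left_eq_add.1 h
  smul_add D φ ψ := smulGerm_add (unop D) φ ψ
  add_smul D D' φ := add_smulGerm (unop D) (unop D') φ
  zero_smul φ := by
    have h := add_smulGerm (0 : DiffOpStalk I p) 0 φ
    rw [add_zero] at h
    exact left_eq_add.1 h

lemma op_smul_germ {U : Opens M} (hp : p ∈ U) (P : DiffOp I U) (T : Distribution I U) :
    op (DiffOpStalk.germ I p hp P) • germ p hp T = germ p hp (op P • T) := smulGerm_germ hp P T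

end DistStalk

end DistStalk

/-! ### Distributions defined by densities on the boundary -/

section BoundaryDistribution

variable {E : Type*} [NormedAddCommGroup E] [NormedSpace ℝ E]
  {H : Type*} [TopologicalSpace H] {I : ModelWithCorners ℝ E H}
  {M : Type*} [TopologicalSpace M] [ChartedSpace H M] [IsManifold I ∞ M]
  {m : ℕ} {N : Type*} [TopologicalSpace N] [ChartedSpace (EuclideanSpace ℝ (Fin m)) N]
  [IsManifold (𝓡 m) ∞ N]
  {ι : C^∞⟮𝓡 m, N; I, M⟯} (hc : IsClosedEmbedding ι) {U : Opens M}

/-- The restriction of a test function along a closed embedding. -/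
def TestFn.pull (g : TestFn I U) : TestFn (𝓡 m) (preim ι U) :=
  ⟨g.1.comp ι, g.2.1.comp_isClosedEmbedding hc,
    (tsupport_comp_subset_preimage _ hc.continuous).trans (preimage_mono g.2.2)⟩

/-- If `ι^* ∘ P = Q ∘ ι^*` on functions, then the same is true on test functions. -/
lemma TestFn.pull_smul {P : DiffOp I U} {Q : DiffOp (𝓡 m) (preim ι U)}
    (h : ∀ f, Q.apply (𝓡 m) (pullFn ι U f) = pullFn ι U (P.apply I f)) (g : TestFn I U) :
    TestFn.pull hc (P • g) = Q • TestFn.pull hc g := by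
  refine TestFn.ext_on fun x => ?_
  refine (TestFn.smul_apply P g ⟨ι x, x.2⟩).trans (Eq.trans ?_ (TestFn.smul_apply Q _ x).symm)
  exact (DFunLike.congr_fun (h (TestFn.toSmoothFn I g)) x).symm

variable [T2Space N] [SigmaCompactSpace N]

/-- The distribution `g ↦ ∫_N (g ∘ ι) ν`. -/
def boundaryDistribution (ν : Density (𝓡 m) (preim ι U)) : Distribution I U :=
  ⟨{ toFun := fun g => ν.integral (𝓡 m) (TestFn.pull hc g).1
     map_add' := fun g g' => Density.integral_add ν (TestFn.pull hc g).isCompactlySupportedIn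
      (TestFn.pull hc g').isCompactlySupportedIn
     map_smul' := fun r g =>
      Density.integral_const_mul ν r (TestFn.pull hc g).isCompactlySupportedIn },
    fun K hK hKU => by
      obtain ⟨C, hC⟩ := Density.exists_integral_bound ν (hc.isCompact_preimage hK)
        (preimage_mono hKU)
      refine ⟨{1}, C, fun g hg b hb hP => hC _ ?_ b hb fun x => ?_⟩
      · exact (tsupport_comp_subset_preimage _ hc.continuous).trans (preimage_mono hg)
      · have h := hP 1 (Finset.mem_singleton_self _) (ι x)
        rwa [one_smul] at h⟩

lemma boundaryDistribution_mem (ν : Density (𝓡 m) (preim ι U)) :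
    boundaryDistribution hc ν ∈ boundaryDensities ι U := ⟨ν, fun _ => rfl⟩

lemma exists_eq_boundaryDistribution {T : Distribution I U} (hT : T ∈ boundaryDensities ι U) :
    ∃ ν, T = boundaryDistribution hc ν := by
  obtain ⟨ν, hν⟩ := hT
  exact ⟨ν, Distribution.ext hν⟩

lemma boundaryDistribution_add (ν ν' : Density (𝓡 m) (preim ι U)) :
    boundaryDistribution hc (ν + ν') =
      boundaryDistribution hc ν + boundaryDistribution hc ν' :=
  Distribution.ext fun g => Density.add_integral ν ν' (TestFn.pull hc g).isCompactlySupportedIn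

lemma res_boundaryDistribution {W : Opens M} (h : W ≤ U) (ν : Density (𝓡 m) (preim ι U)) :
    Distribution.res I h (boundaryDistribution hc ν) = boundaryDistribution hc
      (Density.res (𝓡 m) (show preim ι W ≤ preim ι U from fun _ hx => h hx) ν) :=
  Distribution.ext fun g => (Density.integral_res _ ν fun _ hx =>
    (TestFn.pull hc g).isCompactlySupportedIn.eq_zero hx).symm

lemma IsAdjoint.op_smul_boundaryDistribution {P : DiffOp I U} {Q : DiffOp (𝓡 m) (preim ι U)}
    {ν ν' : Density (𝓡 m) (preim ι U)} (hν : IsAdjoint Q ν ν')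
    (h : ∀ f, Q.apply (𝓡 m) (pullFn ι U f) = pullFn ι U (P.apply I f)) :
    op P • boundaryDistribution hc ν = boundaryDistribution hc ν' :=
  Distribution.ext fun g => by
    change ν.integral (𝓡 m) (TestFn.pull hc (P • g)).1 = ν'.integral (𝓡 m) (TestFn.pull hc g).1
    rw [TestFn.pull_smul hc h]
    exact (hν _).symm

/-- A density is determined by the integrals of the restrictions of test functions. -/
lemma eq_zero_of_boundaryDistribution_eq_zero [FiniteDimensional ℝ E] [T2Space M]
    {ν : Density (𝓡 m) (preim ι U)} (h : boundaryDistribution hc ν = 0) : ν = 0 := by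
  refine Density.ext_diag fun y hy => ?_
  by_contra hν
  obtain ⟨V, hyV, hV⟩ := Density.exists_integral_ne_zero ν hy hν
  obtain ⟨W, hW, hWV⟩ := hc.isInducing.isOpen_iff.1 V.2
  have hyW : ι y ∈ W := by
    change y ∈ ι ⁻¹' W
    rw [hWV]
    exact hyV
  obtain ⟨f, -, hf⟩ := (SmoothBumpFunction.nhds_basis_tsupport (I := I) (ι y)).mem_iff.1
    ((hW.inter U.2).mem_nhds ⟨hyW, hy⟩)
  let g : TestFn I U := ⟨⟨f, f.contMDiff⟩, f.hasCompactSupport, hf.trans inter_subset_right⟩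
  have h1 : tsupport (fun x => g.1 (ι x)) ⊆ V := by
    refine (tsupport_comp_subset_preimage _ hc.continuous).trans ?_
    refine (preimage_mono (hf.trans inter_subset_left)).trans hWV.subset
  refine hV (fun x => g.1 (ι x)) ⟨?_, ?_, h1⟩ (fun x => f.nonneg) ?_
    (DFunLike.congr_fun (congrArg Subtype.val h) g)
  · exact f.continuous.comp hc.continuous
  · exact f.hasCompactSupport.comp_isClosedEmbedding hc
  · change 0 < f (ι y)
    rw [f.eq_one]
    exact one_pos

/-! #### The inclusion of germs of densities into germs of distributions -/

include hc in
omit [IsManifold I ∞ M] [IsManifold (𝓡 m) ∞ N] [T2Space N] [SigmaCompactSpace N] in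
lemma exists_preim_eq (V : Opens N) : ∃ U : Opens M, preim ι U = V := by
  obtain ⟨U, hU, h⟩ := hc.isInducing.isOpen_iff.1 V.2
  exact ⟨⟨U, hU⟩, Opens.ext h⟩

omit [IsManifold I ∞ M] [T2Space N] [SigmaCompactSpace N] in
include hc in
lemma DensityStalk.exists_preim_germ {x : N} (φ : DensityStalk (𝓡 m) x) {V : Opens M}
    (hV : ι x ∈ V) : ∃ (U : Opens M) (hx : x ∈ preim ι U) (ν : Density (𝓡 m) (preim ι U)), U ≤ V ∧
      DensityStalk.germ (𝓡 m) x hx ν = φ := by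
  obtain ⟨W, hW, ν, hWV, rfl⟩ := φ.exists_germ_le (V := preim ι V) hV
  obtain ⟨U, rfl⟩ := exists_preim_eq hc W
  have hxU : x ∈ preim ι (U ⊓ V) := ⟨hW, hV⟩
  have h : preim ι (U ⊓ V) ≤ preim ι U := fun _ hy => And.left hy
  exact ⟨U ⊓ V, hxU, Density.res (𝓡 m) h ν, inf_le_right, DensityStalk.germ_res (𝓡 m) h x hxU ν⟩

/-- The germ at `ι x` of the distribution defined by a germ of a density at `x`. -/
def boundaryGermFun {x : N} (φ : DensityStalk (𝓡 m) x) : DistStalk I (ι x) :=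
  have h := φ.exists_preim_germ hc (V := ⊤) trivial
  DistStalk.germ (ι x) (show ι x ∈ h.choose from h.choose_spec.choose)
    (boundaryDistribution hc h.choose_spec.choose_spec.choose)

lemma boundaryGermFun_germ {x : N} (hx : x ∈ preim ι U) (ν : Density (𝓡 m) (preim ι U)) :
    boundaryGermFun hc (DensityStalk.germ (𝓡 m) x hx ν) =
      DistStalk.germ (ι x) (show ι x ∈ U from hx) (boundaryDistribution hc ν) := by
  have h := (DensityStalk.germ (𝓡 m) x hx ν).exists_preim_germ hc (V := ⊤) trivial
  obtain ⟨W, h₁, h₂, hxW, hW⟩ := DensityStalk.germ_eq h.choose_spec.choose_spec.choose_spec.2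
  obtain ⟨W, rfl⟩ := exists_preim_eq hc W
  let W' : Opens M := W ⊓ (h.choose ⊓ U)
  have hxW' : ι x ∈ W' := ⟨hxW, h.choose_spec.choose, hx⟩
  have hW' : preim ι W' ≤ preim ι W := fun _ hy => hy.1
  change DistStalk.germ (ι x) (show ι x ∈ h.choose from h.choose_spec.choose) _ = _
  rw [← DistStalk.germ_res (inf_le_right.trans inf_le_left : W' ≤ h.choose) hxW',
    ← DistStalk.germ_res (inf_le_right.trans inf_le_right : W' ≤ U) hxW',
    res_boundaryDistribution, res_boundaryDistribution]
  refine congrArg (fun ν => DistStalk.germ (ι x) hxW' (boundaryDistribution hc ν)) ?_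
  refine Density.ext_diag fun y hy => ?_
  have h3 := congrArg (fun ν : Density (𝓡 m) (preim ι W) => ν.1 y y) hW
  beta_reduce at h3
  rw [Density.res_apply h₁ _ y (hW' hy), Density.res_apply h₂ _ y (hW' hy)] at h3
  exact (Density.res_apply _ _ y hy).trans (h3.trans (Density.res_apply _ _ y hy).symm)

/-- The inclusion of the germs at `x` of densities into the germs at `ι x` of distributions. -/
def boundaryGerm (x : N) : DensityStalk (𝓡 m) x →+ DistStalk I (ι x) :=
  AddMonoidHom.mk' (boundaryGermFun hc) fun φ ψ => by
    obtain ⟨U, hU, ν, -, rfl⟩ := φ.exists_preim_germ hc (V := ⊤) trivial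
    obtain ⟨V, hV, ν', hVU, rfl⟩ := ψ.exists_preim_germ hc hU
    have hxV : x ∈ preim ι V := hV
    have h : preim ι V ≤ preim ι U := fun _ hx => hVU hx
    rw [← DensityStalk.germ_res (𝓡 m) h x hxV, ← DensityStalk.germ_add, boundaryGermFun_germ,
      boundaryGermFun_germ, boundaryGermFun_germ, boundaryDistribution_add]
    exact DistStalk.germ_add (show ι x ∈ V from hV) _ _

lemma boundaryGerm_germ {x : N} (hx : x ∈ preim ι U) (ν : Density (𝓡 m) (preim ι U)) :
    boundaryGerm hc x (DensityStalk.germ (𝓡 m) x hx ν) =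
      DistStalk.germ (ι x) (show ι x ∈ U from hx) (boundaryDistribution hc ν) :=
  boundaryGermFun_germ hc hx ν

lemma boundaryGerm_injective [FiniteDimensional ℝ E] [T2Space M] (x : N) :
    Function.Injective (boundaryGerm (I := I) hc x) := by
  rw [injective_iff_map_eq_zero]
  intro φ hφ
  obtain ⟨U, hU, ν, -, rfl⟩ := φ.exists_preim_germ hc (V := ⊤) trivial
  rw [boundaryGerm_germ, ← DistStalk.germ_zero (I := I) (U := U) hU] at hφ
  obtain ⟨W, h, _, hxW, hW⟩ := DistStalk.germ_eq hφ
  have hxW' : x ∈ preim ι W := hxW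
  have h' : preim ι W ≤ preim ι U := fun _ hx => h hx
  rw [← DensityStalk.germ_res (𝓡 m) h' x hxW',
    eq_zero_of_boundaryDistribution_eq_zero hc ((res_boundaryDistribution hc h ν).symm.trans hW),
    DensityStalk.germ_zero]

end BoundaryDistribution

/-! ### The stalks of the push-forward -/

/-- If `Y` lowers the index of the maps `t k` as the multiplication by a normal coordinate does for
the normal derivatives of the delta distribution, then these maps are independent. -/
lemma eq_zero_of_sum_eq_zero {A B : Type*} [AddCommGroup A] [AddCommGroup B] (t : ℕ → A →+ B)
    (Y : B →+ B) (hA : ∀ (k : ℕ) (a : A), (k + 1) • a = 0 → a = 0)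
    (ht : Function.Injective (t 0)) (h0 : ∀ a, Y (t 0 a) = 0)
    (hY : ∀ k a, Y (t (k + 1) a) = (k + 1) • t k a) (K : ℕ) (ν : ℕ → A)
    (h : ∑ k ∈ Finset.range K, t k (ν k) = 0) : ∀ k < K, ν k = 0 := by
  induction K generalizing ν with
  | zero => exact fun k hk => absurd hk (Nat.not_lt_zero k)
  | succ K ih =>
    have h1 : ∀ k < K, (k + 1) • ν (k + 1) = 0 := ih _ <| by
      have h2 := congrArg Y h
      rw [map_sum, Finset.sum_range_succ', h0, add_zero, map_zero] at h2
      refine (Finset.sum_congr rfl fun k _ => ?_).trans h2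
      rw [hY, map_nsmul]
    have h2 : ∀ k < K, ν (k + 1) = 0 := fun k hk => hA k _ (h1 k hk)
    rw [Finset.sum_range_succ', Finset.sum_eq_zero fun k hk => by
      rw [h2 k (Finset.mem_range.1 hk), map_zero], zero_add] at h
    rintro (_ | k) hk
    · exact ht (h.trans (map_zero _).symm)
    · exact h2 k (Nat.lt_of_succ_lt_succ hk)

section PushStalk

variable {m : ℕ} {M : Type*} [TopologicalSpace M] [ChartedSpace (EuclideanHalfSpace (m + 1)) M]
  [IsManifold (𝓡∂ (m + 1)) ∞ M]
  {N : Type*} [TopologicalSpace N] [ChartedSpace (EuclideanSpace ℝ (Fin m)) N]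
  [IsManifold (𝓡 m) ∞ N] [T2Space N] [SigmaCompactSpace N]
  {ι : C^∞⟮𝓡 m, N; 𝓡∂ (m + 1), M⟯}
  [∀ x : N, Module (DiffOpStalk (𝓡 m) x)ᵐᵒᵖ (DensityStalk (𝓡 m) x)]
  [∀ x : N, Module (DiffOpStalk (𝓡 m) x) (TransferStalk ι x)]

variable (ι) in
/-- The given module structures are the ones by formal adjoints on densities, and by composition of
operators on the transfer module. -/
structure IsOperatorAction : Prop where
  smul_germ : ∀ {V : Opens N} {x : N} (hx : x ∈ V) {Q : DiffOp (𝓡 m) V} {ν ν' : Density (𝓡 m) V},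
    IsAdjoint Q ν ν' → op (DiffOpStalk.germ (𝓡 m) x hx Q) • DensityStalk.germ (𝓡 m) x hx ν =
      DensityStalk.germ (𝓡 m) x hx ν'
  toOperator_smul : ∀ (x : N) (Q : DiffOpStalk (𝓡 m) x) (t : TransferStalk ι x)
    (φ : FnStalk (𝓡∂ (m + 1)) (ι x)), TransferStalk.toOperator ι x (Q • t) φ =
      DiffOpStalk.act x Q (TransferStalk.toOperator ι x t φ)

namespace IsOperatorAction

variable (ha : IsOperatorAction ι) (hb : HasBoundaryCoordinates ι) (hc : IsClosedEmbedding ι)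

include ha

lemma op_smul_boundaryGerm {U : Opens M} {P : DiffOp (𝓡∂ (m + 1)) U}
    {Q : DiffOp (𝓡 m) (preim ι U)}
    (h : ∀ (W : Opens M) (hW : W ≤ U) (hW' : preim ι W ≤ preim ι U) (f : SmoothFn (𝓡∂ (m + 1)) W),
      (DiffOp.res (𝓡 m) hW' Q).apply (𝓡 m) (pullFn ι W f) =
        pullFn ι W ((DiffOp.res (𝓡∂ (m + 1)) hW P).apply (𝓡∂ (m + 1)) f))
    {x : N} (hx : x ∈ preim ι U) (φ : DensityStalk (𝓡 m) x) :
    op (DiffOpStalk.germ (𝓡∂ (m + 1)) (ι x) hx P) • boundaryGerm hc x φ =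
      boundaryGerm hc x (op (DiffOpStalk.germ (𝓡 m) x hx Q) • φ) := by
  obtain ⟨W, hW, ν, hWU, rfl⟩ := φ.exists_preim_germ hc (show ι x ∈ U from hx)
  have hW' : preim ι W ≤ preim ι U := fun _ hy => hWU hy
  obtain ⟨ν', hν'⟩ := exists_isAdjoint (DiffOp.res (𝓡 m) hW' Q) ν
  rw [← DiffOpStalk.germ_res (𝓡 m) hW' x hW, ha.smul_germ hW hν', boundaryGerm_germ,
    boundaryGerm_germ, ← DiffOpStalk.germ_res (𝓡∂ (m + 1)) hWU (ι x) hW]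
  refine (DistStalk.op_smul_germ (show ι x ∈ W from hW) _ _).trans ?_
  rw [hν'.op_smul_boundaryDistribution hc (h W hWU hW')]

lemma op_ofFn_smul_boundaryGerm (x : N) (a : FnStalk (𝓡∂ (m + 1)) (ι x))
    (φ : DensityStalk (𝓡 m) x) :
    op (DiffOpStalk.ofFn (𝓡∂ (m + 1)) (ι x) a) • boundaryGerm hc x φ =
      boundaryGerm hc x (op (DiffOpStalk.ofFn (𝓡 m) x (pullStalk ι x a)) • φ) := by
  obtain ⟨U, hU, f, -, rfl⟩ := a.exists_germ_le (V := ⊤) trivial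
  have hxU : x ∈ preim ι U := hU
  rw [pullStalk_germ, DiffOpStalk.ofFn_germ, DiffOpStalk.ofFn_germ hxU]
  refine ha.op_smul_boundaryGerm hc (P := DiffOp.ofFn (𝓡∂ (m + 1)) U f)
    (Q := DiffOp.ofFn (𝓡 m) (preim ι U) (pullFn ι U f)) (fun W hW hW' g => ?_) hxU φ
  refine (DiffOp.ofFn_apply (SmoothFn.res (𝓡 m) hW' (pullFn ι U f)) (pullFn ι W g)).trans ?_
  refine (map_mul (pullFn ι W) (SmoothFn.res (𝓡∂ (m + 1)) hW f) g).symm.trans ?_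
  exact congrArg (pullFn ι W) (DiffOp.ofFn_apply (SmoothFn.res (𝓡∂ (m + 1)) hW f) g).symm

lemma op_partialDeriv_smul_boundaryGerm {U : Opens M} (b : BoundaryCoordinates ι U) {x : N}
    (hx : x ∈ preim ι U) (i : Fin m) (φ : DensityStalk (𝓡 m) x) :
    op (DiffOpStalk.germ (𝓡∂ (m + 1)) (ι x) hx (b.ambient.partialDeriv i.succ)) •
        boundaryGerm hc x φ =
      boundaryGerm hc x (op (DiffOpStalk.germ (𝓡 m) x hx (b.boundary.partialDeriv i)) • φ) :=
  ha.op_smul_boundaryGerm hc (fun _ hW hW' f => b.pullFn_partialDeriv hW hW' i f) hx φ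

include hb in
lemma ofFn_smul_tmul {x : N} (a f : FnStalk (𝓡 m) x) (D : DiffOpStalk (𝓡∂ (m + 1)) (ι x)) :
    DiffOpStalk.ofFn (𝓡 m) x a • TransferStalk.tmul ι x f D = TransferStalk.tmul ι x (a * f) D :=
  hb.transfer_ext fun φ => by
    rw [ha.toOperator_smul, TransferStalk.toOperator_tmul, TransferStalk.toOperator_tmul,
      DiffOpStalk.act_ofFn, mul_assoc]

include hb in
lemma mul_smul_transfer {x : N} (Q Q' : DiffOpStalk (𝓡 m) x) (t : TransferStalk ι x) :
    (Q * Q') • t = Q • Q' • t :=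
  hb.transfer_ext fun φ => by
    rw [ha.toOperator_smul, ha.toOperator_smul, ha.toOperator_smul, DiffOpStalk.mul_act]

include hb in
lemma partialDeriv_smul_tmul {U : Opens M} (b : BoundaryCoordinates ι U) {x : N}
    (hx : x ∈ preim ι U) (i : Fin m) (f : FnStalk (𝓡 m) x)
    (D : DiffOpStalk (𝓡∂ (m + 1)) (ι x)) :
    DiffOpStalk.germ (𝓡 m) x hx (b.boundary.partialDeriv i) • TransferStalk.tmul ι x f D =
      TransferStalk.tmul ι x f (DiffOpStalk.germ (𝓡∂ (m + 1)) (ι x) hx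
        (b.ambient.partialDeriv i.succ) * D) +
      TransferStalk.tmul ι x (DiffOpStalk.act x (DiffOpStalk.germ (𝓡 m) x hx
        (b.boundary.partialDeriv i)) f) D :=
  hb.transfer_ext fun φ => by
    rw [ha.toOperator_smul, map_add, Pi.add_apply, TransferStalk.toOperator_tmul,
      TransferStalk.toOperator_tmul, TransferStalk.toOperator_tmul,
      (b.boundary.isVectorFieldOp_partialDeriv i).act_mul hx, b.act_pullStalk hx,
      DiffOpStalk.mul_act]

/-- The germ of the distribution `g ↦ ∫ f (D g)|_N ν`, for a germ `φ` of a density `ν`, as a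
function of `f ⊗ D`. -/
def transferPairing (x : N) (φ : DensityStalk (𝓡 m) x) :
    TransferStalk ι x →+ DistStalk (𝓡∂ (m + 1)) (ι x) :=
  TensorProduct.liftAddHom
    { toFun := fun D =>
        { toFun := fun f => op D • boundaryGerm hc x (op (DiffOpStalk.ofFn (𝓡 m) x f) • φ)
          map_zero' := by
            refine (congrArg (fun Q => op D • boundaryGerm hc x (op Q • φ))
              (map_zero (DiffOpStalk.ofFn (𝓡 m) x))).trans ?_
            rw [op_zero, zero_smul, map_zero, smul_zero]
          map_add' := fun f f' => by
            refine (congrArg (fun Q => op D • boundaryGerm hc x (op Q • φ))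
              (map_add (DiffOpStalk.ofFn (𝓡 m) x) f f')).trans ?_
            rw [op_add, add_smul, map_add, smul_add]
            rfl }
      map_zero' := AddMonoidHom.ext fun f => zero_smul (DiffOpStalk (𝓡∂ (m + 1)) (ι x))ᵐᵒᵖ _
      map_add' := fun D D' => AddMonoidHom.ext fun f => add_smul (op D) (op D') _ }
    fun a D f => by
      have h : ∀ f : FnStalk (𝓡 m) x,
          op (DiffOpStalk.ofFn (𝓡∂ (m + 1)) (ι x) a * D) •
            boundaryGerm hc x (op (DiffOpStalk.ofFn (𝓡 m) x f) • φ) =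
          op D • boundaryGerm hc x (op (DiffOpStalk.ofFn (𝓡 m) x (pullStalk ι x a * f)) • φ) :=
        fun f => by
          rw [op_mul, mul_smul, ha.op_ofFn_smul_boundaryGerm, mul_comm, map_mul, op_mul,
            mul_smul (op _) (op _) φ]
      exact h f

lemma transferPairing_tmul (x : N) (φ : DensityStalk (𝓡 m) x) (f : FnStalk (𝓡 m) x)
    (D : DiffOpStalk (𝓡∂ (m + 1)) (ι x)) :
    ha.transferPairing hc x φ (TransferStalk.tmul ι x f D) =
      op D • boundaryGerm hc x (op (DiffOpStalk.ofFn (𝓡 m) x f) • φ) := rfl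

lemma transferPairing_op_smul (x : N) (φ : DensityStalk (𝓡 m) x)
    (P : DiffOpStalk (𝓡∂ (m + 1)) (ι x)) (t : TransferStalk ι x) :
    ha.transferPairing hc x φ (op P • t) = op P • ha.transferPairing hc x φ t := by
  induction t using TransferStalk.induction_on with
  | h0 => rw [smul_zero, map_zero, smul_zero]
  | ht f D =>
    rw [TransferStalk.op_smul_tmul, transferPairing_tmul, transferPairing_tmul, op_mul, mul_smul]
  | ha t t' h h' => rw [smul_add, map_add, map_add, smul_add, h, h']

lemma transferPairing_add (x : N) (φ ψ : DensityStalk (𝓡 m) x) :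
    ha.transferPairing hc x (φ + ψ) = ha.transferPairing hc x φ + ha.transferPairing hc x ψ := by
  refine AddMonoidHom.ext fun t => ?_
  rw [AddMonoidHom.add_apply]
  induction t using TransferStalk.induction_on with
  | h0 => simp only [map_zero, add_zero]
  | ht f D => simp only [transferPairing_tmul, smul_add, map_add]
  | ha t t' h h' =>
    simp only [map_add, h, h']
    abel

include hb in
lemma transferPairing_partialDeriv_smul {U : Opens M} (b : BoundaryCoordinates ι U) {x : N}
    (hx : x ∈ preim ι U) (i : Fin m) (φ : DensityStalk (𝓡 m) x) (f : FnStalk (𝓡 m) x)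
    (D : DiffOpStalk (𝓡∂ (m + 1)) (ι x)) :
    ha.transferPairing hc x (op (DiffOpStalk.germ (𝓡 m) x hx (b.boundary.partialDeriv i)) • φ)
        (TransferStalk.tmul ι x f D) =
      ha.transferPairing hc x φ (DiffOpStalk.germ (𝓡 m) x hx (b.boundary.partialDeriv i) •
        TransferStalk.tmul ι x f D) := by
  have h1 := (b.boundary.isVectorFieldOp_partialDeriv i).germ_mul_ofFn hx f
  have h2 := ha.op_partialDeriv_smul_boundaryGerm hc b hx i (op (DiffOpStalk.ofFn (𝓡 m) x f) • φ)
  rw [ha.partialDeriv_smul_tmul hb b hx, map_add, transferPairing_tmul, transferPairing_tmul,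
    transferPairing_tmul]
  generalize DiffOpStalk.germ (𝓡 m) x hx (b.boundary.partialDeriv i) = e at *
  generalize DiffOpStalk.germ (𝓡∂ (m + 1)) (ι x) hx (b.ambient.partialDeriv i.succ) = d at *
  rw [op_mul, mul_smul (op D) (op d), h2, ← smul_add, ← map_add, ← mul_smul (op _) (op _) φ,
    ← op_mul, h1, op_add, add_smul, op_mul, mul_smul (op _) (op _) φ]

include hb in
/-- The pairing is balanced over the differential operators of the boundary: it suffices to check
this for functions and coordinate vector fields. -/
lemma transferPairing_smul (x : N) (φ : DensityStalk (𝓡 m) x) (Q : DiffOpStalk (𝓡 m) x)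
    (t : TransferStalk ι x) :
    ha.transferPairing hc x (op Q • φ) t = ha.transferPairing hc x φ (Q • t) := by
  obtain ⟨U, hx, ⟨b⟩⟩ := hb x
  have hQ : Q ∈ Subring.closure _ := b.boundary.closure_stalk_eq_top hx ▸ Subring.mem_top Q
  have hneg : ∀ (φ : DensityStalk (𝓡 m) x), ha.transferPairing hc x (-φ) =
      -ha.transferPairing hc x φ := fun φ =>
    map_neg (AddMonoidHom.mk' (ha.transferPairing hc x) (ha.transferPairing_add hc x)) φ
  have hzero : ha.transferPairing hc x 0 = 0 :=
    map_zero (AddMonoidHom.mk' (ha.transferPairing hc x) (ha.transferPairing_add hc x))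
  induction hQ using Subring.closure_induction generalizing t φ with
  | mem Q hQ =>
    induction t using TransferStalk.induction_on with
    | h0 => rw [smul_zero, map_zero, map_zero]
    | ha t t' h h' => rw [smul_add, map_add, map_add, h, h']
    | ht f D =>
      rcases hQ with ⟨a, rfl⟩ | ⟨i, rfl⟩
      · rw [ha.ofFn_smul_tmul hb, transferPairing_tmul, transferPairing_tmul,
          ← mul_smul (op _) (op _) φ, ← op_mul, ← map_mul]
      · exact ha.transferPairing_partialDeriv_smul hb hc b hx i φ f D
  | zero => rw [op_zero, zero_smul, zero_smul, map_zero, hzero]; rfl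
  | one => rw [op_one, one_smul, one_smul]
  | add Q Q' _ _ h h' =>
    rw [op_add, add_smul, add_smul, map_add, transferPairing_add, AddMonoidHom.add_apply, h, h']
  | neg Q _ h => rw [op_neg, neg_smul, neg_smul, map_neg, hneg, AddMonoidHom.neg_apply, h]
  | mul Q Q' _ _ h h' => rw [op_mul, mul_smul (op _) (op _) φ, ha.mul_smul_transfer hb, h', h]

/-- The map `(f ⊗ D) ⊗ ν ↦ (g ↦ ∫ f (D g)|_N ν)` on germs. -/
def tensorPairing (x : N) : TransferStalk ι x ⊗[ℤ] DensityStalk (𝓡 m) x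
    →ₗ[(DiffOpStalk (𝓡∂ (m + 1)) (ι x))ᵐᵒᵖ] DistStalk (𝓡∂ (m + 1)) (ι x) :=
  let L : TransferStalk ι x ⊗[ℤ] DensityStalk (𝓡 m) x →+ DistStalk (𝓡∂ (m + 1)) (ι x) :=
    TensorProduct.liftAddHom
      (AddMonoidHom.flip (AddMonoidHom.mk' (ha.transferPairing hc x)
        (ha.transferPairing_add hc x)))
      fun n t φ => by
        rw [map_zsmul, map_zsmul, AddMonoidHom.zsmul_apply]
  { toFun := L
    map_add' := map_add L
    map_smul' := fun P z => by
      induction z using TensorProduct.induction_on with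
      | zero => rw [smul_zero, map_zero, RingHom.id_apply, smul_zero]
      | tmul t φ => exact ha.transferPairing_op_smul hc x φ (unop P) t
      | add z z' h h' => rw [smul_add, map_add, map_add, h, h', RingHom.id_apply, smul_add] }

include hb in
lemma balancingRelations_le (x : N) :
    balancingRelations ι x ≤ LinearMap.ker (ha.tensorPairing hc x) :=
  Submodule.span_le.2 <| by
    rintro _ ⟨t, Q, φ, rfl⟩
    rw [SetLike.mem_coe, LinearMap.mem_ker, map_sub, sub_eq_zero]
    exact ha.transferPairing_smul hb hc x φ Q t

/-- The map `ν ⊗ (f ⊗ D) ↦ (g ↦ ∫ f (D g)|_N ν)` on germs. -/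
def toDist (x : N) : PushStalk ι x →ₗ[(DiffOpStalk (𝓡∂ (m + 1)) (ι x))ᵐᵒᵖ]
    DistStalk (𝓡∂ (m + 1)) (ι x) :=
  (balancingRelations ι x).liftQ (ha.tensorPairing hc x) (ha.balancingRelations_le hb hc x)

lemma toDist_tmul (x : N) (φ : DensityStalk (𝓡 m) x) (f : FnStalk (𝓡 m) x)
    (D : DiffOpStalk (𝓡∂ (m + 1)) (ι x)) :
    ha.toDist hb hc x (PushStalk.tmul ι x φ f D) =
      op D • boundaryGerm hc x (op (DiffOpStalk.ofFn (𝓡 m) x f) • φ) := rfl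

end IsOperatorAction

end PushStalk

/-! ### Normal forms in the push-forward -/

section NormalForm

variable {m : ℕ} {M : Type*} [TopologicalSpace M] [ChartedSpace (EuclideanHalfSpace (m + 1)) M]
  [IsManifold (𝓡∂ (m + 1)) ∞ M]
  {N : Type*} [TopologicalSpace N] [ChartedSpace (EuclideanSpace ℝ (Fin m)) N]
  [IsManifold (𝓡 m) ∞ N] [T2Space N] [SigmaCompactSpace N]
  {ι : C^∞⟮𝓡 m, N; 𝓡∂ (m + 1), M⟯}
  [∀ x : N, Module (DiffOpStalk (𝓡 m) x)ᵐᵒᵖ (DensityStalk (𝓡 m) x)]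
  [∀ x : N, Module (DiffOpStalk (𝓡 m) x) (TransferStalk ι x)]

omit [T2Space N] [SigmaCompactSpace N] in
lemma DensityStalk.eq_zero_of_succ_nsmul {x : N} (k : ℕ) (φ : DensityStalk (𝓡 m) x)
    (h : (k + 1) • φ = 0) : φ = 0 := by
  let c : FnStalk (𝓡 m) x := FnStalk.germ (𝓡 m) x (U := ⊤) trivial
    (algebraMap ℝ (SmoothFn (𝓡 m) (⊤ : Opens N)) ((k + 1 : ℕ) : ℝ)⁻¹)
  have hc : ((k + 1 : ℕ) : FnStalk (𝓡 m) x) * c = 1 := by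
    rw [← map_natCast (FnStalk.germ (𝓡 m) x (U := ⊤) trivial) (k + 1), ← map_mul,
      ← map_natCast (algebraMap ℝ (SmoothFn (𝓡 m) (⊤ : Opens N))) (k + 1), ← map_mul,
      mul_inv_cancel₀ (Nat.cast_ne_zero.2 k.succ_ne_zero), map_one, map_one]
  have h1 : op (DiffOpStalk.ofFn (𝓡 m) x (((k + 1 : ℕ) : FnStalk (𝓡 m) x) * c)) • φ = 0 := by
    rw [map_mul, op_mul, mul_smul, map_natCast, op_natCast, Nat.cast_smul_eq_nsmul, h, smul_zero]
  rwa [hc, map_one, op_one, one_smul] at h1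

namespace PushStalk

variable (x : N)

omit [T2Space N] [SigmaCompactSpace N] in
lemma add_tmul (φ ψ : DensityStalk (𝓡 m) x) (f : FnStalk (𝓡 m) x)
    (D : DiffOpStalk (𝓡∂ (m + 1)) (ι x)) :
    tmul ι x (φ + ψ) f D = tmul ι x φ f D + tmul ι x ψ f D :=
  congrArg (Submodule.Quotient.mk (p := balancingRelations ι x)) (TensorProduct.tmul_add _ _ _)

omit [T2Space N] [SigmaCompactSpace N] in
lemma tmul_add (φ : DensityStalk (𝓡 m) x) (f : FnStalk (𝓡 m) x)
    (D D' : DiffOpStalk (𝓡∂ (m + 1)) (ι x)) :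
    tmul ι x φ f (D + D') = tmul ι x φ f D + tmul ι x φ f D' := by
  unfold tmul
  rw [TransferStalk.tmul_add, TensorProduct.add_tmul]
  rfl

omit [T2Space N] [SigmaCompactSpace N] in
lemma tmul_ofFn_mul (φ : DensityStalk (𝓡 m) x) (f : FnStalk (𝓡 m) x)
    (a : FnStalk (𝓡∂ (m + 1)) (ι x)) (D : DiffOpStalk (𝓡∂ (m + 1)) (ι x)) :
    tmul ι x φ f (DiffOpStalk.ofFn (𝓡∂ (m + 1)) (ι x) a * D) =
      tmul ι x φ (pullStalk ι x a * f) D := by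
  unfold tmul
  rw [TransferStalk.tmul_ofFn_mul]

omit [T2Space N] [SigmaCompactSpace N] in
lemma mk_tmul_op_smul (φ : DensityStalk (𝓡 m) x) (Q : DiffOpStalk (𝓡 m) x)
    (t : TransferStalk ι x) :
    Submodule.Quotient.mk (p := balancingRelations ι x) (t ⊗ₜ[ℤ] (op Q • φ)) =
      Submodule.Quotient.mk (p := balancingRelations ι x) ((Q • t) ⊗ₜ[ℤ] φ) :=
  (Submodule.Quotient.eq _).2 (Submodule.subset_span ⟨t, Q, φ, rfl⟩)

omit [T2Space N] [SigmaCompactSpace N] in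
lemma induction_on {p : PushStalk ι x → Prop} (s : PushStalk ι x) (h0 : p 0)
    (ht : ∀ φ f D, p (tmul ι x φ f D)) (hadd : ∀ s s', p s → p s' → p (s + s')) : p s := by
  obtain ⟨z, rfl⟩ := Submodule.Quotient.mk_surjective (balancingRelations ι x) s
  induction z using TensorProduct.induction_on with
  | zero => exact h0
  | add z z' h h' => exact hadd _ _ h h'
  | tmul t φ =>
    induction t using TransferStalk.induction_on with
    | h0 => rw [TensorProduct.zero_tmul]; exact h0
    | ht f D => exact ht φ f D
    | ha t t' h h' => rw [TensorProduct.add_tmul]; exact hadd _ _ h h'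

end PushStalk

/-- The sum `∑ k, ν k ⊗ (1 ⊗ d ^ k)` of germs, where `d` is the normal derivative. -/
def BoundaryCoordinates.normalForm {U : Opens M} (b : BoundaryCoordinates ι U) {x : N}
    (hx : x ∈ preim ι U) : (ℕ →₀ DensityStalk (𝓡 m) x) →+ PushStalk ι x :=
  Finsupp.liftAddHom fun k => AddMonoidHom.mk'
    (fun φ => PushStalk.tmul ι x φ 1 (DiffOpStalk.germ (𝓡∂ (m + 1)) (ι x) hx b.normal ^ k))
    fun φ ψ => PushStalk.add_tmul x φ ψ 1 _

omit [T2Space N] [SigmaCompactSpace N] in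
lemma BoundaryCoordinates.normalForm_single {U : Opens M} (b : BoundaryCoordinates ι U) {x : N}
    (hx : x ∈ preim ι U) (k : ℕ) (φ : DensityStalk (𝓡 m) x) :
    b.normalForm hx (Finsupp.single k φ) =
      PushStalk.tmul ι x φ 1 (DiffOpStalk.germ (𝓡∂ (m + 1)) (ι x) hx b.normal ^ k) :=
  Finsupp.liftAddHom_apply_single _ _ _

omit [IsManifold (𝓡 m) ∞ N] [T2Space N] [SigmaCompactSpace N]
  [(x : N) → Module (DiffOpStalk (𝓡 m) x)ᵐᵒᵖ (DensityStalk (𝓡 m) x)]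
  [(x : N) → Module (DiffOpStalk (𝓡 m) x) (TransferStalk ι x)] in
lemma BoundaryCoordinates.pow_normal_mul_coord {U : Opens M} (b : BoundaryCoordinates ι U) {x : N}
    (hx : x ∈ preim ι U) (k : ℕ) :
    DiffOpStalk.germ (𝓡∂ (m + 1)) (ι x) hx b.normal ^ (k + 1) *
        DiffOpStalk.ofFn (𝓡∂ (m + 1)) (ι x)
          (FnStalk.germ (𝓡∂ (m + 1)) (ι x) hx b.normalCoord) =
      DiffOpStalk.ofFn (𝓡∂ (m + 1)) (ι x) (FnStalk.germ (𝓡∂ (m + 1)) (ι x) hx b.normalCoord) *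
          DiffOpStalk.germ (𝓡∂ (m + 1)) (ι x) hx b.normal ^ (k + 1) +
        ((k + 1 : ℕ) : DiffOpStalk (𝓡∂ (m + 1)) (ι x)) *
          DiffOpStalk.germ (𝓡∂ (m + 1)) (ι x) hx b.normal ^ k := by
  have h := b.ambient.isCoordinateFrame (x := ι x) hx
  have h1 := h.mul_ofFn 0 (FnStalk.germ (𝓡∂ (m + 1)) (ι x) hx (b.ambient.coord 0))
  rw [h.act_coord, if_pos rfl, map_one] at h1
  change DiffOpStalk.germ (𝓡∂ (m + 1)) (ι x) hx b.normal * DiffOpStalk.ofFn (𝓡∂ (m + 1)) (ι x)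
    (FnStalk.germ (𝓡∂ (m + 1)) (ι x) hx b.normalCoord) = DiffOpStalk.ofFn (𝓡∂ (m + 1)) (ι x)
    (FnStalk.germ (𝓡∂ (m + 1)) (ι x) hx b.normalCoord) *
      DiffOpStalk.germ (𝓡∂ (m + 1)) (ι x) hx b.normal + 1 at h1
  generalize DiffOpStalk.germ (𝓡∂ (m + 1)) (ι x) hx b.normal = d at *
  generalize DiffOpStalk.ofFn (𝓡∂ (m + 1)) (ι x)
    (FnStalk.germ (𝓡∂ (m + 1)) (ι x) hx b.normalCoord) = y at *
  induction k with
  | zero => simpa using h1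
  | succ k ih =>
    have hk : d * ((k + 1 : ℕ) : DiffOpStalk (𝓡∂ (m + 1)) (ι x)) = ((k + 1 : ℕ) : _) * d :=
      (Nat.cast_commute (k + 1) d).symm
    rw [pow_succ' d (k + 1), mul_assoc, ih, mul_add, ← mul_assoc, h1, ← mul_assoc, hk, add_mul,
      one_mul, mul_assoc y, mul_assoc _ d, ← pow_succ' d k, add_assoc, Nat.cast_succ (k + 1),
      add_mul, one_mul, add_comm (d ^ (k + 1))]

namespace IsOperatorAction

variable (ha : IsOperatorAction ι) (hb : HasBoundaryCoordinates ι) (hc : IsClosedEmbedding ι)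

include ha hb

lemma op_ofFn_smul_tmul {x : N} (φ : DensityStalk (𝓡 m) x) (a f : FnStalk (𝓡 m) x)
    (D : DiffOpStalk (𝓡∂ (m + 1)) (ι x)) :
    PushStalk.tmul ι x (op (DiffOpStalk.ofFn (𝓡 m) x a) • φ) f D =
      PushStalk.tmul ι x φ (a * f) D := by
  refine (PushStalk.mk_tmul_op_smul x φ _ _).trans ?_
  rw [ha.ofFn_smul_tmul hb]
  rfl

lemma tmul_partialDeriv_mul {U : Opens M} (b : BoundaryCoordinates ι U) {x : N}
    (hx : x ∈ preim ι U) (i : Fin m) (φ : DensityStalk (𝓡 m) x)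
    (D : DiffOpStalk (𝓡∂ (m + 1)) (ι x)) :
    PushStalk.tmul ι x φ 1 (DiffOpStalk.germ (𝓡∂ (m + 1)) (ι x) hx
        (b.ambient.partialDeriv i.succ) * D) =
      PushStalk.tmul ι x
        (op (DiffOpStalk.germ (𝓡 m) x hx (b.boundary.partialDeriv i)) • φ) 1 D := by
  refine Eq.trans ?_ (PushStalk.mk_tmul_op_smul x φ _ _).symm
  have h1 : DiffOpStalk.act x (DiffOpStalk.germ (𝓡 m) x hx (b.boundary.partialDeriv i)) 1 = 0 := by
    have h := (b.boundary.isVectorFieldOp_partialDeriv i).act_mul hx 1 1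
    rw [one_mul, one_mul, mul_one] at h
    exact left_eq_add.1 h
  have h2 : TransferStalk.tmul ι x 0 D = 0 := TensorProduct.tmul_zero _ _
  rw [ha.partialDeriv_smul_tmul hb b hx, h1, h2, add_zero]
  rfl

/-- Every germ of the push-forward is a sum of germs `ν k ⊗ (1 ⊗ d ^ k)`, where `d` is the normal
derivative: tangential derivatives are moved to the densities. -/
lemma normalForm_surjective {U : Opens M} (b : BoundaryCoordinates ι U) {x : N}
    (hx : x ∈ preim ι U) : Function.Surjective (b.normalForm hx) := by
  have h0 : ∀ {φ k}, PushStalk.tmul ι x φ 1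
      (DiffOpStalk.germ (𝓡∂ (m + 1)) (ι x) hx b.normal ^ k) ∈ (b.normalForm hx).range :=
    fun {φ k} => ⟨_, b.normalForm_single hx k φ⟩
  have hcomm : ∀ i k, DiffOpStalk.germ (𝓡∂ (m + 1)) (ι x) hx b.normal ^ k *
      DiffOpStalk.germ (𝓡∂ (m + 1)) (ι x) hx (b.ambient.partialDeriv i) =
      DiffOpStalk.germ (𝓡∂ (m + 1)) (ι x) hx (b.ambient.partialDeriv i) *
        DiffOpStalk.germ (𝓡∂ (m + 1)) (ι x) hx b.normal ^ k := fun i k =>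
    Commute.pow_left ((b.ambient.isCoordinateFrame (x := ι x) hx).comm 0 i) k
  -- it suffices to treat the generators of the range
  have hlift : ∀ P : DiffOpStalk (𝓡∂ (m + 1)) (ι x), (∀ φ k, op P • PushStalk.tmul ι x φ 1
      (DiffOpStalk.germ (𝓡∂ (m + 1)) (ι x) hx b.normal ^ k) ∈ (b.normalForm hx).range) →
      ∀ s ∈ (b.normalForm hx).range, op P • s ∈ (b.normalForm hx).range := by
    rintro P hP _ ⟨F, rfl⟩
    induction F using Finsupp.induction_linear with
    | zero => rw [map_zero, smul_zero]; exact zero_mem _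
    | add F G hF hG => rw [map_add, smul_add]; exact add_mem hF hG
    | single k φ => rw [b.normalForm_single]; exact hP φ k
  have hd : ∀ s ∈ (b.normalForm hx).range, op (DiffOpStalk.germ (𝓡∂ (m + 1)) (ι x) hx b.normal) •
      s ∈ (b.normalForm hx).range := hlift _ fun φ k => by
    rw [PushStalk.op_smul_tmul, ← pow_succ]
    exact h0
  have hfn : ∀ (a : FnStalk (𝓡∂ (m + 1)) (ι x)) (φ : DensityStalk (𝓡 m) x) (k : ℕ),
      op (DiffOpStalk.ofFn (𝓡∂ (m + 1)) (ι x) a) • PushStalk.tmul ι x φ 1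
        (DiffOpStalk.germ (𝓡∂ (m + 1)) (ι x) hx b.normal ^ k) ∈ (b.normalForm hx).range := by
    intro a φ k
    induction k generalizing a with
    | zero =>
      rw [PushStalk.op_smul_tmul, pow_zero, one_mul, ← mul_one (DiffOpStalk.ofFn _ _ _),
        PushStalk.tmul_ofFn_mul, ← ha.op_ofFn_smul_tmul hb,
        ← pow_zero (DiffOpStalk.germ (𝓡∂ (m + 1)) (ι x) hx b.normal)]
      exact h0
    | succ k ih =>
      have h1 := (b.ambient.isCoordinateFrame (x := ι x) hx).mul_ofFn 0 a
      change DiffOpStalk.germ (𝓡∂ (m + 1)) (ι x) hx b.normal * _ = _ *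
        DiffOpStalk.germ (𝓡∂ (m + 1)) (ι x) hx b.normal + _ at h1
      rw [PushStalk.op_smul_tmul, pow_succ, mul_assoc, h1, mul_add, PushStalk.tmul_add,
        ← mul_assoc, ← PushStalk.op_smul_tmul, ← PushStalk.op_smul_tmul,
        ← PushStalk.op_smul_tmul (ι := ι) x φ 1 _ (DiffOpStalk.ofFn _ _ _)]
      exact add_mem (hd _ (ih a)) (ih _)
  have hclosed : ∀ (D : DiffOpStalk (𝓡∂ (m + 1)) (ι x)), ∀ s ∈ (b.normalForm hx).range,
      op D • s ∈ (b.normalForm hx).range := by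
    intro D
    have hD : D ∈ Subring.closure _ :=
      b.ambient.closure_stalk_eq_top (x := ι x) hx ▸ Subring.mem_top D
    induction hD using Subring.closure_induction with
    | mem D hD =>
      rcases hD with ⟨a, rfl⟩ | ⟨i, rfl⟩
      · exact hlift _ (hfn a)
      · refine Fin.cases hd (fun i => ?_) i
        refine hlift _ fun φ k => ?_
        rw [PushStalk.op_smul_tmul, hcomm, ha.tmul_partialDeriv_mul hb]
        exact h0
    | zero => intro s _; rw [op_zero, zero_smul]; exact zero_mem _
    | one => intro s hs; rw [op_one, one_smul]; exact hs
    | add D D' _ _ h h' => intro s hs; rw [op_add, add_smul]; exact add_mem (h s hs) (h' s hs)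
    | neg D _ h => intro s hs; rw [op_neg, neg_smul]; exact neg_mem (h s hs)
    | mul D D' _ _ h h' => intro s hs; rw [op_mul, mul_smul]; exact h' _ (h s hs)
  intro s
  change s ∈ (b.normalForm hx).range
  induction s using PushStalk.induction_on with
  | h0 => exact zero_mem _
  | hadd s s' h h' => exact add_mem h h'
  | ht φ f D =>
    have h1 := hclosed D _ (h0 (φ := op (DiffOpStalk.ofFn (𝓡 m) x f) • φ) (k := 0))
    rwa [PushStalk.op_smul_tmul, pow_zero, one_mul, ha.op_ofFn_smul_tmul hb, mul_one] at h1

omit hb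

/-- Germs of densities are determined by the germ of the distribution
`g ↦ ∑ k, ∫ (d ^ k g)|_N ν k`, where `d` is the normal derivative: the multiplication by the normal
coordinate lowers the order of `d`. -/
lemma eq_zero_of_sum_normal_eq_zero {U : Opens M} (b : BoundaryCoordinates ι U) {x : N}
    (hx : x ∈ preim ι U) [T2Space M] (K : ℕ) (ν : ℕ → DensityStalk (𝓡 m) x)
    (h : ∑ k ∈ Finset.range K, op (DiffOpStalk.germ (𝓡∂ (m + 1)) (ι x) hx b.normal ^ k) •
      boundaryGerm hc x (ν k) = 0) : ∀ k < K, ν k = 0 := by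
  have hy := ha.op_ofFn_smul_boundaryGerm hc x
    (FnStalk.germ (𝓡∂ (m + 1)) (ι x) hx b.normalCoord)
  rw [pullStalk_germ (show ι x ∈ U from hx), b.pullFn_normalCoord, map_zero, map_zero] at hy
  have hd := b.pow_normal_mul_coord hx
  generalize DiffOpStalk.germ (𝓡∂ (m + 1)) (ι x) hx b.normal = d at *
  generalize DiffOpStalk.ofFn (𝓡∂ (m + 1)) (ι x)
    (FnStalk.germ (𝓡∂ (m + 1)) (ι x) hx b.normalCoord) = y at *
  let Y := DistribSMul.toAddMonoidHom (DistStalk (𝓡∂ (m + 1)) (ι x)) (op y)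
  let t : ℕ → DensityStalk (𝓡 m) x →+ DistStalk (𝓡∂ (m + 1)) (ι x) := fun k =>
    (DistribSMul.toAddMonoidHom (DistStalk (𝓡∂ (m + 1)) (ι x)) (op (d ^ k))).comp
      (boundaryGerm hc x)
  have hY : ∀ φ, op y • boundaryGerm hc x φ = 0 := fun φ => by
    rw [hy, op_zero, zero_smul, map_zero]
  have ht0 : ∀ φ, t 0 φ = boundaryGerm hc x φ := fun φ => by
    change op (d ^ 0) • boundaryGerm hc x φ = _
    rw [pow_zero, op_one, one_smul]
  refine eq_zero_of_sum_eq_zero t Y DensityStalk.eq_zero_of_succ_nsmul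
    (fun φ ψ hφ => boundaryGerm_injective hc x ((ht0 φ).symm.trans (hφ.trans (ht0 ψ))))
    (fun φ => (congrArg Y (ht0 φ)).trans (hY φ)) (fun k φ => ?_) K ν h
  change op y • op (d ^ (k + 1)) • boundaryGerm hc x φ = (k + 1) • op (d ^ k) • boundaryGerm hc x φ
  rw [← mul_smul, ← op_mul, hd, op_add, add_smul, op_mul, mul_smul, hY, smul_zero, zero_add,
    ← nsmul_eq_mul, op_smul, smul_assoc]

include hb in
lemma toDist_normalForm {U : Opens M} (b : BoundaryCoordinates ι U) {x : N} (hx : x ∈ preim ι U)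
    (F : ℕ →₀ DensityStalk (𝓡 m) x) : ha.toDist hb hc x (b.normalForm hx F) =
      F.sum fun k φ => op (DiffOpStalk.germ (𝓡∂ (m + 1)) (ι x) hx b.normal ^ k) •
        boundaryGerm hc x φ := by
  refine (map_finsuppSum (ha.toDist hb hc x) F _).trans ?_
  refine Finsupp.sum_congr fun k _ => ?_
  refine (ha.toDist_tmul hb hc x _ _ _).trans ?_
  rw [map_one, op_one, one_smul]

include hb in
lemma toDist_injective [T2Space M] (x : N) : Function.Injective (ha.toDist hb hc x) := by
  obtain ⟨U, hx, ⟨b⟩⟩ := hb x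
  rw [injective_iff_map_eq_zero]
  intro s hs
  obtain ⟨F, rfl⟩ := ha.normalForm_surjective hb b hx s
  obtain ⟨K, hK⟩ := F.support.exists_nat_subset_range
  replace hs := (ha.toDist_normalForm hb hc b hx F).symm.trans hs
  rw [Finsupp.sum_of_support_subset _ hK _ fun k _ => by rw [map_zero, smul_zero]] at hs
  have hF : F = 0 := Finsupp.ext fun k => by
    by_cases hk : k ∈ F.support
    · exact ha.eq_zero_of_sum_normal_eq_zero hc b hx K F hs k (Finset.mem_range.1 (hK hk))
    · exact Finsupp.notMem_support_iff.1 hk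
  rw [hF, map_zero]

end IsOperatorAction

end NormalForm

/-! ### The push-forward as a sheaf of distributions -/

section GeneratedSheaf

variable {E : Type*} [NormedAddCommGroup E] [NormedSpace ℝ E]
  {H : Type*} [TopologicalSpace H] {I : ModelWithCorners ℝ E H}
  {M : Type*} [TopologicalSpace M] [ChartedSpace H M] [IsManifold I ∞ M]

lemma mem_generatedSheaf {S : ∀ U : Opens M, Set (Distribution I U)} {U : Opens M}
    {T : Distribution I U} : T ∈ generatedSheaf I S U ↔
      ∀ F : ∀ U : Opens M, Submodule (DiffOp I U)ᵐᵒᵖ (Distribution I U),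
        IsSubmoduleSheaf I F → (∀ U', S U' ⊆ F U') → T ∈ F U := by
  simp only [generatedSheaf, Submodule.mem_sInf]
  exact ⟨fun h F hF hS => h _ ⟨F, hF, hS, rfl⟩, fun h _ ⟨F, hF, hS, hN⟩ => hN ▸ h F hF hS⟩

lemma isSubmoduleSheaf_generatedSheaf (S : ∀ U : Opens M, Set (Distribution I U)) :
    IsSubmoduleSheaf I (generatedSheaf I S) where
  res_mem h T hT := (generatedSheaf.res I S h ⟨T, hT⟩).2
  mem_of_local T hT := mem_generatedSheaf.2 fun F hF hS => hF.mem_of_local T fun x hx => by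
    obtain ⟨W, h, hxW, hW⟩ := hT x hx
    exact ⟨W, h, hxW, mem_generatedSheaf.1 hW F hF hS⟩

lemma subset_generatedSheaf (S : ∀ U : Opens M, Set (Distribution I U)) (U : Opens M) :
    S U ⊆ generatedSheaf I S U := fun _ hT => mem_generatedSheaf.2 fun _ _ hS => hS U hT

lemma Distribution.eq_of_germ [FiniteDimensional ℝ E] [SigmaCompactSpace M] [T2Space M]
    {U : Opens M} {T T' : Distribution I U}
    (h : ∀ p (hp : p ∈ U), DistStalk.germ p hp T = DistStalk.germ p hp T') : T = T' := by
  refine Distribution.eq_of_local fun p hp => ?_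
  obtain ⟨W, _, _, hpW, hW⟩ := DistStalk.germ_eq (h p hp)
  exact ⟨W, hpW, fun g hg => congrArg (fun T : Distribution I W => T ⟨g.1, g.2.1, hg⟩) hW⟩

end GeneratedSheaf

section Sheaf

variable {m : ℕ} {M : Type*} [TopologicalSpace M] [ChartedSpace (EuclideanHalfSpace (m + 1)) M]
  [IsManifold (𝓡∂ (m + 1)) ∞ M] [T2Space M] [SigmaCompactSpace M]
  {N : Type*} [TopologicalSpace N] [ChartedSpace (EuclideanSpace ℝ (Fin m)) N]
  [IsManifold (𝓡 m) ∞ N] [T2Space N] [SigmaCompactSpace N]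
  {ι : C^∞⟮𝓡 m, N; 𝓡∂ (m + 1), M⟯} (hc : IsClosedEmbedding ι)

omit [T2Space M] [SigmaCompactSpace M] in
/-- The distributions defined by densities on the boundary vanish in the interior. -/
lemma germ_boundaryDistribution_eq_zero {U : Opens M} (ν : Density (𝓡 m) (preim ι U)) {p : M}
    (hp : p ∈ U) (hpι : p ∉ range ι) : DistStalk.germ p hp (boundaryDistribution hc ν) = 0 := by
  let W : Opens M := U ⊓ ⟨(range ι)ᶜ, hc.isClosed_range.isOpen_compl⟩
  have hpW : p ∈ W := ⟨hp, hpι⟩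
  rw [← DistStalk.germ_res (inf_le_left : W ≤ U) hpW, ← DistStalk.germ_zero hpW]
  refine congrArg _ (Distribution.ext fun g => ?_)
  refine Eq.trans (congrArg (ν.integral (𝓡 m)) (funext fun x => ?_)) (Density.integral_zero ν)
  exact image_eq_zero_of_notMem_tsupport (f := g.1) fun h => (g.2.2 h).2 ⟨x, rfl⟩

variable [∀ x : N, Module (DiffOpStalk (𝓡 m) x)ᵐᵒᵖ (DensityStalk (𝓡 m) x)]
  [∀ x : N, Module (DiffOpStalk (𝓡 m) x) (TransferStalk ι x)]

/-- The distribution `T` is the one defined by the family `s` of germs of the push-forward. -/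
structure Represents (ha : IsOperatorAction ι) (hb : HasBoundaryCoordinates ι)
    (hc : IsClosedEmbedding ι) {U : Opens M} (T : Distribution (𝓡∂ (m + 1)) U)
    (s : GermFamily ι U) : Prop where
  germ_eq : ∀ x : preim ι U,
    DistStalk.germ (ι x) (show ι x ∈ U from x.2) T = ha.toDist hb hc x (s x)
  germ_eq_zero : ∀ (p : M) (hp : p ∈ U), p ∉ range ι → DistStalk.germ p hp T = 0

namespace Represents

variable {ha : IsOperatorAction ι} {hb : HasBoundaryCoordinates ι} {hc : IsClosedEmbedding ι}
  {U : Opens M} {T T' : Distribution (𝓡∂ (m + 1)) U} {s s' : GermFamily ι U}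

lemma unique (h : Represents ha hb hc T s) (h' : Represents ha hb hc T' s) : T = T' := by
  refine Distribution.eq_of_germ fun p hp => ?_
  by_cases hpι : p ∈ range ι
  · obtain ⟨x, rfl⟩ := hpι
    exact (h.germ_eq ⟨x, hp⟩).trans (h'.germ_eq ⟨x, hp⟩).symm
  · exact (h.germ_eq_zero p hp hpι).trans (h'.germ_eq_zero p hp hpι).symm

omit [SigmaCompactSpace M]

lemma family_unique (h : Represents ha hb hc T s) (h' : Represents ha hb hc T s') : s = s' :=
  funext fun x => ha.toDist_injective hb hc x ((h.germ_eq x).symm.trans (h'.germ_eq x))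

omit [T2Space M]

lemma zero : Represents ha hb hc (0 : Distribution (𝓡∂ (m + 1)) U) (0 : GermFamily ι U) :=
  ⟨fun x => (DistStalk.germ_zero _).trans (map_zero (ha.toDist hb hc (x : N))).symm,
    fun _ _ _ => DistStalk.germ_zero _⟩

lemma add (h : Represents ha hb hc T s) (h' : Represents ha hb hc T' s') :
    Represents ha hb hc (T + T') (s + s') where
  germ_eq x := by
    rw [GermFamily.add_apply, map_add, ← h.germ_eq, ← h'.germ_eq]
    exact DistStalk.germ_add (show ι x ∈ U from x.2) T T'
  germ_eq_zero p hp hpι := by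
    rw [DistStalk.germ_add, h.germ_eq_zero p hp hpι, h'.germ_eq_zero p hp hpι, add_zero]

lemma smul (P : (DiffOp (𝓡∂ (m + 1)) U)ᵐᵒᵖ) (h : Represents ha hb hc T s) :
    Represents ha hb hc (P • T) (P • s) where
  germ_eq x := by
    rw [GermFamily.smul_apply, map_smul, ← h.germ_eq x]
    exact (DistStalk.op_smul_germ (show ι x ∈ U from x.2) (unop P) T).symm
  germ_eq_zero p hp hpι := by
    refine (DistStalk.op_smul_germ hp (unop P) T).symm.trans ?_
    rw [h.germ_eq_zero p hp hpι, smul_zero]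

lemma neg (h : Represents ha hb hc T s) : Represents ha hb hc (-T) (-s) := by
  have h1 := h.smul (-1)
  rwa [neg_smul, one_smul, neg_smul, one_smul] at h1

lemma res {W : Opens M} (hW : W ≤ U) (h : Represents ha hb hc T s) :
    Represents ha hb hc (Distribution.res (𝓡∂ (m + 1)) hW T) (GermFamily.res ι hW s) where
  germ_eq x := (DistStalk.germ_res hW _ T).trans (h.germ_eq ⟨x, hW x.2⟩)
  germ_eq_zero p hp hpι := (DistStalk.germ_res hW hp T).trans (h.germ_eq_zero p (hW hp) hpι)

/-- A distribution that is represented locally by a family of germs is represented by it. -/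
lemma of_local (h : ∀ p ∈ U, ∃ (W : Opens M) (hW : W ≤ U), p ∈ W ∧
    Represents ha hb hc (Distribution.res (𝓡∂ (m + 1)) hW T) (GermFamily.res ι hW s)) :
    Represents ha hb hc T s where
  germ_eq x := by
    obtain ⟨W, hW, hxW, h⟩ := h (ι x) x.2
    exact (DistStalk.germ_res hW hxW T).symm.trans (h.germ_eq ⟨x, hxW⟩)
  germ_eq_zero p hp hpι := by
    obtain ⟨W, hW, hpW, h⟩ := h p hp
    exact (DistStalk.germ_res hW hpW T).symm.trans (h.germ_eq_zero p hpW hpι)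

lemma tmul (ν : Density (𝓡 m) (preim ι U)) (f : SmoothFn (𝓡 m) (preim ι U))
    (D : DiffOp (𝓡∂ (m + 1)) U) :
    Represents ha hb hc (op D • boundaryDistribution hc (Density.mulFn f ν))
      (GermFamily.tmul ι ν f D) where
  germ_eq x := by
    refine (DistStalk.op_smul_germ (show ι x ∈ U from x.2) _ _).symm.trans ?_
    refine Eq.trans ?_ (ha.toDist_tmul hb hc _ _ _ _).symm
    rw [DiffOpStalk.ofFn_germ, ha.smul_germ _ (IsAdjoint.ofFn f), boundaryGerm_germ]
  germ_eq_zero p hp hpι := by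
    refine (DistStalk.op_smul_germ hp _ _).symm.trans ?_
    rw [germ_boundaryDistribution_eq_zero hc _ hp hpι, smul_zero]

lemma boundaryDistribution (ν : Density (𝓡 m) (preim ι U)) :
    Represents ha hb hc (boundaryDistribution hc ν) (GermFamily.tmul ι ν 1 1) := by
  have h := tmul (ha := ha) (hb := hb) (hc := hc) ν 1 1
  rw [op_one, one_smul] at h
  have h1 : Density.mulFn 1 ν = ν := by
    refine (IsAdjoint.ofFn (ν := ν) 1).unique ?_
    rw [map_one]
    exact IsAdjoint.one
  rwa [h1] at h

end Represents

variable (ha : IsOperatorAction ι) (hb : HasBoundaryCoordinates ι)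

omit [T2Space M] [SigmaCompactSpace M] in
lemma exists_represents_of_mem_tensorSections {U : Opens M} {s : GermFamily ι U}
    (hs : s ∈ tensorSections ι U) :
    ∃ T ∈ generatedSheaf (𝓡∂ (m + 1)) (boundaryDensities ι) U, Represents ha hb hc T s := by
  induction hs using AddSubgroup.closure_induction with
  | mem s hs =>
    obtain ⟨ν, f, D, rfl⟩ := hs
    exact ⟨_, Submodule.smul_mem _ _ (subset_generatedSheaf _ _ (boundaryDistribution_mem hc _)),
      Represents.tmul ν f D⟩
  | zero => exact ⟨0, zero_mem _, Represents.zero⟩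
  | add s s' _ _ h h' =>
    obtain ⟨T, hT, h⟩ := h
    obtain ⟨T', hT', h'⟩ := h'
    exact ⟨T + T', add_mem hT hT', h.add h'⟩
  | neg s _ h =>
    obtain ⟨T, hT, h⟩ := h
    exact ⟨-T, neg_mem hT, h.neg⟩

lemma exists_represents_of_mem_pushforward {U : Opens M} {s : GermFamily ι U}
    (hs : s ∈ pushforward ι U) :
    ∃ T ∈ generatedSheaf (𝓡∂ (m + 1)) (boundaryDensities ι) U, Represents ha hb hc T s := by
  have h1 : ∀ p : U, ∃ (W : Opens M) (hW : W ≤ U), (p : M) ∈ W ∧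
      ∃ T ∈ generatedSheaf (𝓡∂ (m + 1)) (boundaryDensities ι) W,
        Represents ha hb hc T (GermFamily.res ι hW s) := by
    rintro ⟨p, hp⟩
    by_cases hpι : p ∈ range ι
    · obtain ⟨x, rfl⟩ := hpι
      obtain ⟨W, hW, hxW, h⟩ := hs x hp
      exact ⟨W, hW, hxW, exists_represents_of_mem_tensorSections hc ha hb h⟩
    · refine ⟨U ⊓ ⟨(range ι)ᶜ, hc.isClosed_range.isOpen_compl⟩, inf_le_left, ⟨hp, hpι⟩, 0,
        zero_mem _, fun x => absurd ⟨_, rfl⟩ x.2.2, fun _ _ _ => DistStalk.germ_zero _⟩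
  choose W hWU hpW T hT hTs using h1
  obtain ⟨T', hT'⟩ := Distribution.exists_glue W hWU
    (fun p hp => mem_iUnion.2 ⟨⟨p, hp⟩, hpW ⟨p, hp⟩⟩) T fun p q =>
      ((hTs p).res (inf_le_left : W p ⊓ W q ≤ W p)).unique
        ((hTs q).res (inf_le_right : W p ⊓ W q ≤ W q))
  refine ⟨T', (isSubmoduleSheaf_generatedSheaf _).mem_of_local T' fun p hp =>
    ⟨W ⟨p, hp⟩, hWU _, hpW _, ?_⟩, Represents.of_local fun p hp => ⟨W ⟨p, hp⟩, hWU _, hpW _, ?_⟩⟩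
  · rw [hT']
    exact hT _
  · rw [hT']
    exact hTs _

/-- The distributions that are represented by sections of the push-forward. -/
def representedSheaf (U : Opens M) :
    Submodule (DiffOp (𝓡∂ (m + 1)) U)ᵐᵒᵖ (Distribution (𝓡∂ (m + 1)) U) where
  carrier := {T | ∃ s ∈ pushforward ι U, Represents ha hb hc T s}
  zero_mem' := ⟨0, zero_mem _, Represents.zero⟩
  add_mem' := by
    rintro T T' ⟨s, hs, h⟩ ⟨s', hs', h'⟩
    exact ⟨s + s', add_mem hs hs', h.add h'⟩
  smul_mem' := by
    rintro P T ⟨s, hs, h⟩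
    exact ⟨P • s, Submodule.smul_mem _ _ hs, h.smul P⟩

omit [SigmaCompactSpace M] in
lemma isSubmoduleSheaf_representedSheaf :
    IsSubmoduleSheaf (𝓡∂ (m + 1)) (representedSheaf hc ha hb) where
  res_mem := by
    rintro U W hW T ⟨s, hs, h⟩
    exact ⟨GermFamily.res ι hW s, (pushforward.res ι hW ⟨s, hs⟩).2, h.res hW⟩
  mem_of_local := by
    intro U T hT
    choose W hWU hpW s hs hsT using hT
    let s' : GermFamily ι U := fun x => s (ι x) x.2 ⟨x, hpW (ι x) x.2⟩
    -- the local families agree with `s'` because the germs of `T` determine them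
    have h1 : ∀ p hp, GermFamily.res ι (hWU p hp) s' = s p hp := fun p hp => funext fun x =>
      ha.toDist_injective hb hc x <| by
        have hx : ι x ∈ U := hWU p hp x.2
        refine ((hsT (ι x) hx).germ_eq ⟨x, hpW (ι x) hx⟩).symm.trans
          (Eq.trans ?_ ((hsT p hp).germ_eq x))
        exact (DistStalk.germ_res (hWU _ hx) (hpW _ hx) T).trans
          (DistStalk.germ_res (hWU p hp) (show ι x ∈ W p hp from x.2) T).symm
    refine ⟨s', fun x hx => ?_, Represents.of_local fun p hp => ⟨W p hp, hWU p hp, hpW p hp, ?_⟩⟩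
    · obtain ⟨W', hW', hxW', h⟩ := hs (ι x) hx x (hpW (ι x) hx)
      rw [← h1 (ι x) hx] at h
      exact ⟨W', hW'.trans (hWU _ hx), hxW', h⟩
    · rw [h1]
      exact hsT p hp

omit [SigmaCompactSpace M] in
/-- Every section of the generated sheaf is represented by a section of the push-forward. -/
lemma exists_represents_of_mem_generatedSheaf {U : Opens M} {T : Distribution (𝓡∂ (m + 1)) U}
    (hT : T ∈ generatedSheaf (𝓡∂ (m + 1)) (boundaryDensities ι) U) :
    ∃ s ∈ pushforward ι U, Represents ha hb hc T s := by
  refine mem_generatedSheaf.1 hT (representedSheaf hc ha hb)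
    (isSubmoduleSheaf_representedSheaf hc ha hb) fun U' T' hT' => ?_
  obtain ⟨ν, rfl⟩ := exists_eq_boundaryDistribution hc hT'
  exact ⟨_, (pushforward.tmul ι ν 1 1).2, Represents.boundaryDistribution ν⟩

/-- The distribution represented by a section of the push-forward. -/
def pushforward.toGenerated (U : Opens M) : pushforward ι U →ₗ[(DiffOp (𝓡∂ (m + 1)) U)ᵐᵒᵖ]
    generatedSheaf (𝓡∂ (m + 1)) (boundaryDensities ι) U :=
  have h := fun s : pushforward ι U =>
    (exists_represents_of_mem_pushforward hc ha hb s.2).choose_spec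
  { toFun := fun s => ⟨_, (h s).1⟩
    map_add' := fun s s' => Subtype.ext ((h (s + s')).2.unique ((h s).2.add (h s').2))
    map_smul' := fun P s => Subtype.ext ((h (P • s)).2.unique ((h s).2.smul P)) }

lemma pushforward.represents_toGenerated {U : Opens M} (s : pushforward ι U) :
    Represents ha hb hc (pushforward.toGenerated hc ha hb U s).1 s.1 :=
  (exists_represents_of_mem_pushforward hc ha hb s.2).choose_spec.2

lemma pushforward.toGenerated_bijective (U : Opens M) :
    Function.Bijective (pushforward.toGenerated hc ha hb U) := by
  refine ⟨fun s s' h => Subtype.ext ?_, fun T => ?_⟩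
  · have h1 := represents_toGenerated hc ha hb s
    rw [h] at h1
    exact h1.family_unique (represents_toGenerated hc ha hb s')
  · obtain ⟨s, hs, h⟩ := exists_represents_of_mem_generatedSheaf hc ha hb T.2
    exact ⟨⟨s, hs⟩, Subtype.ext ((represents_toGenerated hc ha hb ⟨s, hs⟩).unique h)⟩

end Sheaf

/-! ### Normal derivatives in a collar -/

section Sum

variable {E : Type*} [NormedAddCommGroup E] [NormedSpace ℝ E]
  {H : Type*} [TopologicalSpace H] {I : ModelWithCorners ℝ E H}
  {M : Type*} [TopologicalSpace M] [ChartedSpace H M] [IsManifold I ∞ M]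

lemma Distribution.sum_apply {U : Opens M} {α : Type*} (t : Finset α) (T : α → Distribution I U)
    (g : TestFn I U) : (∑ i ∈ t, T i) g = ∑ i ∈ t, T i g := by
  classical
  induction t using Finset.induction_on with
  | empty => rfl
  | insert a t ha ih =>
    rw [Finset.sum_insert ha, Finset.sum_insert ha, ← ih]
    rfl

lemma DistStalk.germ_sum {U : Opens M} {p : M} (hp : p ∈ U) {α : Type*} (t : Finset α)
    (T : α → Distribution I U) : germ p hp (∑ i ∈ t, T i) = ∑ i ∈ t, germ p hp (T i) := by
  classical
  induction t using Finset.induction_on with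
  | empty => exact germ_zero hp
  | insert a t ha ih => rw [Finset.sum_insert ha, Finset.sum_insert ha, germ_add, ih]

end Sum

section Collar

variable {m : ℕ} {M : Type*} [TopologicalSpace M] [ChartedSpace (EuclideanHalfSpace (m + 1)) M]
  [IsManifold (𝓡∂ (m + 1)) ∞ M]
  {N : Type*} [TopologicalSpace N] [ChartedSpace (EuclideanSpace ℝ (Fin m)) N]
  [IsManifold (𝓡 m) ∞ N]
  {ι : C^∞⟮𝓡 m, N; 𝓡∂ (m + 1), M⟯}

namespace Collar

variable (c : Collar ι) {U : Opens M}

lemma normalDeriv_add (k : ℕ) (g g' : C^∞⟮𝓡∂ (m + 1), M; 𝓘(ℝ, ℝ), ℝ⟯) (z : N) :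
    c.normalDeriv k (g + g' : C^∞⟮𝓡∂ (m + 1), M; 𝓘(ℝ, ℝ), ℝ⟯) z =
      c.normalDeriv k g z + c.normalDeriv k g' z := by
  rw [c.normalDeriv_eq (mem_chartDomain z), c.normalDeriv_eq (mem_chartDomain z),
    c.normalDeriv_eq (mem_chartDomain z)]
  exact DFunLike.congr_fun (map_add (((c.coordinates z).normal ^ k).apply (𝓡∂ (m + 1)))
    (SmoothFn.restrict (c.domain z) g) (SmoothFn.restrict (c.domain z) g')) _

lemma normalDeriv_eq_zero (k : ℕ) {g : C^∞⟮𝓡∂ (m + 1), M; 𝓘(ℝ, ℝ), ℝ⟯} {z : N}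
    (hz : ι z ∉ tsupport g) : c.normalDeriv k g z = 0 := by
  have hz' := c.mem_domain.2 (mem_chartDomain z)
  let W : Opens M := c.domain z ⊓ ⟨(tsupport g)ᶜ, (isClosed_tsupport _).isOpen_compl⟩
  rw [c.normalDeriv_eq (mem_chartDomain z)]
  refine (DiffOp.apply_congr (inf_le_left : W ≤ c.domain z) ((c.coordinates z).normal ^ k)
    (g := 0) (fun y hy => ?_) ⟨ι z, hz', hz⟩).trans ?_
  · exact image_eq_zero_of_notMem_tsupport (f := g) hy.2
  · rw [map_zero]
    rfl

lemma continuous_normalDeriv (k : ℕ) (g : C^∞⟮𝓡∂ (m + 1), M; 𝓘(ℝ, ℝ), ℝ⟯) :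
    Continuous (c.normalDeriv k g) := by
  refine continuous_iff_continuousAt.2 fun z => ?_
  refine ContinuousOn.continuousAt (s := chartDomain m z) ?_
    ((chartDomain m z).isOpen.mem_nhds (mem_chartDomain z))
  rw [continuousOn_iff_continuous_domRestrict]
  have h : Set.domRestrict (chartDomain m z : Set N) (c.normalDeriv k g) =
      fun y : (chartDomain m z : Set N) =>
      ((c.coordinates z).normal ^ k).apply (𝓡∂ (m + 1)) (SmoothFn.restrict (c.domain z) g)
        ⟨ι y, c.mem_domain.2 y.2⟩ := funext fun y => c.normalDeriv_eq y.2 k g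
  rw [h]
  exact (ContMDiffMap.contMDiff _).continuous.comp
    ((ι.contMDiff.continuous.comp continuous_subtype_val).subtype_mk _)

lemma isCompactlySupportedIn_normalDeriv (hc : IsClosedEmbedding ι) (k : ℕ)
    (g : TestFn (𝓡∂ (m + 1)) U) : IsCompactlySupportedIn (preim ι U) (c.normalDeriv k g.1) := by
  have h : tsupport (c.normalDeriv k g.1) ⊆ ι ⁻¹' tsupport g.1 := by
    refine closure_minimal (fun z hz => ?_) ((isClosed_tsupport _).preimage hc.continuous)
    by_contra h
    exact hz (c.normalDeriv_eq_zero k h)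
  exact ⟨c.continuous_normalDeriv k g.1, (hc.isCompact_preimage g.2.1.isCompact).of_isClosed_subset
    (isClosed_tsupport _) h, h.trans (preimage_mono g.2.2)⟩

lemma normal_pow_smul_apply {j : N} {W : Opens M} (hW : W ≤ c.domain j) (k : ℕ)
    (g : TestFn (𝓡∂ (m + 1)) W) {z : N} (hz : z ∈ preim ι W) :
    (DiffOp.res (𝓡∂ (m + 1)) hW (c.coordinates j).normal ^ k • g : TestFn (𝓡∂ (m + 1)) W).1 (ι z) =
      c.normalDeriv k g.1 z := by
  rw [c.normalDeriv_eq (c.mem_domain.1 (hW hz)), ← map_pow]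
  refine (TestFn.smul_apply _ g ⟨ι z, hz⟩).trans ?_
  exact DFunLike.congr_fun (DiffOp.apply_res hW ((c.coordinates j).normal ^ k)
    (SmoothFn.restrict (c.domain j) g.1)) ⟨ι z, hz⟩

end Collar

variable [T2Space N] [SigmaCompactSpace N] (hc : IsClosedEmbedding ι)

/-- The distribution `g ↦ ∑ k < K, ∫ (d ^ k g)|_N ν k` on `W`, where `d` is the normal
derivative. -/
def BoundaryCoordinates.normalSum {V W : Opens M} (b : BoundaryCoordinates ι V) (hW : W ≤ V)
    (K : ℕ) (ν : ℕ → Density (𝓡 m) (preim ι W)) : Distribution (𝓡∂ (m + 1)) W :=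
  ∑ k ∈ Finset.range K, op (DiffOp.res (𝓡∂ (m + 1)) hW b.normal ^ k) •
    boundaryDistribution hc (ν k)

lemma BoundaryCoordinates.normalSum_mem {V W : Opens M} (b : BoundaryCoordinates ι V) (hW : W ≤ V)
    (K : ℕ) (ν : ℕ → Density (𝓡 m) (preim ι W)) :
    b.normalSum hc hW K ν ∈ generatedSheaf (𝓡∂ (m + 1)) (boundaryDensities ι) W :=
  sum_mem fun _ _ => Submodule.smul_mem _ _
    (subset_generatedSheaf _ _ (boundaryDistribution_mem hc _))

lemma BoundaryCoordinates.germ_normalSum {V W : Opens M} (b : BoundaryCoordinates ι V)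
    (hW : W ≤ V) (K : ℕ) (ν : ℕ → Density (𝓡 m) (preim ι W)) {x : N} (hx : x ∈ preim ι W) :
    DistStalk.germ (ι x) (show ι x ∈ W from hx) (b.normalSum hc hW K ν) =
      ∑ k ∈ Finset.range K, op (DiffOpStalk.germ (𝓡∂ (m + 1)) (ι x) (hW hx) b.normal ^ k) •
        boundaryGerm hc x (DensityStalk.germ (𝓡 m) x hx (ν k)) := by
  refine (DistStalk.germ_sum _ _ _).trans (Finset.sum_congr rfl fun k _ => ?_)
  refine (DistStalk.op_smul_germ _ _ _).symm.trans ?_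
  rw [boundaryGerm_germ, map_pow, DiffOpStalk.germ_res]

lemma BoundaryCoordinates.res_normalSum {V W W' : Opens M} (b : BoundaryCoordinates ι V)
    (hW : W ≤ V) (hW' : W' ≤ W) (K : ℕ) (ν : ℕ → Density (𝓡 m) (preim ι W)) :
    Distribution.res (𝓡∂ (m + 1)) hW' (b.normalSum hc hW K ν) =
      b.normalSum hc (hW'.trans hW) K fun k =>
        Density.res (𝓡 m) (show preim ι W' ≤ preim ι W from fun _ hx => hW' hx) (ν k) := by
  refine (map_sum (Distribution.res (𝓡∂ (m + 1)) hW') _ _).trans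
    (Finset.sum_congr rfl fun k _ => ?_)
  rw [← res_boundaryDistribution hc hW']
  refine Distribution.ext fun g => ?_
  have h := TestFn.smul_incl (𝓡∂ (m + 1)) hW' (DiffOp.res (𝓡∂ (m + 1)) hW b.normal ^ k) g
  rw [map_pow] at h
  exact congrArg (boundaryDistribution hc (ν k)).1 h

lemma Collar.normalSum_apply (c : Collar ι) {j : N} {W : Opens M} (hW : W ≤ c.domain j) (K : ℕ)
    (ν : ℕ → Density (𝓡 m) (preim ι W)) (g : TestFn (𝓡∂ (m + 1)) W) :
    (c.coordinates j).normalSum hc hW K ν g =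
      ∑ k ∈ Finset.range K, (ν k).integral (𝓡 m) (c.normalDeriv k g.1) := by
  refine (Distribution.sum_apply _ _ _).trans (Finset.sum_congr rfl fun k _ => ?_)
  refine Density.integral_congr (ν k) (ν k) fun i x => ?_
  by_cases hx : x ∈ preim ι W
  · exact congrArg (· * (ν k).1 i x) (c.normal_pow_smul_apply hW k g hx)
  · rw [(ν k).2.1 i x fun h => hx h.1, mul_zero, mul_zero]

variable [∀ x : N, Module (DiffOpStalk (𝓡 m) x)ᵐᵒᵖ (DensityStalk (𝓡 m) x)]
  [∀ x : N, Module (DiffOpStalk (𝓡 m) x) (TransferStalk ι x)]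

namespace IsOperatorAction

variable (ha : IsOperatorAction ι) (hb : HasBoundaryCoordinates ι)

include ha

/-- The densities in a sum of normal derivatives are determined at each point by the germ of the
sum. -/
lemma eq_of_germ_normalSum_eq [T2Space M] {V W W' : Opens M} (b : BoundaryCoordinates ι V)
    (hW : W ≤ V) (hW' : W' ≤ V) {K : ℕ} {ν : ℕ → Density (𝓡 m) (preim ι W)}
    {ν' : ℕ → Density (𝓡 m) (preim ι W')} {x : N} (hx : x ∈ preim ι W) (hx' : x ∈ preim ι W')
    (h : DistStalk.germ (ι x) (show ι x ∈ W from hx) (b.normalSum hc hW K ν) =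
      DistStalk.germ (ι x) (show ι x ∈ W' from hx') (b.normalSum hc hW' K ν')) {k : ℕ}
    (hk : k < K) (i : N) : (ν k).1 i x = (ν' k).1 i x := by
  rw [b.germ_normalSum hc hW K ν hx, b.germ_normalSum hc hW' K ν' hx'] at h
  have h1 := ha.eq_zero_of_sum_normal_eq_zero hc b (show x ∈ preim ι V from hW hx) K
    (fun k => DensityStalk.germ (𝓡 m) x hx (ν k) - DensityStalk.germ (𝓡 m) x hx' (ν' k))
    (by
      simp only [map_sub, smul_sub, Finset.sum_sub_distrib]
      exact sub_eq_zero.2 h) k hk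
  obtain ⟨W₁, h₁, h₂, hxW, h3⟩ := DensityStalk.germ_eq (sub_eq_zero.1 h1)
  have h4 := congrArg (fun ν : Density (𝓡 m) W₁ => ν.1 i x) h3
  exact (Density.res_apply h₁ _ i hxW).symm.trans (h4.trans (Density.res_apply h₂ _ i hxW))

include hb in
/-- Near every point of the boundary, a section of the generated sheaf is a sum of normal
derivatives. -/
lemma exists_eq_normalSum [T2Space M] {U V : Opens M} {T : Distribution (𝓡∂ (m + 1)) U}
    (hT : T ∈ generatedSheaf (𝓡∂ (m + 1)) (boundaryDensities ι) U)
    (b : BoundaryCoordinates ι V) {x : N} (hxU : x ∈ preim ι U) (hxV : x ∈ preim ι V) :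
    ∃ (W : Opens M) (hWU : W ≤ U) (hWV : W ≤ V) (_ : x ∈ preim ι W) (K : ℕ)
      (ν : ℕ → Density (𝓡 m) (preim ι W)), (∀ k ≥ K, ν k = 0) ∧
        Distribution.res (𝓡∂ (m + 1)) hWU T = b.normalSum hc hWV K ν := by
  obtain ⟨s, -, hs⟩ := exists_represents_of_mem_generatedSheaf hc ha hb hT
  obtain ⟨F, hF⟩ := ha.normalForm_surjective hb b hxV (s ⟨x, hxU⟩)
  obtain ⟨K, hK⟩ := F.support.exists_nat_subset_range
  -- finitely many germs are defined on a common neighborhood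
  have h1 : ∀ K : ℕ, ∃ (W : Opens M) (_ : W ≤ U ⊓ V) (hx : x ∈ preim ι W)
      (ν : ℕ → Density (𝓡 m) (preim ι W)), ∀ k < K, DensityStalk.germ (𝓡 m) x hx (ν k) = F k := by
    intro K
    induction K with
    | zero => exact ⟨U ⊓ V, le_rfl, ⟨hxU, hxV⟩, 0, fun k hk => absurd hk k.not_lt_zero⟩
    | succ K ih =>
      obtain ⟨W, hW, hx, ν, hν⟩ := ih
      obtain ⟨W', hx', ν', hW', h⟩ := (F K).exists_preim_germ hc (show ι x ∈ W from hx)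
      have hW'' : preim ι W' ≤ preim ι W := fun _ hy => hW' hy
      refine ⟨W', hW'.trans hW, hx', fun k => if k < K then Density.res (𝓡 m) hW'' (ν k) else ν',
        fun k hk => ?_⟩
      beta_reduce
      split_ifs with hk'
      · exact (DensityStalk.germ_res (𝓡 m) hW'' x hx' _).trans (hν k hk')
      · rw [h, Nat.eq_of_lt_succ_of_not_lt hk hk']
  obtain ⟨W, hW, hx, ν, hν⟩ := h1 K
  have h2 : DistStalk.germ (ι x) (show ι x ∈ U from hxU) T =
      DistStalk.germ (ι x) (show ι x ∈ W from hx) (b.normalSum hc (hW.trans inf_le_right) K ν) := by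
    rw [b.germ_normalSum hc _ K ν hx, hs.germ_eq ⟨x, hxU⟩, ← hF, ha.toDist_normalForm hb hc,
      Finsupp.sum_of_support_subset _ hK _ fun k _ => by rw [map_zero, smul_zero]]
    exact Finset.sum_congr rfl fun k hk => by rw [hν k (Finset.mem_range.1 hk)]
  obtain ⟨W', h₁, h₂, hxW', h3⟩ := DistStalk.germ_eq h2
  have h₂' : preim ι W' ≤ preim ι W := fun _ hy => h₂ hy
  refine ⟨W', h₁, h₂.trans (hW.trans inf_le_right), hxW', K,
    fun k => if k < K then Density.res (𝓡 m) h₂' (ν k) else 0, fun k hk => if_neg hk.not_gt, ?_⟩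
  rw [h3, b.res_normalSum]
  refine Finset.sum_congr rfl fun k hk => ?_
  beta_reduce
  rw [if_pos (Finset.mem_range.1 hk)]

end IsOperatorAction

end Collar

/-! ### Sums of normal derivatives -/

section CollarSum

variable {m : ℕ} {M : Type*} [TopologicalSpace M] [ChartedSpace (EuclideanHalfSpace (m + 1)) M]
  [IsManifold (𝓡∂ (m + 1)) ∞ M]
  {N : Type*} [TopologicalSpace N] [ChartedSpace (EuclideanSpace ℝ (Fin m)) N]
  [IsManifold (𝓡 m) ∞ N]
  {ι : C^∞⟮𝓡 m, N; 𝓡∂ (m + 1), M⟯}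

lemma IsLocallyFinite.exists_forall_eq_zero {V : Opens N} {ν : ℕ → Density (𝓡 m) V}
    (hν : IsLocallyFinite ν) {K : Set N} (hK : IsCompact K) (hKV : K ⊆ V) :
    ∃ n : ℕ, ∀ k ≥ n, ∀ i, ∀ y ∈ K, (ν k).1 i y = 0 := by
  refine hK.induction_on (p := fun S => ∃ n : ℕ, ∀ k ≥ n, ∀ i, ∀ y ∈ S, (ν k).1 i y = 0)
    ⟨0, fun _ _ _ _ hy => absurd hy (notMem_empty _)⟩ ?_ ?_ fun x hx => ?_
  · rintro S S' hS ⟨n, hn⟩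
    exact ⟨n, fun k hk i y hy => hn k hk i y (hS hy)⟩
  · rintro S S' ⟨n, hn⟩ ⟨n', hn'⟩
    refine ⟨max n n', fun k hk i y hy => hy.elim (fun h => ?_) fun h => ?_⟩
    · exact hn k ((le_max_left _ _).trans hk) i y h
    · exact hn' k ((le_max_right _ _).trans hk) i y h
  · obtain ⟨W, hxW, n, hn⟩ := hν x (hKV hx)
    exact ⟨W, mem_nhdsWithin_of_mem_nhds (W.isOpen.mem_nhds hxW), n, hn⟩

variable [T2Space N] [SigmaCompactSpace N] (hc : IsClosedEmbedding ι) (c : Collar ι) {U : Opens M}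

lemma Collar.integral_normalDeriv_eq_zero {ν : Density (𝓡 m) (preim ι U)} (k : ℕ)
    (g : TestFn (𝓡∂ (m + 1)) U) (h : ∀ y, ι y ∈ tsupport g.1 → ∀ i, ν.1 i y = 0) :
    ν.integral (𝓡 m) (c.normalDeriv k g.1) = 0 := by
  refine (Density.integral_congr ν ν (g' := fun _ => 0) fun i y => ?_).trans
    (Density.integral_zero ν)
  by_cases hy : ι y ∈ tsupport g.1
  · rw [h y hy i, mul_zero, mul_zero]
  · rw [c.normalDeriv_eq_zero k hy]

lemma Collar.finsum_integral_eq_sum {ν : ℕ → Density (𝓡 m) (preim ι U)} {K : ℕ}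
    (g : TestFn (𝓡∂ (m + 1)) U)
    (h : ∀ k ≥ K, ∀ y, ι y ∈ tsupport g.1 → ∀ i, (ν k).1 i y = 0) :
    ∑ᶠ k, (ν k).integral (𝓡 m) (c.normalDeriv k g.1) =
      ∑ k ∈ Finset.range K, (ν k).integral (𝓡 m) (c.normalDeriv k g.1) := by
  refine finsum_eq_sum_of_support_subset _ fun k hk => ?_
  rw [Finset.coe_range, mem_Iio]
  by_contra hkK
  exact hk (c.integral_normalDeriv_eq_zero k g (h k (not_lt.1 hkK)))

include hc in
lemma IsLocallyFinite.finsum_integral_add {ν : ℕ → Density (𝓡 m) (preim ι U)}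
    (hν : IsLocallyFinite ν) (g g' : TestFn (𝓡∂ (m + 1)) U) :
    ∑ᶠ k, (ν k).integral (𝓡 m) (c.normalDeriv k (g + g').1) =
      ∑ᶠ k, (ν k).integral (𝓡 m) (c.normalDeriv k g.1) +
        ∑ᶠ k, (ν k).integral (𝓡 m) (c.normalDeriv k g'.1) := by
  have h1 : ∀ g : TestFn (𝓡∂ (m + 1)) U, ∃ K : ℕ, ∀ k ≥ K, ∀ y, ι y ∈ tsupport g.1 →
      ∀ i, (ν k).1 i y = 0 := fun g => by
    obtain ⟨K, hK⟩ := hν.exists_forall_eq_zero (hc.isCompact_preimage g.2.1.isCompact)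
      (preimage_mono g.2.2)
    exact ⟨K, fun k hk y hy i => hK k hk i y hy⟩
  obtain ⟨K, hK⟩ := h1 g
  obtain ⟨K', hK'⟩ := h1 g'
  have h2 : ∀ (g : TestFn (𝓡∂ (m + 1)) U) K, (∀ k ≥ K, ∀ y, ι y ∈ tsupport g.1 →
      ∀ i, (ν k).1 i y = 0) →
      (Function.support fun k => (ν k).integral (𝓡 m) (c.normalDeriv k g.1)).Finite :=
    fun g K h => (Finset.range K).finite_toSet.subset fun k hk => by
      rw [Finset.coe_range, mem_Iio]
      by_contra hkK
      exact hk (c.integral_normalDeriv_eq_zero k g (h k (not_lt.1 hkK)))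
  rw [← finsum_add_distrib (h2 g K hK) (h2 g' K' hK')]
  refine finsum_congr fun k => ?_
  rw [← Density.integral_add (ν k) (c.isCompactlySupportedIn_normalDeriv hc k g)
    (c.isCompactlySupportedIn_normalDeriv hc k g')]
  exact congrArg _ (funext fun z => c.normalDeriv_add k g.1 g'.1 z)

omit [IsManifold (𝓡∂ (m + 1)) ∞ M] [IsManifold (𝓡 m) ∞ N] [T2Space N] [SigmaCompactSpace N] in
lemma Collar.exists_le_domain {V : Opens N} {x : N} (hx : x ∈ preim ι U) (hxV : x ∈ V)
    (hc : IsClosedEmbedding ι) :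
    ∃ W : Opens M, W ≤ U ∧ W ≤ c.domain x ∧ preim ι W ≤ V ∧ ι x ∈ W := by
  obtain ⟨V', rfl⟩ := exists_preim_eq hc V
  exact ⟨U ⊓ (c.domain x ⊓ V'), inf_le_left, inf_le_right.trans inf_le_left,
    fun y hy => hy.2.2, hx, c.mem_domain.2 (mem_chartDomain x), hxV⟩

/-- A locally finite sum of normal derivatives of densities is a section of the generated sheaf. -/
lemma IsLocallyFinite.mem_generatedSheaf {ν : ℕ → Density (𝓡 m) (preim ι U)}
    (hc : IsClosedEmbedding ι) (hν : IsLocallyFinite ν) {T : Distribution (𝓡∂ (m + 1)) U}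
    (hT : ∀ g : TestFn (𝓡∂ (m + 1)) U,
      T g = ∑ᶠ k, (ν k).integral (𝓡 m) (c.normalDeriv k g.1)) :
    T ∈ generatedSheaf (𝓡∂ (m + 1)) (boundaryDensities ι) U := by
  refine (isSubmoduleSheaf_generatedSheaf _).mem_of_local T fun p hp => ?_
  -- near a boundary point the sum is finite, and away from the boundary `T` vanishes
  by_cases hpι : p ∈ range ι
  · obtain ⟨x, rfl⟩ := hpι
    obtain ⟨V, hxV, K, hK⟩ := hν x hp
    obtain ⟨W, hWU, hWc, hWV, hxW⟩ := c.exists_le_domain (show x ∈ preim ι U from hp) hxV hc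
    have hW' : preim ι W ≤ preim ι U := fun _ hy => hWU hy
    refine ⟨W, hWU, hxW, ?_⟩
    have h1 : Distribution.res (𝓡∂ (m + 1)) hWU T = (c.coordinates x).normalSum hc hWc K
        fun k => Density.res (𝓡 m) hW' (ν k) := Distribution.ext fun g => by
      rw [c.normalSum_apply]
      refine (hT (TestFn.incl (𝓡∂ (m + 1)) hWU g)).trans ?_
      refine (c.finsum_integral_eq_sum (K := K) _ fun k hk y hy i => ?_).trans
        (Finset.sum_congr rfl fun k _ => ?_)
      · exact hK k hk i y (hWV (g.2.2 hy))
      · exact (Density.integral_res hW' (ν k) fun z hz =>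
          (c.isCompactlySupportedIn_normalDeriv hc k g).eq_zero hz).symm
    rw [h1]
    exact BoundaryCoordinates.normalSum_mem hc _ _ _ _
  · refine ⟨U ⊓ ⟨(range ι)ᶜ, hc.isClosed_range.isOpen_compl⟩, inf_le_left, ⟨hp, hpι⟩, ?_⟩
    have h1 : Distribution.res (𝓡∂ (m + 1)) (inf_le_left :
        U ⊓ ⟨(range ι)ᶜ, hc.isClosed_range.isOpen_compl⟩ ≤ U) T = 0 :=
      Distribution.ext fun g => (hT (TestFn.incl (𝓡∂ (m + 1)) inf_le_left g)).trans <|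
        finsum_eq_zero_of_forall_eq_zero fun k => c.integral_normalDeriv_eq_zero k _
          fun y hy => absurd ⟨y, rfl⟩ (g.2.2 hy).2
    rw [h1]
    exact zero_mem _

variable [T2Space M] [SigmaCompactSpace M]
  [∀ x : N, Module (DiffOpStalk (𝓡 m) x)ᵐᵒᵖ (DensityStalk (𝓡 m) x)]
  [∀ x : N, Module (DiffOpStalk (𝓡 m) x) (TransferStalk ι x)]

/-- Every section of the generated sheaf is a locally finite sum of normal derivatives of densities:
the local densities are unique, hence they glue. -/
lemma IsOperatorAction.exists_isLocallyFinite (ha : IsOperatorAction ι)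
    (hb : HasBoundaryCoordinates ι) (hc : IsClosedEmbedding ι) {T : Distribution (𝓡∂ (m + 1)) U}
    (hT : T ∈ generatedSheaf (𝓡∂ (m + 1)) (boundaryDensities ι) U) :
    ∃ ν : ℕ → Density (𝓡 m) (preim ι U), IsLocallyFinite ν ∧ ∀ g : TestFn (𝓡∂ (m + 1)) U,
      T g = ∑ᶠ k, (ν k).integral (𝓡 m) (c.normalDeriv k g.1) := by
  have h1 := fun x : preim ι U => ha.exists_eq_normalSum hc hb hT (c.coordinates (x : N)) x.2
    (c.mem_domain.2 (mem_chartDomain (x : N)))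
  choose W hWU hWc hxW K ν hν hTν using h1
  have happly : ∀ (x : preim ι U) (g : TestFn (𝓡∂ (m + 1)) (W x)) (L : ℕ), K x ≤ L →
      T (TestFn.incl (𝓡∂ (m + 1)) (hWU x) g) =
        ∑ k ∈ Finset.range L, (ν x k).integral (𝓡 m) (c.normalDeriv k g.1) := fun x g L hL => by
    refine (congrArg (fun T : Distribution (𝓡∂ (m + 1)) (W x) => T g) (hTν x)).trans ?_
    refine (c.normalSum_apply hc _ _ _ _).trans
      (Finset.sum_subset (Finset.range_subset_range.2 hL) fun k _ hk => ?_)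
    rw [hν x k (not_lt.1 fun h => hk (Finset.mem_range.2 h))]
    exact Density.zero_integral _
  -- the local densities agree on the overlaps
  have hagree : ∀ (x y : preim ι U) (z : N), z ∈ preim ι (W x) → z ∈ preim ι (W y) →
      ∀ k i, (ν x k).1 i z = (ν y k).1 i z := fun x y z hzx hzy k i => by
    let V : Opens M := W x ⊓ (W y ⊓ c.domain z)
    have hVx : V ≤ W x := inf_le_left
    have hVy : V ≤ W y := inf_le_right.trans inf_le_left
    have hVc : V ≤ c.domain z := inf_le_right.trans inf_le_right
    have hzV : z ∈ preim ι V := ⟨hzx, hzy, c.mem_domain.2 (mem_chartDomain z)⟩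
    have hVx' : preim ι V ≤ preim ι (W x) := fun _ h => hVx h
    have hVy' : preim ι V ≤ preim ι (W y) := fun _ h => hVy h
    let L : ℕ := max (k + 1) (max (K x) (K y))
    have h2 : (c.coordinates z).normalSum hc hVc L (fun k => Density.res (𝓡 m) hVx' (ν x k)) =
        (c.coordinates z).normalSum hc hVc L (fun k => Density.res (𝓡 m) hVy' (ν y k)) :=
      Distribution.ext fun g => by
        have hx := happly x (TestFn.incl _ hVx g) L ((le_max_left _ _).trans (le_max_right _ _))
        have hy := happly y (TestFn.incl _ hVy g) L ((le_max_right _ _).trans (le_max_right _ _))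
        rw [c.normalSum_apply, c.normalSum_apply]
        refine (Finset.sum_congr rfl fun k _ => ?_).trans ((hx.symm.trans hy).trans
          (Finset.sum_congr rfl fun k _ => ?_))
        · exact Density.integral_res hVx' (ν x k) fun z hz =>
            (c.isCompactlySupportedIn_normalDeriv hc k g).eq_zero hz
        · exact (Density.integral_res hVy' (ν y k) fun z hz =>
            (c.isCompactlySupportedIn_normalDeriv hc k g).eq_zero hz).symm
    have h3 := ha.eq_of_germ_normalSum_eq hc (c.coordinates z) hVc hVc hzV hzV
      (congrArg (DistStalk.germ (ι z) hzV) h2) (k := k)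
      ((Nat.lt_succ_self k).trans_le (le_max_left _ _)) i
    exact (Density.res_apply hVx' _ i hzV).symm.trans (h3.trans (Density.res_apply hVy' _ i hzV))
  have hW' : ∀ x, preim ι (W x) ≤ preim ι U := fun x _ hy => hWU x hy
  have hglue := fun k => Density.exists_glue (fun x => preim ι (W x)) hW'
    (fun x hx => mem_iUnion.2 ⟨⟨x, hx⟩, hxW ⟨x, hx⟩⟩) (fun x => ν x k) fun x y =>
      Density.ext_diag fun z hz => by
        rw [Density.res_apply inf_le_left _ z hz, Density.res_apply inf_le_right _ z hz]
        exact hagree x y z hz.1 hz.2 k z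
  choose ν' hν' using hglue
  have hνν' : ∀ (x : preim ι U) (k : ℕ) (i z : N), z ∈ preim ι (W x) →
      (ν' k).1 i z = (ν x k).1 i z := fun x k i z hz => by
    rw [← hν' k x, Density.res_apply (hW' x) _ i hz]
  have hzero : ∀ (x : preim ι U), ∀ k ≥ K x, ∀ i, ∀ z ∈ preim ι (W x), (ν' k).1 i z = 0 :=
    fun x k hk i z hz => by
      rw [hνν' x k i z hz, hν x k hk]
      rfl
  have hfin : IsLocallyFinite ν' := fun x hx =>
    ⟨preim ι (W ⟨x, hx⟩), hxW _, K ⟨x, hx⟩, hzero ⟨x, hx⟩⟩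
  -- both sides are additive in `g`, hence it suffices to treat `g` with small support
  refine ⟨ν', hfin, TestFn.functional_ext (fun g => T g)
    (fun g => ∑ᶠ k, (ν' k).integral (𝓡 m) (c.normalDeriv k g.1)) (map_zero T.1) ?_ T.map_add
    (hfin.finsum_integral_add hc c) fun p hp => ?_⟩
  · refine finsum_eq_zero_of_forall_eq_zero fun k => c.integral_normalDeriv_eq_zero k _
      fun y hy => absurd hy ?_
    exact fun h => (tsupport_eq_empty_iff.2 (rfl : ((0 : TestFn (𝓡∂ (m + 1)) U).1 : M → ℝ) = 0)
      ▸ h : ι y ∈ (∅ : Set M))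
  · by_cases hpι : p ∈ range ι
    · obtain ⟨x, rfl⟩ := hpι
      refine ⟨W ⟨x, hp⟩, hxW ⟨x, hp⟩, fun g hg => ?_⟩
      let g' : TestFn (𝓡∂ (m + 1)) (W ⟨x, hp⟩) := ⟨g.1, g.2.1, hg⟩
      refine (happly ⟨x, hp⟩ g' _ le_rfl).trans ?_
      refine Eq.trans (Finset.sum_congr rfl fun k _ => ?_)
        (c.finsum_integral_eq_sum (K := K ⟨x, hp⟩) g fun k hk y hy i =>
          hzero ⟨x, hp⟩ k hk i y (hg hy)).symm
      rw [← hν' k ⟨x, hp⟩]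
      exact Density.integral_res _ (ν' k) fun z hz =>
        (c.isCompactlySupportedIn_normalDeriv hc k g').eq_zero hz
    · obtain ⟨s, -, hs⟩ := exists_represents_of_mem_generatedSheaf hc ha hb hT
      obtain ⟨V, hVU, _, hpV, hV⟩ := DistStalk.germ_eq
        ((hs.germ_eq_zero p hp hpι).trans (DistStalk.germ_zero hp).symm)
      refine ⟨V ⊓ ⟨(range ι)ᶜ, hc.isClosed_range.isOpen_compl⟩, ⟨hpV, hpι⟩, fun g hg => ?_⟩
      let g' : TestFn (𝓡∂ (m + 1)) V := ⟨g.1, g.2.1, hg.trans inter_subset_left⟩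
      refine (congrArg (fun T : Distribution (𝓡∂ (m + 1)) V => T g') hV).trans ?_
      exact (finsum_eq_zero_of_forall_eq_zero fun k => c.integral_normalDeriv_eq_zero k g
        fun y hy => absurd ⟨y, rfl⟩ (hg hy).2).symm

end CollarSum

end BoundaryDensities

end

theorem mainTheorem12 {m : ℕ}
    {M : Type*} [TopologicalSpace M] [ChartedSpace (EuclideanHalfSpace (m + 1)) M]
    [IsManifold (𝓡∂ (m + 1)) ∞ M] [T2Space M] [SigmaCompactSpace M]
    {N : Type*} [TopologicalSpace N] [ChartedSpace (EuclideanSpace ℝ (Fin m)) N]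
    [IsManifold (𝓡 m) ∞ N] [T2Space N] [SigmaCompactSpace N]
    (ι : C^∞⟮𝓡 m, N; 𝓡∂ (m + 1), M⟯)
    (hι : Manifold.IsSmoothEmbedding (𝓡 m) (𝓡∂ (m + 1)) ∞ ι)
    (hrange : Set.range ι = (𝓡∂ (m + 1)).boundary M) :
    (∃ (_ : ∀ x : N, Module (DiffOpStalk (𝓡 m) x)ᵐᵒᵖ (DensityStalk (𝓡 m) x))
       (_ : ∀ x : N, Module (DiffOpStalk (𝓡 m) x) (TransferStalk ι x)),
      IsFormalAdjointAction (J := 𝓡 m) (N := N) ∧ IsPullbackConnection ι ∧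
      ∃ e : ∀ U : Opens M, pushforward ι U ≃ₗ[(DiffOp (𝓡∂ (m + 1)) U)ᵐᵒᵖ]
          generatedSheaf (𝓡∂ (m + 1)) (boundaryDensities ι) U,
        (∀ (U U' : Opens M) (h : U' ≤ U) (s : pushforward ι U),
          e U' (pushforward.res ι h s) =
            generatedSheaf.res (𝓡∂ (m + 1)) (boundaryDensities ι) h (e U s)) ∧
        ∀ (U : Opens M) (ν : Density (𝓡 m) (preim ι U)) (f : SmoothFn (𝓡 m) (preim ι U))
          (D : DiffOp (𝓡∂ (m + 1)) U) (g : TestFn (𝓡∂ (m + 1)) U),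
          (e U (pushforward.tmul ι ν f D)).1 g =
            ν.integral (𝓡 m) (fun x => extendZero f x * (D • g) (ι x))) ∧
    ∀ (c : Collar ι) (U : Opens M) (T : Distribution (𝓡∂ (m + 1)) U),
      T ∈ generatedSheaf (𝓡∂ (m + 1)) (boundaryDensities ι) U ↔
        ∃ ν : ℕ → Density (𝓡 m) (preim ι U), IsLocallyFinite ν ∧
          ∀ g : TestFn (𝓡∂ (m + 1)) U,
            T g = ∑ᶠ k, (ν k).integral (𝓡 m) (c.normalDeriv k g) := by
  have hb : HasBoundaryCoordinates ι := exists_boundaryCoordinates hι hrange.subset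
  have hc : IsClosedEmbedding ι :=
    ⟨hι.isEmbedding, hrange ▸ ModelWithCorners.isClosed_boundary (n := ∞) (by simp)⟩
  let _ : ∀ x : N, Module (DiffOpStalk (𝓡 m) x)ᵐᵒᵖ (DensityStalk (𝓡 m) x) := densityStalkModule
  let _ : ∀ x : N, Module (DiffOpStalk (𝓡 m) x) (TransferStalk ι x) := hb.transferModule
  have ha : IsOperatorAction ι := ⟨DensityStalk.adjoint_germ, hb.toOperator_smul⟩
  refine ⟨⟨densityStalkModule, hb.transferModule, fun V ν Q => ?_, hb.isPullbackConnection,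
    fun U => LinearEquiv.ofBijective (pushforward.toGenerated hc ha hb U)
      (pushforward.toGenerated_bijective hc ha hb U), fun U U' h s => ?_, fun U ν f D g => ?_⟩,
    fun c U T => ⟨fun hT => ha.exists_isLocallyFinite c hb hc hT, fun ⟨ν, hν, hT⟩ =>
      hν.mem_generatedSheaf c hc hT⟩⟩
  · obtain ⟨ν', hν'⟩ := exists_isAdjoint Q ν
    exact ⟨ν', hν', fun x hx => ha.smul_germ hx hν'⟩
  · exact Subtype.ext ((pushforward.represents_toGenerated hc ha hb (pushforward.res ι h s)).unique
      ((pushforward.represents_toGenerated hc ha hb s).res h))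
  · have h1 := (pushforward.represents_toGenerated hc ha hb (pushforward.tmul ι ν f D)).unique
      (Represents.tmul ν f D)
    refine (congrArg (fun T : Distribution (𝓡∂ (m + 1)) U => T g) h1).trans ?_
    exact Density.integral_mulFn f ν _
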